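/- For $N\ge 1$ let $\rho_N(x)=\int_{\Omega^{N-1}}P_N(x,x_2,\dots,x_N)\,dx_2\cdots dx_N$ be the marginal density of the probability density on $\Omega^N$ $$P_N(x_1,\dots,x_N)\propto\prod_{l=1}^N\omega_N(x_l)\prod_{1\le j<k\le N}(x_k-x_j)^2 ,$$ where $\omega_N(x)=e^{-2Nx^2}$ and $\Omega=\mathbb R$ for the Gaussian unitary ensemble (GUE), and $\omega_N(x)=x^{\alpha}e^{-4Nx}$ and $\Omega=(0,\infty)$ for the Laguerre unitary ensemble (LUE) with a fixed real parameter $\alpha>-1$. Let $\mathrm{Ai}$ be the Airy function. Then for each fixed $\xi\in\mathbb R$, as $N\to\infty$, the GUE density satisfies $$\frac{N^{1/3}}{2}\,\rho_N\Big(1+\frac{\xi}{2N^{2/3}}\Big)=\mathrm{Ai}'(\xi)^2-\xi\,\mathrm{Ai}(\xi)^2-\frac1{20}\Big(3\xi^2\mathrm{Ai}(\xi)^2-2\xi\,\mathrm{Ai}'(\xi)^2-3\,\mathrm{Ai}(\xi)\mathrm{Ai}'(\xi)\Big)\frac1{N^{2/3}}+O\Big(\frac1N\Big),$$ and the LUE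 density satisfies $$\frac{(2N)^{1/3}}{2}\,\rho_N\Big(1+\frac{\xi}{(2N)^{2/3}}\Big)=\mathrm{Ai}'(\xi)^2-\xi\,\mathrm{Ai}(\xi)^2+\frac{\alpha}{2^{1/3}}\mathrm{Ai}(\xi)^2\frac1{N^{1/3}}+\frac{2^{1/3}}{10}\Big(3\xi^2\mathrm{Ai}(\xi)^2-2\xi\,\mathrm{Ai}'(\xi)^2+(2-5\alpha^2)\mathrm{Ai}(\xi)\mathrm{Ai}'(\xi)\Big)\frac1{N^{2/3}}+O\Big(\frac1N\Big).$$ The implied constants may depend on $\xi$ and, for the LUE, on $\alpha$. -/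

import Mathlib

open MeasureTheory Filter Asymptotics

noncomputable section

/-- The unnormalised joint eigenvalue density of a unitary ensemble with weight `w`:
`∏_l w(x_l) · ∏_{j<k} (x_k - x_j)²`. -/
def jointWeight (w : ℝ → ℝ) (N : ℕ) (x : Fin N → ℝ) : ℝ :=
  (∏ l, w (x l)) * ∏ j, ∏ k ∈ Finset.Ioi j, (x k - x j) ^ 2

/-- The normalisation constant: the integral of `jointWeight` over `Ω^N`. -/
def partitionFunction (w : ℝ → ℝ) (Ω : Set ℝ) (N : ℕ) : ℝ :=
  ∫ x in Set.univ.pi (fun _ : Fin N => Ω), jointWeight w N x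

/-- The joint eigenvalue probability density function `P_N` on `Ω^N`. -/
def jointDensity (w : ℝ → ℝ) (Ω : Set ℝ) (N : ℕ) (x : Fin N → ℝ) : ℝ :=
  jointWeight w N x / partitionFunction w Ω N

/-- The marginal density `ρ_N(x) = ∫_{Ω^{N-1}} P_N(x, x₂, …, x_N) dx₂ ⋯ dx_N`, meant for `N ≥ 1`
and `x ∈ Ω` (the value at `N = 0` is a convention). -/
def marginalDensity (w : ℝ → ℝ) (Ω : Set ℝ) : ℕ → ℝ → ℝ
  | 0, _ => 0
  | n + 1, x => ∫ y in Set.univ.pi (fun _ : Fin n => Ω),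
      jointDensity w Ω (n + 1) (Fin.cons x y : Fin (n + 1) → ℝ)

/-- The GUE weight `exp(-2 N x²)` on `ℝ`. -/
def gueWeight (N : ℕ) (x : ℝ) : ℝ := Real.exp (-2 * N * x ^ 2)

/-- The LUE weight `x^α exp(-4 N x)` on `(0, ∞)`. -/
def lueWeight (α : ℝ) (N : ℕ) (x : ℝ) : ℝ := x ^ α * Real.exp (-4 * N * x)

/-- The eigenvalue density `ρ_N` of the GUE. -/
def gueDensity (N : ℕ) (x : ℝ) : ℝ := marginalDensity (gueWeight N) Set.univ N x

/-- The eigenvalue density `ρ_N` of the LUE with parameter `α`. -/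
def lueDensity (α : ℝ) (N : ℕ) (x : ℝ) : ℝ := marginalDensity (lueWeight α N) (Set.Ioi 0) N x

/-- The integral of `exp (z³/3 - ξ z)` along the ray from `0` to `∞` through the point `ω`. -/
def airyRay (ω : ℂ) (ξ : ℝ) : ℂ :=
  ∫ t in Set.Ioi (0 : ℝ), ω * Complex.exp ((t * ω) ^ 3 / 3 - ξ * (t * ω))

/-- The contour integral `(2πi)⁻¹ ∫ exp (z³/3 - ξ z) dz`, along the contour which comes in from
`∞ e^{-iπ/3}` to `0` on a ray and goes out to `∞ e^{iπ/3}` on a ray. -/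
def airyContour (ξ : ℝ) : ℂ :=
  (2 * Real.pi * Complex.I)⁻¹ *
    (airyRay (Complex.exp (Complex.I * Real.pi / 3)) ξ -
      airyRay (Complex.exp (-(Complex.I * Real.pi / 3))) ξ)

/-- The Airy function `Ai` on the real line; the contour integral is real
(`airyContour_eq_airyAi`). -/
def airyAi (ξ : ℝ) : ℝ := (airyContour ξ).re

theorem airyContour_eq_airyAi (ξ : ℝ) : airyContour ξ = (airyAi ξ : ℂ) := by
  have h (ω : ℂ) : airyRay ((starRingEnd ℂ) ω) ξ = (starRingEnd ℂ) (airyRay ω ξ) := by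
    unfold airyRay
    rw [← integral_conj]
    simp [← Complex.exp_conj, map_ofNat]
  have hω : Complex.exp (-(Complex.I * Real.pi / 3)) =
      (starRingEnd ℂ) (Complex.exp (Complex.I * Real.pi / 3)) := by
    rw [← Complex.exp_conj]
    simp [neg_div, map_ofNat]
  apply Eq.symm
  apply Complex.conj_eq_iff_re.mp
  unfold airyContour
  rw [hω, h]
  simp [map_ofNat]
  ring

end

/-! Expanding the squared Vandermonde determinant in the monic orthogonal polynomials `p_k` of the
weight, with squared norms `h_k`, turns the marginal into `w(x) ∑_{k<N} p_k(x)²/h_k / N`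
(`marginalDensity_succ_eq`). For the Hermite and Laguerre weights this sum collapses to a quadratic
form in `p_N(x)` and `p_N'(x)` alone (`hermite_christoffel`, `laguerre_christoffel`).

Both values are integrals along the very contour that defines `Ai`
(`hermiteMonic_eval_eq_hermiteInt`, `laguerreMonic_eval_eq_laguerreInt` and their derivative
versions). Integration by parts on the contour reproduces the recurrences of the polynomials, so
only one initial integral has to be evaluated: a Gaussian for Hermite, a residue at `v = 1` for
Laguerre.

At the edge `v = 0` is a double saddle. Put `v = ε u` with `ε = N^(-1/3)` for the GUE and `ε =
(2N)^(-1/3)` for the LUE; the integrand becomes a perturbation of `u^k exp(u³/3 - ξ u)`. The real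
part of the phase is controlled on the whole of both rays, so the contour need not be deformed, and
splitting at `ε |u| = δ` gives an expansion to order `ε²` with error `O(ε³)`
(`AiryPhase.wedgeInt_perturbedAiry_isBigO`). Its coefficients are moments of the Airy integrand,
which the Airy equation reduces to `Ai` and `Ai'` (`inv_mul_airyMoment`).

In the quadratic form the two leading orders in `ε` cancel identically, before anything is expanded
(`gueDensity_edge`, `lueDensity_edge`), so second order expansions suffice. The normalising
constants are `1 + O(1/N)` by Stirling's formula with a rate, and `1/N` is of the order of `ε³`.
Multiplying the expansions leaves polynomial identities in `ξ`, `α`, `Ai` and `Ai'`. -/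

noncomputable section

/-! ### The one-point density of a unitary ensemble as a Christoffel sum. -/

-- Monic polynomials of degrees `0, …, N-1` have the same determinant at the nodes as the powers, by
-- column operations. The double sum is the Leibniz formula applied to each of the two factors of
-- the square.
open Polynomial in
theorem jointWeight_eq_sum (w : ℝ → ℝ) (p : ℕ → ℝ[X]) (hp : ∀ k, (p k).Monic)
    (hd : ∀ k, (p k).natDegree = k) (N : ℕ) (x : Fin N → ℝ) :
    jointWeight w N x = ∑ σ : Equiv.Perm (Fin N), ∑ τ : Equiv.Perm (Fin N),
      ((σ.sign : ℤ) : ℝ) * ((τ.sign : ℤ) : ℝ) *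
        ∏ i, (w (x i) * (p (σ i)).eval (x i) * (p (τ i)).eval (x i)) := by
  have hV : ∏ j, ∏ k ∈ Finset.Ioi j, (x k - x j) =
      ∑ σ : Equiv.Perm (Fin N), ((σ.sign : ℤ) : ℝ) * ∏ i, (p (σ i)).eval (x i) := by
    rw [← Matrix.det_vandermonde, Matrix.det_eval_matrixOfPolynomials_eq_det_vandermonde x
      (fun i => p i) (fun i => hd i) (fun i => hp i), ← Matrix.det_transpose, Matrix.det_apply']
    rfl
  simp only [jointWeight, Finset.prod_pow]
  rw [hV, sq, Finset.sum_mul_sum, Finset.mul_sum]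
  refine Finset.sum_congr rfl fun σ _ => ?_
  rw [Finset.mul_sum]
  refine Finset.sum_congr rfl fun τ _ => ?_
  simp only [Finset.prod_mul_distrib]
  ring

theorem setIntegral_univ_pi_prod {ι : Type*} [Fintype ι] (Ω : Set ℝ) (f : ι → ℝ → ℝ) :
    ∫ x in Set.univ.pi (fun _ : ι => Ω), ∏ i, f i (x i) = ∏ i, ∫ x in Ω, f i x := by
  rw [volume_pi, Measure.restrict_pi_pi, integral_fintype_prod_eq_prod]

theorem integrableOn_univ_pi_prod {ι : Type*} [Fintype ι] (Ω : Set ℝ) (f : ι → ℝ → ℝ)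
    (hf : ∀ i, IntegrableOn (f i) Ω) :
    IntegrableOn (fun x : ι → ℝ => ∏ i, f i (x i)) (Set.univ.pi fun _ : ι => Ω) := by
  rw [IntegrableOn, volume_pi, Measure.restrict_pi_pi]
  exact Integrable.fintype_prod hf

theorem sum_perm_apply_zero (n : ℕ) (f : Fin (n + 1) → ℝ) :
    ∑ σ : Equiv.Perm (Fin (n + 1)), f (σ 0) = n.factorial * ∑ k, f k := by
  rw [← Equiv.sum_comp Equiv.Perm.decomposeFin.symm, Fintype.sum_prod_type]
  simp [Finset.mul_sum, Fintype.card_perm]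

open Polynomial in
/-- The one-point marginal of a unitary ensemble as a Christoffel sum over monic orthogonal
polynomials. -/
theorem marginalDensity_succ_eq (w : ℝ → ℝ) (Ω : Set ℝ) (p : ℕ → ℝ[X]) (hp : ∀ k, (p k).Monic)
    (hd : ∀ k, (p k).natDegree = k) (h : ℕ → ℝ) (hh : ∀ k, h k ≠ 0)
    (hi : ∀ i j, IntegrableOn (fun x => w x * (p i).eval x * (p j).eval x) Ω)
    (ho : ∀ i j, ∫ x in Ω, w x * (p i).eval x * (p j).eval x = if i = j then h i else 0)
    (n : ℕ) (x : ℝ) :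
    marginalDensity w Ω (n + 1) x =
      w x * (∑ k ∈ Finset.range (n + 1), (p k).eval x ^ 2 / h k) / (n + 1) := by
  have hprod (σ : Equiv.Perm (Fin (n + 1))) : ∏ i, h (σ i) = ∏ i : Fin (n + 1), h i :=
    Equiv.prod_comp σ fun i : Fin (n + 1) => h i
  -- Orthogonality kills every pair with `σ ≠ τ`. Each diagonal pair contributes the same product of
  -- norms, and there are `(n+1)!` of them.
  have hZ : partitionFunction w Ω (n + 1) = (n + 1).factorial * ∏ i : Fin (n + 1), h i := by
    simp only [partitionFunction, jointWeight_eq_sum w p hp hd]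
    rw [integral_finsetSum _ fun σ _ => integrable_finsetSum _ fun τ _ =>
      (integrableOn_univ_pi_prod Ω (fun i x => w x * (p (σ i)).eval x * (p (τ i)).eval x)
        fun i => hi _ _).const_mul _]
    have (σ : Equiv.Perm (Fin (n + 1))) : ∫ x in Set.univ.pi (fun _ : Fin (n + 1) => Ω),
        ∑ τ : Equiv.Perm (Fin (n + 1)), ((σ.sign : ℤ) : ℝ) * ((τ.sign : ℤ) : ℝ) *
        ∏ i, (w (x i) * (p (σ i)).eval (x i) * (p (τ i)).eval (x i)) =
        ∏ i : Fin (n + 1), h i := by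
      rw [integral_finsetSum _ fun τ _ =>
        (integrableOn_univ_pi_prod Ω (fun i x => w x * (p (σ i)).eval x * (p (τ i)).eval x)
          fun i => hi _ _).const_mul _, Finset.sum_eq_single σ]
      · rw [integral_const_mul, setIntegral_univ_pi_prod Ω
          (fun i x => w x * (p (σ i)).eval x * (p (σ i)).eval x)]
        simp only [ho, if_true, hprod]
        rcases Int.units_eq_one_or σ.sign with hs | hs <;> simp [hs]
      · intro τ _ hτ
        rw [integral_const_mul, setIntegral_univ_pi_prod Ω
          (fun i x => w x * (p (σ i)).eval x * (p (τ i)).eval x)]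
        obtain ⟨i, hi⟩ : ∃ i, σ i ≠ τ i := by
          by_contra! hc
          exact hτ (Equiv.ext fun i => (hc i).symm)
        rw [Finset.prod_eq_zero (Finset.mem_univ i), mul_zero]
        rw [ho, if_neg fun hc => hi (Fin.ext hc)]
      · simp
    simp only [this]
    simp [Fintype.card_perm]
  have hM : ∫ y in Set.univ.pi (fun _ : Fin n => Ω),
      jointWeight w (n + 1) (Fin.cons x y : Fin (n + 1) → ℝ) =
      w x * (n.factorial * ∑ k ∈ Finset.range (n + 1), (p k).eval x ^ 2 / h k) *
        ∏ i : Fin (n + 1), h i := by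
    simp only [jointWeight_eq_sum w p hp hd, Fin.prod_univ_succ, Fin.cons_zero, Fin.cons_succ]
    have hint (σ τ : Equiv.Perm (Fin (n + 1))) : IntegrableOn (fun y : Fin n → ℝ =>
        ((σ.sign : ℤ) : ℝ) * ((τ.sign : ℤ) : ℝ) *
        (w x * (p (σ 0)).eval x * (p (τ 0)).eval x *
        ∏ i : Fin n, (w (y i) * (p (σ i.succ)).eval (y i) * (p (τ i.succ)).eval (y i))))
        (Set.univ.pi (fun _ : Fin n => Ω)) :=
      ((integrableOn_univ_pi_prod Ω
        (fun (i : Fin n) x => w x * (p (σ i.succ)).eval x * (p (τ i.succ)).eval x)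
        fun i => hi _ _).const_mul _).const_mul _
    rw [integral_finsetSum _ fun σ _ => integrable_finsetSum _ fun τ _ => hint σ τ]
    have (σ : Equiv.Perm (Fin (n + 1))) : ∫ y in Set.univ.pi (fun _ : Fin n => Ω),
        ∑ τ : Equiv.Perm (Fin (n + 1)), ((σ.sign : ℤ) : ℝ) * ((τ.sign : ℤ) : ℝ) *
        (w x * (p (σ 0)).eval x * (p (τ 0)).eval x *
        ∏ i : Fin n, (w (y i) * (p (σ i.succ)).eval (y i) * (p (τ i.succ)).eval (y i))) =
        w x * ((p (σ 0)).eval x ^ 2 / h (σ 0)) * ∏ i : Fin (n + 1), h i := by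
      rw [integral_finsetSum _ fun τ _ => hint σ τ, Finset.sum_eq_single σ]
      · rw [integral_const_mul, integral_const_mul, setIntegral_univ_pi_prod Ω
          (fun (i : Fin n) x => w x * (p (σ i.succ)).eval x * (p (σ i.succ)).eval x)]
        simp only [ho, if_true]
        rw [← hprod σ, Fin.prod_univ_succ]
        have := hh (σ 0)
        rcases Int.units_eq_one_or σ.sign with hs | hs <;> simp [hs] <;> field_simp
      · intro τ _ hτ
        rw [integral_const_mul, integral_const_mul, setIntegral_univ_pi_prod Ω
          (fun (i : Fin n) x => w x * (p (σ i.succ)).eval x * (p (τ i.succ)).eval x)]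
        obtain ⟨i, hi⟩ : ∃ i : Fin n, σ i.succ ≠ τ i.succ := by
          by_contra! hc
          refine hτ (Equiv.ext fun i => ?_)
          refine Fin.cases ?_ (fun i => (hc i).symm) i
          -- The variable with index `0` is not integrated, so orthogonality only compares `σ` and
          -- `τ` on the successors. Two bijections that agree there also agree at `0`.
          obtain ⟨j, hj⟩ := σ.surjective (τ 0)
          refine Fin.cases (fun h => h.symm) (fun j hj => ?_) j hj
          rw [hc] at hj
          exact absurd (τ.injective hj) (Fin.succ_ne_zero j)
        rw [Finset.prod_eq_zero (Finset.mem_univ i), mul_zero, mul_zero]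
        rw [ho, if_neg fun hc => hi (Fin.ext hc)]
      · simp
    simp only [this]
    rw [← Finset.sum_mul, ← Finset.mul_sum,
      sum_perm_apply_zero n fun k => (p k).eval x ^ 2 / h k, Finset.sum_range,
      Fin.prod_univ_succ fun i : Fin (n + 1) => h i]
  have hP : ∏ i : Fin (n + 1), h i ≠ 0 := Finset.prod_ne_zero_iff.mpr fun i _ => hh i
  have hn : (n.factorial : ℝ) ≠ 0 := by positivity
  simp only [marginalDensity, jointDensity]
  rw [integral_div, hM, hZ, Nat.factorial_succ]
  push_cast
  field_simp

/-! ### Monic Hermite polynomials. -/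

open Polynomial in
theorem iterate_derivative_of_monic (p : ℝ[X]) (k : ℕ) (hp : p.Monic) (hd : p.natDegree = k) :
    derivative^[k] p = C (k.factorial : ℝ) := by
  have h0 : (derivative^[k] p).natDegree = 0 := by
    have := natDegree_iterate_derivative p k
    omega
  rw [eq_C_of_natDegree_eq_zero h0, coeff_iterate_derivative]
  have : p.coeff k = 1 := by rw [← hd]; exact hp
  simp [this, Nat.descFactorial_self]

open Polynomial in
theorem monic_X_mul_sub {p q : ℝ[X]} {k : ℕ} (hp : p.Monic) (hd : p.natDegree = k)
    (hq : q.natDegree ≤ k) : (X * p - q).Monic ∧ (X * p - q).natDegree = k + 1 := by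
  have h1 : (X * p).Monic := monic_X.mul hp
  have h2 : (X * p).natDegree = k + 1 := by rw [natDegree_X_mul hp.ne_zero, hd]
  have h3 : q.degree < (X * p).degree := by
    refine lt_of_le_of_lt degree_le_natDegree ?_
    rw [degree_eq_natDegree h1.ne_zero, h2]
    exact_mod_cast Nat.lt_succ_of_le hq
  refine ⟨h1.sub_of_left h3, ?_⟩
  rw [natDegree_eq_of_degree_eq (degree_sub_eq_left_of_degree_lt h3), h2]

open Polynomial in
/-- The monic orthogonal polynomials of the weight `exp (-a x²)`. -/
def hermiteMonic (a : ℝ) : ℕ → ℝ[X]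
  | 0 => 1
  | k + 1 => X * hermiteMonic a k - C (1 / (2 * a)) * derivative (hermiteMonic a k)

-- The Appell property. Differentiating the recursion gives `p_{k+1}` plus `k + 1` times the
-- recursion for `p_{k+1}` itself.
open Polynomial in
theorem derivative_hermiteMonic (a : ℝ) (k : ℕ) :
    derivative (hermiteMonic a (k + 1)) = C ((k : ℝ) + 1) * hermiteMonic a k := by
  induction k with
  | zero => simp [hermiteMonic]
  | succ k ih =>
    rw [hermiteMonic, derivative_sub, derivative_mul, derivative_C_mul, ih, derivative_C_mul]
    conv_rhs => rw [hermiteMonic]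
    conv_lhs => enter [1, 1, 2]; rw [hermiteMonic]
    simp only [derivative_X, map_add, map_one, Nat.cast_add, Nat.cast_one]
    ring

open Polynomial in
theorem hermiteMonic_monic_natDegree (a : ℝ) (k : ℕ) :
    (hermiteMonic a k).Monic ∧ (hermiteMonic a k).natDegree = k := by
  induction k with
  | zero => simp [hermiteMonic]
  | succ k ih =>
    refine monic_X_mul_sub ih.1 ih.2 ((natDegree_C_mul_le _ _).trans ?_)
    exact (natDegree_derivative_le _).trans (by omega)

open Polynomial in
theorem integrable_eval_mul_gaussian {a : ℝ} (ha : 0 < a) (q : ℝ[X]) :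
    Integrable fun x : ℝ => Real.exp (-a * x ^ 2) * q.eval x := by
  induction q using Polynomial.induction_on' with
  | add p q hp hq =>
    simp only [eval_add, mul_add]
    exact hp.add hq
  | monomial n c =>
    have := (integrable_rpow_mul_exp_neg_mul_sq ha (s := n)
      (by have : (0:ℝ) ≤ n := n.cast_nonneg; linarith)).const_mul c
    refine this.congr (ae_of_all _ fun x => ?_)
    simp only [eval_monomial, Real.rpow_natCast]
    ring

-- The recursion is Rodrigues' formula: `exp(-a x²) p_{k+1}` is `-1/(2a)` times the derivative of
-- `exp(-a x²) p_k`. Integration by parts moves that derivative onto `q`; iterating it gives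
-- orthogonality, since `k` derivatives annihilate polynomials of degree below `k`.
open Polynomial in
theorem integral_gaussian_mul_hermiteMonic_succ {a : ℝ} (ha : 0 < a) (q : ℝ[X]) (k : ℕ) :
    ∫ x : ℝ, Real.exp (-a * x ^ 2) * (q * hermiteMonic a (k + 1)).eval x =
      1 / (2 * a) * ∫ x : ℝ, Real.exp (-a * x ^ 2) * (derivative q * hermiteMonic a k).eval x := by
  have hd (x : ℝ) : HasDerivAt
      (fun x => -(1 / (2 * a)) * (Real.exp (-a * x ^ 2) * (q * hermiteMonic a k).eval x))
      (Real.exp (-a * x ^ 2) * (q * hermiteMonic a (k + 1) -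
        C (1 / (2 * a)) * (derivative q * hermiteMonic a k)).eval x) x := by
    have h1 := (((hasDerivAt_pow 2 x).const_mul (-a)).exp.mul
      ((q * hermiteMonic a k).hasDerivAt x)).const_mul (-(1 / (2 * a)))
    refine h1.congr_deriv ?_
    simp [hermiteMonic]
    field_simp
    ring
  have h0 := integral_eq_zero_of_hasDerivAt_of_integrable hd
    (integrable_eval_mul_gaussian ha _) ((integrable_eval_mul_gaussian ha _).const_mul _)
  have he (x : ℝ) : Real.exp (-a * x ^ 2) * (q * hermiteMonic a (k + 1) -
        C (1 / (2 * a)) * (derivative q * hermiteMonic a k)).eval x =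
      Real.exp (-a * x ^ 2) * (q * hermiteMonic a (k + 1)).eval x -
      1 / (2 * a) * (Real.exp (-a * x ^ 2) * (derivative q * hermiteMonic a k).eval x) := by
    simp; ring
  simp only [he] at h0
  rw [integral_sub (integrable_eval_mul_gaussian ha _)
    ((integrable_eval_mul_gaussian ha _).const_mul _), integral_const_mul] at h0
  linarith

open Polynomial in
theorem integral_gaussian_mul_hermiteMonic {a : ℝ} (ha : 0 < a) (q : ℝ[X]) (k : ℕ) :
    ∫ x : ℝ, Real.exp (-a * x ^ 2) * (q * hermiteMonic a k).eval x =
      (1 / (2 * a)) ^ k * ∫ x : ℝ, Real.exp (-a * x ^ 2) * (derivative^[k] q).eval x := by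
  induction k generalizing q with
  | zero => simp [hermiteMonic]
  | succ k ih =>
    rw [integral_gaussian_mul_hermiteMonic_succ ha, ih, Function.iterate_succ_apply]
    ring

/-- The squared norm of `hermiteMonic a k` for the weight `exp (-a x²)`. -/
def hermiteNorm (a : ℝ) (k : ℕ) : ℝ := k.factorial / (2 * a) ^ k * √(Real.pi / a)

theorem hermiteNorm_pos {a : ℝ} (ha : 0 < a) (k : ℕ) : 0 < hermiteNorm a k := by
  have := Real.pi_pos
  unfold hermiteNorm
  positivity

theorem hermiteMonic_orthogonal {a : ℝ} (ha : 0 < a) (i j : ℕ) :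
    ∫ x : ℝ, Real.exp (-a * x ^ 2) * (hermiteMonic a i).eval x * (hermiteMonic a j).eval x =
      if i = j then hermiteNorm a i else 0 := by
  wlog hij : i ≤ j generalizing i j
  · have := this j i (by omega)
    rw [if_neg (by omega)] at this ⊢
    rw [← this]
    congr 1
    ext x
    ring
  have := integral_gaussian_mul_hermiteMonic ha (hermiteMonic a i) j
  simp only [Polynomial.eval_mul, ← mul_assoc] at this
  rw [this]
  split_ifs with h
  · subst h
    rw [iterate_derivative_of_monic _ i (hermiteMonic_monic_natDegree a i).1
      (hermiteMonic_monic_natDegree a i).2]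
    simp only [Polynomial.eval_C]
    rw [integral_mul_const, integral_gaussian, hermiteNorm, one_div, inv_pow]
    ring
  · rw [Polynomial.iterate_derivative_eq_zero]
    · simp
    · rw [(hermiteMonic_monic_natDegree a i).2]
      omega

/-- The Christoffel sum of the Hermite polynomials in terms of a single polynomial and its
derivative. -/
theorem hermite_christoffel {a : ℝ} (ha : 0 < a) (n : ℕ) (x : ℝ) :
    (∑ k ∈ Finset.range n, (hermiteMonic a k).eval x ^ 2 / hermiteNorm a k) * hermiteNorm a n =
      (hermiteMonic a n).derivative.eval x ^ 2 / (2 * a) -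
        x * (hermiteMonic a n).eval x * (hermiteMonic a n).derivative.eval x +
        n * (hermiteMonic a n).eval x ^ 2 := by
  induction n with
  | zero => simp [hermiteMonic]
  | succ n ih =>
    have hn : hermiteNorm a (n + 1) = (n + 1) / (2 * a) * hermiteNorm a n := by
      rw [hermiteNorm, hermiteNorm, Nat.factorial_succ]
      push_cast
      field_simp
      ring
    have h0 := (hermiteNorm_pos ha n).ne'
    rw [Finset.sum_range_succ, add_mul, hn]
    have e1 : (∑ k ∈ Finset.range n, (hermiteMonic a k).eval x ^ 2 / hermiteNorm a k) *
        ((n + 1) / (2 * a) * hermiteNorm a n) = (n + 1) / (2 * a) *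
        ((∑ k ∈ Finset.range n, (hermiteMonic a k).eval x ^ 2 / hermiteNorm a k) *
          hermiteNorm a n) := by ring
    -- Both `p_{n+1}` and its derivative `(n+1) p_n` are linear in `p_n` and `p_n'`, so the
    -- induction step is a polynomial identity in these two values.
    rw [e1, ih, derivative_hermiteMonic]
    simp only [hermiteMonic, Polynomial.eval_mul, Polynomial.eval_sub, Polynomial.eval_X,
      Polynomial.eval_C]
    push_cast
    field_simp
    ring

/-! ### Monic Laguerre polynomials. -/

open Polynomial in
/-- The monic orthogonal polynomials of the weight `x^α exp (-b x)`. -/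
def laguerreMonic (b : ℝ) : ℕ → ℝ → ℝ[X]
  | 0, _ => 1
  | n + 1, α => X * laguerreMonic b n (α + 1) - C ((n + α + 1) / b) * laguerreMonic b n α

theorem laguerreMonic_succ_eval (b : ℝ) (n : ℕ) (α x : ℝ) :
    (laguerreMonic b (n + 1) α).eval x =
      x * (laguerreMonic b n (α + 1)).eval x - (n + α + 1) / b * (laguerreMonic b n α).eval x := by
  simp [laguerreMonic]

/-- The monic form of the classical relation `L_n^(α) = L_n^(α+1) - L_{n-1}^(α+1)`. It allows the
parameter shift in the recursion to be undone. -/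
theorem laguerreMonic_eval_contiguous {b : ℝ} (hb : b ≠ 0) (n : ℕ) (α x : ℝ) :
    (laguerreMonic b (n + 1) α).eval x = (laguerreMonic b (n + 1) (α + 1)).eval x +
      (n + 1) / b * (laguerreMonic b n (α + 1)).eval x := by
  induction n generalizing α with
  | zero => simp [laguerreMonic]; field_simp; ring
  | succ n ih =>
    have h1 := ih α
    have h2 := ih (α + 1)
    have h3 := laguerreMonic_succ_eval b n (α + 1) x
    rw [laguerreMonic_succ_eval b (n + 1) α, laguerreMonic_succ_eval b (n + 1) (α + 1)]
    push_cast at *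
    linear_combination (-(n + 1 + α + 1) / b) * h1 + x * h2 - (n + 1) / b * h3

/-- At `n = 0` the truncated index `n - 1` is harmless because its coefficient vanishes. -/
theorem laguerreMonic_eval_eq {b : ℝ} (hb : b ≠ 0) (n : ℕ) (α x : ℝ) :
    (laguerreMonic b n α).eval x = (laguerreMonic b n (α + 1)).eval x +
      n / b * (laguerreMonic b (n - 1) (α + 1)).eval x := by
  cases n with
  | zero => simp [laguerreMonic]
  | succ n => simpa using laguerreMonic_eval_contiguous hb n α x

open Polynomial in
theorem derivative_laguerreMonic (b : ℝ) (n : ℕ) (α : ℝ) :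
    derivative (laguerreMonic b n α) = C (n : ℝ) * laguerreMonic b (n - 1) (α + 1) := by
  induction n generalizing α with
  | zero => simp [laguerreMonic]
  | succ n ih =>
    refine Polynomial.funext fun x => ?_
    rw [laguerreMonic, derivative_sub, derivative_mul, derivative_C_mul, ih, ih]
    cases n with
    | zero => simp [laguerreMonic]
    | succ n =>
      have h3 := laguerreMonic_succ_eval b n (α + 1) x
      simp only [derivative_X, eval_sub, eval_add, eval_mul, eval_C, eval_X, eval_one,
        Nat.add_sub_cancel]
      push_cast at *
      linear_combination (-(n + 1 : ℝ)) * h3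

open Polynomial in
theorem laguerreMonic_monic_natDegree (b : ℝ) (n : ℕ) (α : ℝ) :
    (laguerreMonic b n α).Monic ∧ (laguerreMonic b n α).natDegree = n := by
  induction n generalizing α with
  | zero => simp [laguerreMonic]
  | succ n ih =>
    refine monic_X_mul_sub (ih _).1 (ih _).2 ((natDegree_C_mul_le _ _).trans (ih _).2.le)

-- Rodrigues' formula in disguise: multiplied by `x^α exp(-b x)`, the right side is `-1/b` times the
-- derivative of `x^(α+1) exp(-b x)` times the polynomial of degree `n` and parameter `α + 1`.
open Polynomial in
theorem laguerreMonic_succ_eval_rodrigues {b : ℝ} (hb : b ≠ 0) (n : ℕ) (α x : ℝ) :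
    (laguerreMonic b (n + 1) α).eval x =
      (x - (α + 1) / b) * (laguerreMonic b n (α + 1)).eval x -
        x / b * (derivative (laguerreMonic b n (α + 1))).eval x := by
  rw [derivative_laguerreMonic, laguerreMonic_succ_eval, laguerreMonic_eval_eq hb n α]
  cases n with
  | zero => simp [laguerreMonic]
  | succ n =>
    have h3 := laguerreMonic_succ_eval b n (α + 1) x
    simp only [eval_mul, eval_C, Nat.add_sub_cancel]
    push_cast at *
    linear_combination (-(n + 1) / b) * h3

/-- The weight `x^α exp (-b x)`. -/
def laguerreWeight (b α x : ℝ) : ℝ := x ^ α * Real.exp (-b * x)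

open Polynomial in
theorem integrableOn_laguerreWeight_mul_eval {b α : ℝ} (hb : 0 < b) (hα : -1 < α) (q : ℝ[X]) :
    IntegrableOn (fun x : ℝ => laguerreWeight b α x * q.eval x) (Set.Ioi 0) := by
  induction q using Polynomial.induction_on' with
  | add p q hp hq =>
    simp only [eval_add, mul_add]
    exact hp.add hq
  | monomial n c =>
    have hn : (0 : ℝ) ≤ n := n.cast_nonneg
    have := (integrableOn_rpow_mul_exp_neg_mul_rpow (p := 1) (s := α + n) (b := b)
      (by linarith) zero_lt_one hb).const_mul c
    refine IntegrableOn.congr_fun this (fun x hx => ?_) measurableSet_Ioi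
    simp only [eval_monomial, laguerreWeight, Real.rpow_one, Real.rpow_add (Set.mem_Ioi.mp hx),
      Real.rpow_natCast]
    ring

open Polynomial in
theorem integral_laguerreWeight_mul_succ {b α : ℝ} (hb : 0 < b) (hα : -1 < α) (q : ℝ[X])
    (n : ℕ) :
    ∫ x in Set.Ioi (0 : ℝ), laguerreWeight b α x * (q * laguerreMonic b (n + 1) α).eval x =
      1 / b * ∫ x in Set.Ioi (0 : ℝ), laguerreWeight b (α + 1) x *
        (derivative q * laguerreMonic b n (α + 1)).eval x := by
  set p := laguerreMonic b n (α + 1) with hp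
  set f : ℝ → ℝ := fun x => -(1 / b) * (laguerreWeight b (α + 1) x * (q * p).eval x) with hf
  set f' : ℝ → ℝ := fun x => laguerreWeight b α x * (q * laguerreMonic b (n + 1) α).eval x -
    1 / b * (laguerreWeight b (α + 1) x * (derivative q * p).eval x) with hf'
  have hd (x : ℝ) (hx : x ∈ Set.Ioi (0 : ℝ)) : HasDerivAt f (f' x) x := by
    have hx0 : (0 : ℝ) < x := hx
    have h1 := (((Real.hasDerivAt_rpow_const (p := α + 1) (Or.inl hx0.ne')).mul
      ((hasDerivAt_id x).const_mul (-b)).exp).mul ((q * p).hasDerivAt x)).const_mul (-(1 / b))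
    refine h1.congr_deriv ?_
    simp only [hf', laguerreWeight, eval_mul, derivative_mul, eval_add,
      laguerreMonic_succ_eval_rodrigues hb.ne', ← hp, Real.rpow_add hx0, Real.rpow_one, id,
      add_sub_cancel_right, Pi.mul_apply]
    field_simp
    ring
  have hI1 := integrableOn_laguerreWeight_mul_eval hb hα (q * laguerreMonic b (n + 1) α)
  have hI2 := integrableOn_laguerreWeight_mul_eval hb (by linarith : -1 < α + 1)
    (derivative q * p)
  have hI' : IntegrableOn f' (Set.Ioi 0) := hI1.sub (hI2.const_mul _)
  have hI : IntegrableOn f (Set.Ioi 0) :=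
    (integrableOn_laguerreWeight_mul_eval hb (by linarith : -1 < α + 1) (q * p)).const_mul _
  -- The boundary term at `0` vanishes because `α + 1 > 0`. Only continuity holds there in general,
  -- as `x^(α+1)` need not be differentiable at `0`.
  have hc : ContinuousWithinAt f (Set.Ici 0) 0 := by
    refine ContinuousAt.continuousWithinAt ?_
    have := Real.continuousAt_rpow_const (0 : ℝ) (α + 1) (Or.inr (by linarith))
    simp only [hf, laguerreWeight]
    refine continuousAt_const.mul ((this.mul (by fun_prop)).mul ?_)
    exact (q * p).continuous.continuousAt
  have h0 := integral_Ioi_of_hasDerivAt_of_tendsto hc hd hI'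
    (tendsto_zero_of_hasDerivAt_of_integrableOn_Ioi hd hI' hI)
  have hf0 : f 0 = 0 := by
    simp [hf, laguerreWeight, Real.zero_rpow (by linarith : α + 1 ≠ 0)]
  rw [hf0, hf', integral_sub hI1 (hI2.const_mul _), integral_const_mul] at h0
  linarith

open Polynomial in
theorem integral_laguerreWeight_mul {b α : ℝ} (hb : 0 < b) (hα : -1 < α) (q : ℝ[X]) (n : ℕ) :
    ∫ x in Set.Ioi (0 : ℝ), laguerreWeight b α x * (q * laguerreMonic b n α).eval x =
      (1 / b) ^ n * ∫ x in Set.Ioi (0 : ℝ), laguerreWeight b (α + n) x *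
        (derivative^[n] q).eval x := by
  induction n generalizing q α with
  | zero => simp [laguerreMonic]
  | succ n ih =>
    rw [integral_laguerreWeight_mul_succ hb hα, ih (by linarith), Function.iterate_succ_apply]
    push_cast
    rw [show α + 1 + (n : ℝ) = α + (n + 1) by ring]
    ring

/-- The squared norm of `laguerreMonic b n α` for the weight `x^α exp (-b x)`. -/
def laguerreNorm (b α : ℝ) (n : ℕ) : ℝ :=
  n.factorial * Real.Gamma (n + α + 1) / (b ^ (2 * n) * b ^ (α + 1))

theorem laguerreNorm_pos {b α : ℝ} (hb : 0 < b) (hα : -1 < α) (n : ℕ) :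
    0 < laguerreNorm b α n := by
  have hn : (0 : ℝ) ≤ n := n.cast_nonneg
  have := Real.Gamma_pos_of_pos (by linarith : 0 < n + α + 1)
  unfold laguerreNorm
  positivity

theorem laguerreMonic_orthogonal {b α : ℝ} (hb : 0 < b) (hα : -1 < α) (i j : ℕ) :
    ∫ x in Set.Ioi (0 : ℝ), laguerreWeight b α x * (laguerreMonic b i α).eval x *
      (laguerreMonic b j α).eval x = if i = j then laguerreNorm b α i else 0 := by
  wlog hij : i ≤ j generalizing i j
  · have := this j i (by omega)
    rw [if_neg (by omega)] at this ⊢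
    exact (setIntegral_congr_fun measurableSet_Ioi fun x _ => mul_right_comm _ _ _).trans this
  have := integral_laguerreWeight_mul hb hα (laguerreMonic b i α) j
  simp only [Polynomial.eval_mul, ← mul_assoc] at this
  rw [this]
  split_ifs with h
  · subst h
    have hi : (0 : ℝ) ≤ i := i.cast_nonneg
    rw [iterate_derivative_of_monic _ i (laguerreMonic_monic_natDegree b i α).1
      (laguerreMonic_monic_natDegree b i α).2]
    simp only [Polynomial.eval_C, laguerreWeight]
    have hG := Real.integral_rpow_mul_exp_neg_mul_Ioi (a := α + i + 1) (r := b) (by linarith) hb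
    simp only [add_sub_cancel_right, ← neg_mul] at hG
    rw [integral_mul_const, hG, laguerreNorm, show (i : ℝ) + α + 1 = α + i + 1 by ring,
      Real.div_rpow zero_le_one hb.le, Real.one_rpow, show α + i + 1 = (α + 1) + i by ring,
      Real.rpow_add hb, Real.rpow_natCast, one_div, inv_pow]
    field_simp
    ring
  · rw [Polynomial.iterate_derivative_eq_zero]
    · simp
    · rw [(laguerreMonic_monic_natDegree b i α).2]
      omega

/-- The Christoffel sum of the Laguerre polynomials in terms of a single polynomial and its
derivative. -/
theorem laguerre_christoffel {b α : ℝ} (hb : 0 < b) (hα : -1 < α) (n : ℕ) (x : ℝ) :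
    (∑ k ∈ Finset.range n, (laguerreMonic b k α).eval x ^ 2 / laguerreNorm b α k) *
        laguerreNorm b α n =
      (x * (laguerreMonic b n α).derivative.eval x ^ 2 +
        (α - b * x) * (laguerreMonic b n α).eval x * (laguerreMonic b n α).derivative.eval x +
        b * n * (laguerreMonic b n α).eval x ^ 2) / b := by
  induction n with
  | zero => simp [laguerreMonic]
  | succ n ih =>
    have hn0 : (0 : ℝ) ≤ n := n.cast_nonneg
    have hn : laguerreNorm b α (n + 1) =
        (n + 1) * (n + α + 1) / b ^ 2 * laguerreNorm b α n := by
      rw [laguerreNorm, laguerreNorm, Nat.factorial_succ, Nat.cast_add, Nat.cast_one,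
        show (n : ℝ) + 1 + α + 1 = n + α + 1 + 1 by ring,
        Real.Gamma_add_one (by linarith : n + α + 1 ≠ 0)]
      push_cast
      field_simp
      ring
    have h0 := (laguerreNorm_pos hb hα n).ne'
    rw [Finset.sum_range_succ, add_mul, hn]
    have e1 : (∑ k ∈ Finset.range n, (laguerreMonic b k α).eval x ^ 2 / laguerreNorm b α k) *
        ((n + 1) * (n + α + 1) / b ^ 2 * laguerreNorm b α n) = (n + 1) * (n + α + 1) / b ^ 2 *
        ((∑ k ∈ Finset.range n, (laguerreMonic b k α).eval x ^ 2 / laguerreNorm b α k) *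
          laguerreNorm b α n) := by ring
    -- With `e2` and `e3`, the polynomial of degree `n + 1` and its derivative are linear in the
    -- polynomial of degree `n` and its derivative at the same parameter `α`, so the induction
    -- closes algebraically.
    have e2 : (laguerreMonic b n (α + 1)).eval x = (laguerreMonic b n α).eval x -
        (laguerreMonic b n α).derivative.eval x / b := by
      rw [derivative_laguerreMonic, laguerreMonic_eval_eq hb.ne' n α]
      simp
      ring
    have e3 : (laguerreMonic b (n + 1) α).derivative.eval x =
        (n + 1) * (laguerreMonic b n (α + 1)).eval x := by
      rw [derivative_laguerreMonic]
      simp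
    rw [e1, ih, e3, laguerreMonic_succ_eval, e2]
    push_cast
    field_simp
    ring

/-! ### Integration along the two rays of the Airy contour. -/

/-- The directions `exp (± iπ/3)` of the two rays of the Airy contour. -/
def AiryDir (ω : ℂ) : Prop := ω.re = 1 / 2 ∧ ω.im ^ 2 = 3 / 4

theorem airyDir_up : AiryDir (Complex.exp (Complex.I * Real.pi / 3)) := by
  have : Complex.I * Real.pi / 3 = ((Real.pi / 3 : ℝ) : ℂ) * Complex.I := by push_cast; ring
  rw [this, AiryDir, Complex.exp_ofReal_mul_I_re, Complex.exp_ofReal_mul_I_im]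
  simp only [Real.cos_pi_div_three, Real.sin_pi_div_three, div_pow]
  norm_num

theorem airyDir_down : AiryDir (Complex.exp (-(Complex.I * Real.pi / 3))) := by
  have : -(Complex.I * Real.pi / 3) = ((-(Real.pi / 3) : ℝ) : ℂ) * Complex.I := by
    push_cast; ring
  rw [this, AiryDir, Complex.exp_ofReal_mul_I_re, Complex.exp_ofReal_mul_I_im]
  simp only [Real.cos_neg, Real.sin_neg, Real.cos_pi_div_three, Real.sin_pi_div_three, neg_sq,
    div_pow]
  norm_num

namespace AiryDir

variable {ω : ℂ}

theorem normSq (h : AiryDir ω) : ω.re ^ 2 + ω.im ^ 2 = 1 := by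
  rw [h.1, h.2]; norm_num

theorem norm (h : AiryDir ω) : ‖ω‖ = 1 := by
  rw [← Real.sqrt_sq (norm_nonneg ω), Complex.sq_norm, Complex.normSq_apply, ← sq, ← sq,
    h.normSq, Real.sqrt_one]

theorem norm_ofReal_mul (h : AiryDir ω) {t : ℝ} (ht : 0 ≤ t) : ‖(t : ℂ) * ω‖ = t := by
  rw [norm_mul, h.norm, mul_one, Complex.norm_real, Real.norm_of_nonneg ht]

theorem ofReal_mul_re (h : AiryDir ω) (t : ℝ) : ((t : ℂ) * ω).re = t / 2 := by
  rw [Complex.re_ofReal_mul, h.1]; ring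

theorem ofReal_mul_im_sq (h : AiryDir ω) (t : ℝ) : ((t : ℂ) * ω).im ^ 2 = 3 / 4 * t ^ 2 := by
  rw [Complex.im_ofReal_mul, mul_pow, h.2]; ring

theorem sq_eq (h : AiryDir ω) : ω ^ 2 = ω - 1 := by
  have h1 := h.1
  have h2 := h.2
  apply Complex.ext
  · simp only [sq, Complex.mul_re, Complex.sub_re, Complex.one_re]
    rw [← sq, ← sq, h1, h2]; norm_num
  · simp only [sq, Complex.mul_im, Complex.sub_im, Complex.one_im, h1]
    ring

theorem cube_eq (h : AiryDir ω) : ω ^ 3 = -1 := by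
  linear_combination (ω + 1) * h.sq_eq

theorem normSq_one_add (h : AiryDir ω) (t : ℝ) : ‖1 + (t : ℂ) * ω‖ ^ 2 = 1 + t + t ^ 2 := by
  rw [Complex.sq_norm, Complex.normSq_apply, ← sq, ← sq, Complex.add_re, Complex.add_im,
    h.ofReal_mul_re, Complex.one_re, Complex.one_im, zero_add, h.ofReal_mul_im_sq]
  ring

theorem normSq_one_sub (h : AiryDir ω) (t : ℝ) : ‖1 - (t : ℂ) * ω‖ ^ 2 = 1 - t + t ^ 2 := by
  rw [Complex.sq_norm, Complex.normSq_apply, ← sq, ← sq, Complex.sub_re, Complex.sub_im,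
    h.ofReal_mul_re, Complex.one_re, Complex.one_im, zero_sub, neg_sq, h.ofReal_mul_im_sq]
  ring

theorem one_le_norm_one_add (h : AiryDir ω) {t : ℝ} (ht : 0 ≤ t) : 1 ≤ ‖1 + (t : ℂ) * ω‖ := by
  have := h.normSq_one_add t
  nlinarith [norm_nonneg (1 + (t : ℂ) * ω)]

theorem norm_one_add_le (h : AiryDir ω) {t : ℝ} (ht : 0 ≤ t) : ‖1 + (t : ℂ) * ω‖ ≤ 1 + t := by
  refine (norm_add_le _ _).trans ?_
  rw [h.norm_ofReal_mul ht, norm_one]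

theorem half_le_norm_one_sub (h : AiryDir ω) (t : ℝ) : 1 / 2 ≤ ‖1 - (t : ℂ) * ω‖ := by
  have := h.normSq_one_sub t
  nlinarith [norm_nonneg (1 - (t : ℂ) * ω), sq_nonneg (t - 1 / 2)]

theorem one_sub_ne_zero (h : AiryDir ω) (t : ℝ) : 1 - (t : ℂ) * ω ≠ 0 := by
  rw [← norm_pos_iff]
  linarith [h.half_le_norm_one_sub t]

theorem one_add_mem_slitPlane (h : AiryDir ω) {t : ℝ} (ht : 0 ≤ t) :
    1 + (t : ℂ) * ω ∈ Complex.slitPlane := by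
  left
  rw [Complex.add_re, h.ofReal_mul_re, Complex.one_re]
  linarith

end AiryDir

/-- The integral of `g` along the ray from `0` to `∞` through `ω`. -/
def rayIntegral (ω : ℂ) (g : ℂ → ℂ) : ℂ := ∫ t in Set.Ioi (0 : ℝ), ω * g (t * ω)

/-- The integral of `g` along the contour from `∞ exp (-iπ/3)` through `0` to `∞ exp (iπ/3)`. -/
def wedgeInt (g : ℂ → ℂ) : ℂ :=
  rayIntegral (Complex.exp (Complex.I * Real.pi / 3)) g -
    rayIntegral (Complex.exp (-(Complex.I * Real.pi / 3))) g

/-- Integrability on both rays of the Airy contour. -/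
def WedgeIntegrable (g : ℂ → ℂ) : Prop :=
  ∀ ω, AiryDir ω → IntegrableOn (fun t : ℝ => g (t * ω)) (Set.Ioi 0)

theorem WedgeIntegrable.add {f g : ℂ → ℂ} (hf : WedgeIntegrable f) (hg : WedgeIntegrable g) :
    WedgeIntegrable fun v => f v + g v := fun ω h => (hf ω h).add (hg ω h)

theorem WedgeIntegrable.const_mul {f : ℂ → ℂ} (hf : WedgeIntegrable f) (c : ℂ) :
    WedgeIntegrable fun v => c * f v := fun ω h => (hf ω h).const_mul c

theorem WedgeIntegrable.congr {f g : ℂ → ℂ} (hf : WedgeIntegrable f)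
    (h : ∀ ω, AiryDir ω → ∀ t : ℝ, 0 < t → f (t * ω) = g (t * ω)) : WedgeIntegrable g :=
  fun ω hω => (hf ω hω).congr_fun (fun t ht => h ω hω t ht) measurableSet_Ioi

theorem wedgeInt_add {f g : ℂ → ℂ} (hf : WedgeIntegrable f) (hg : WedgeIntegrable g) :
    wedgeInt (fun v => f v + g v) = wedgeInt f + wedgeInt g := by
  simp only [wedgeInt, rayIntegral, mul_add]
  rw [integral_add ((hf _ airyDir_up).const_mul _) ((hg _ airyDir_up).const_mul _),
    integral_add ((hf _ airyDir_down).const_mul _) ((hg _ airyDir_down).const_mul _)]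
  ring

theorem wedgeInt_const_mul (c : ℂ) (f : ℂ → ℂ) :
    wedgeInt (fun v => c * f v) = c * wedgeInt f := by
  have (ω : ℂ) : rayIntegral ω (fun v => c * f v) = c * rayIntegral ω f := by
    rw [rayIntegral, rayIntegral, ← integral_const_mul]
    exact integral_congr_ae (ae_of_all _ fun t => mul_left_comm _ _ _)
  rw [wedgeInt, this, this, wedgeInt, mul_sub]

theorem wedgeInt_congr {f g : ℂ → ℂ}
    (h : ∀ ω, AiryDir ω → ∀ t : ℝ, 0 < t → f (t * ω) = g (t * ω)) : wedgeInt f = wedgeInt g := by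
  have (ω : ℂ) (hω : AiryDir ω) : rayIntegral ω f = rayIntegral ω g :=
    setIntegral_congr_fun measurableSet_Ioi fun t ht => by
      simp only [h ω hω t ht]
  rw [wedgeInt, wedgeInt, this _ airyDir_up, this _ airyDir_down]

theorem rayIntegral_comp_mul {c : ℝ} (hc : 0 < c) (ω : ℂ) (g : ℂ → ℂ) :
    rayIntegral ω (fun v => g (c * v)) = (c : ℂ)⁻¹ * rayIntegral ω g := by
  have := integral_comp_mul_left_Ioi (fun t : ℝ => ω * g (t * ω)) 0 hc
  rw [mul_zero] at this
  simp only [rayIntegral]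
  rw [Complex.real_smul, Complex.ofReal_inv] at this
  rw [← this]
  congr 1
  ext t
  push_cast
  rw [mul_assoc]

theorem wedgeInt_comp_mul {c : ℝ} (hc : 0 < c) (g : ℂ → ℂ) :
    wedgeInt (fun v => g (c * v)) = (c : ℂ)⁻¹ * wedgeInt g := by
  rw [wedgeInt, rayIntegral_comp_mul hc, rayIntegral_comp_mul hc, wedgeInt]
  ring

theorem rayIntegral_deriv {ω : ℂ} {g g' : ℂ → ℂ}
    (hd : ∀ t : ℝ, 0 ≤ t → HasDerivAt g (g' (t * ω)) (t * ω))
    (hi : IntegrableOn (fun t : ℝ => g (t * ω)) (Set.Ioi 0))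
    (hi' : IntegrableOn (fun t : ℝ => g' (t * ω)) (Set.Ioi 0)) :
    rayIntegral ω g' = -g 0 := by
  have hd' (t : ℝ) (ht : 0 ≤ t) :
      HasDerivAt (fun t : ℝ => g (t * ω)) (ω * g' (t * ω)) t := by
    have h1 : HasDerivAt (fun t : ℝ => (t : ℂ) * ω) ω t := by
      simpa using (Complex.ofRealCLM.hasDerivAt (x := t)).mul_const ω
    rw [mul_comm]
    exact (hd t ht).comp t h1
  have hi'' := hi'.const_mul ω
  have h0 := tendsto_zero_of_hasDerivAt_of_integrableOn_Ioi
    (fun t (ht : t ∈ Set.Ioi (0 : ℝ)) => hd' t (le_of_lt ht)) hi'' hi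
  have := integral_Ioi_of_hasDerivAt_of_tendsto' (fun t ht => hd' t ht) hi'' h0
  simpa [rayIntegral] using this

/-- Each ray contributes `-g 0`, whatever its direction, and the two contributions cancel. Every
recurrence between contour integrals below is an instance of this. -/
theorem wedgeInt_deriv_eq_zero {g g' : ℂ → ℂ}
    (hd : ∀ ω, AiryDir ω → ∀ t : ℝ, 0 ≤ t → HasDerivAt g (g' (t * ω)) (t * ω))
    (hi : WedgeIntegrable g) (hi' : WedgeIntegrable g') : wedgeInt g' = 0 := by
  rw [wedgeInt, rayIntegral_deriv (hd _ airyDir_up) (hi _ airyDir_up) (hi' _ airyDir_up),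
    rayIntegral_deriv (hd _ airyDir_down) (hi _ airyDir_down) (hi' _ airyDir_down), sub_self]

theorem integrableOn_one_add_pow_mul_exp_neg (n : ℕ) {c : ℝ} (hc : 0 < c) :
    IntegrableOn (fun t : ℝ => (1 + t) ^ n * Real.exp (-c * t)) (Set.Ioi 0) := by
  refine integrable_of_isBigO_exp_neg (half_pos hc) (by fun_prop) ?_
  have h1 : (fun t : ℝ => (1 + t) ^ n) =O[atTop] fun t : ℝ => Real.exp (c / 2 * t) := by
    have h2 : (fun t : ℝ => 1 + t) =O[atTop] fun t : ℝ => t := by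
      refine IsBigO.of_bound 2 ?_
      filter_upwards [eventually_ge_atTop 1] with t ht
      rw [Real.norm_of_nonneg (by linarith), Real.norm_of_nonneg (by linarith)]
      linarith
    exact (h2.pow n).trans (isLittleO_pow_exp_pos_mul_atTop n (half_pos hc)).isBigO
  refine (h1.mul (isBigO_refl _ _)).congr_right fun t => ?_
  rw [← Real.exp_add]
  ring_nf

/-- Integrability on the Airy contour of a continuous function with exponential decay. -/
theorem wedgeIntegrable_of_bound {g : ℂ → ℂ} {C c : ℝ} (n : ℕ) (hc : 0 < c)
    (hg : ∀ ω, AiryDir ω → ∀ t : ℝ, 0 ≤ t → ContinuousAt g (t * ω))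
    (hb : ∀ ω, AiryDir ω → ∀ t : ℝ, 0 < t →
      ‖g (t * ω)‖ ≤ C * ((1 + t) ^ n * Real.exp (-c * t))) : WedgeIntegrable g := by
  intro ω hω
  refine Integrable.mono' ((integrableOn_one_add_pow_mul_exp_neg n hc).const_mul C) ?_ ?_
  · refine ContinuousOn.aestronglyMeasurable (fun t ht => ?_) measurableSet_Ioi
    exact (ContinuousAt.comp (f := fun t : ℝ => (t : ℂ) * ω) (hg ω hω t (le_of_lt ht))
      (by fun_prop)).continuousWithinAt
  · exact (ae_restrict_mem measurableSet_Ioi).mono fun t ht => hb ω hω t ht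

/-! ### Hermite polynomials as integrals along the Airy contour. -/

theorem AiryDir.re_sq_add (s t : ℝ) {ω : ℂ} (h : AiryDir ω) :
    (((t : ℂ) * ω + s) ^ 2).re = s ^ 2 + s * t - t ^ 2 / 2 := by
  have h1 := h.ofReal_mul_im_sq t
  rw [sq, Complex.mul_re, Complex.add_re, Complex.add_im, Complex.ofReal_re, Complex.ofReal_im,
    add_zero, ← sq, ← sq, h.ofReal_mul_re, h1]
  ring

theorem AiryDir.norm_gaussian {a : ℝ} (s t : ℝ) {ω : ℂ} (h : AiryDir ω) :
    ‖Complex.exp (a / 4 * ((t : ℂ) * ω + s) ^ 2)‖ =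
      Real.exp (a / 4 * (s ^ 2 + s * t - t ^ 2 / 2)) := by
  have : (a / 4 : ℂ) = ((a / 4 : ℝ) : ℂ) := by push_cast; rfl
  rw [Complex.norm_exp, this, Complex.re_ofReal_mul, h.re_sq_add]

theorem AiryDir.norm_gaussian_le {a : ℝ} (ha : 0 < a) (s t : ℝ) {ω : ℂ} (h : AiryDir ω) :
    ‖Complex.exp (a / 4 * ((t : ℂ) * ω + s) ^ 2)‖ ≤
      Real.exp (a / 4 * s ^ 2 + 2 / a * (a * s / 4 + 1) ^ 2) * Real.exp (-1 * t) := by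
  rw [h.norm_gaussian, ← Real.exp_add, Real.exp_le_exp]
  -- Completing the square in `t`, after the term `t` of the target decay has been moved to the
  -- left.
  have h1 : 0 ≤ a / 8 * (t - 4 / a * (a * s / 4 + 1)) ^ 2 := by positivity
  have h2 : a / 8 * (t - 4 / a * (a * s / 4 + 1)) ^ 2 =
      a / 8 * t ^ 2 - (a * s / 4 + 1) * t + 2 / a * (a * s / 4 + 1) ^ 2 := by
    field_simp; ring
  linarith

theorem wedgeIntegrable_pow_mul_gaussian {a : ℝ} (ha : 0 < a) (s : ℝ) (k : ℕ) :
    WedgeIntegrable fun v => (1 + v) ^ k * Complex.exp (a / 4 * (v + s) ^ 2) := by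
  refine wedgeIntegrable_of_bound (C := Real.exp (a / 4 * s ^ 2 + 2 / a * (a * s / 4 + 1) ^ 2))
    k one_pos (fun ω hω t ht => by fun_prop) fun ω hω t ht => ?_
  rw [norm_mul, norm_pow, mul_left_comm]
  gcongr
  · exact hω.norm_one_add_le ht.le
  · exact hω.norm_gaussian_le ha s t

/-- The contour integral `∫ (1+v)^k exp (a/4 (v+s)²) dv`. -/
def hermiteInt (a s : ℝ) (k : ℕ) : ℂ :=
  wedgeInt fun v => (1 + v) ^ k * Complex.exp (a / 4 * (v + s) ^ 2)

theorem hermiteInt_one (a : ℝ) (ha : 0 < a) (s : ℝ) :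
    hermiteInt a s 1 = (1 - s) * hermiteInt a s 0 := by
  have hd : wedgeInt (fun v => (2 / a : ℂ) *
      (a / 2 * ((1 + v) ^ 1 * Complex.exp (a / 4 * (v + s) ^ 2) +
      (s - 1 : ℂ) * ((1 + v) ^ 0 * Complex.exp (a / 4 * (v + s) ^ 2))))) = 0 := by
    rw [wedgeInt_const_mul]
    rw [wedgeInt_deriv_eq_zero (g := fun v => Complex.exp (a / 4 * (v + s) ^ 2)), mul_zero]
    · intro ω _ t _
      have h1 := ((((hasDerivAt_id ((t : ℂ) * ω)).add_const (s : ℂ)).pow 2).const_mul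
        (a / 4 : ℂ)).cexp
      refine h1.congr_deriv ?_
      simp
      ring
    · simpa using wedgeIntegrable_pow_mul_gaussian ha s 0
    · exact ((wedgeIntegrable_pow_mul_gaussian ha s 1).add
        ((wedgeIntegrable_pow_mul_gaussian ha s 0).const_mul _)).const_mul _
  have ha' : (a : ℂ) ≠ 0 := by exact_mod_cast ha.ne'
  have : ∀ v : ℂ, (2 / a : ℂ) * (a / 2 * ((1 + v) ^ 1 * Complex.exp (a / 4 * (v + s) ^ 2) +
      (s - 1 : ℂ) * ((1 + v) ^ 0 * Complex.exp (a / 4 * (v + s) ^ 2)))) =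
      (1 + v) ^ 1 * Complex.exp (a / 4 * (v + s) ^ 2) +
      (s - 1 : ℂ) * ((1 + v) ^ 0 * Complex.exp (a / 4 * (v + s) ^ 2)) := fun v => by
    field_simp
  simp only [this] at hd
  rw [wedgeInt_add (wedgeIntegrable_pow_mul_gaussian ha s 1)
    ((wedgeIntegrable_pow_mul_gaussian ha s 0).const_mul _), wedgeInt_const_mul] at hd
  simp only [hermiteInt]
  linear_combination hd

/-- Integrate the derivative of `(2/a)(1+v)^(k+1) exp(a/4 (v+s)²)`, writing `v + s = (1+v) + (s-1)`.
For `s = 1 - 2x` this is the three-term recurrence satisfied by `2^k` times the monic Hermite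
polynomial at `x`. -/
theorem hermiteInt_add_two {a : ℝ} (ha : 0 < a) (s : ℝ) (k : ℕ) :
    hermiteInt a s (k + 2) =
      (1 - s) * hermiteInt a s (k + 1) - 2 * (k + 1) / a * hermiteInt a s k := by
  have hI (j : ℕ) := wedgeIntegrable_pow_mul_gaussian ha s j
  have ha' : (a : ℂ) ≠ 0 := by exact_mod_cast ha.ne'
  have hd : wedgeInt (fun v => (1 + v) ^ (k + 2) * Complex.exp (a / 4 * (v + s) ^ 2) +
      ((s - 1 : ℂ) * ((1 + v) ^ (k + 1) * Complex.exp (a / 4 * (v + s) ^ 2)) +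
      (2 * (k + 1) / a : ℂ) * ((1 + v) ^ k * Complex.exp (a / 4 * (v + s) ^ 2)))) = 0 := by
    rw [wedgeInt_deriv_eq_zero
      (g := fun v => (2 / a : ℂ) * ((1 + v) ^ (k + 1) * Complex.exp (a / 4 * (v + s) ^ 2)))]
    · intro ω _ t _
      have h1 := ((((hasDerivAt_id ((t : ℂ) * ω)).add_const (s : ℂ)).pow 2).const_mul
        (a / 4 : ℂ)).cexp
      have h2 := ((hasDerivAt_id ((t : ℂ) * ω)).const_add (1 : ℂ)).pow (k + 1)
      refine ((h2.mul h1).const_mul (2 / a : ℂ)).congr_deriv ?_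
      simp
      field_simp
      ring
    · exact (hI (k + 1)).const_mul _
    · exact (hI _).add (((hI _).const_mul _).add ((hI _).const_mul _))
  rw [wedgeInt_add (hI _) (((hI _).const_mul _).add ((hI _).const_mul _)),
    wedgeInt_add ((hI _).const_mul _) ((hI _).const_mul _), wedgeInt_const_mul,
    wedgeInt_const_mul] at hd
  simp only [hermiteInt]
  linear_combination hd

theorem hermiteMonic_eval_add_two (a : ℝ) (k : ℕ) (x : ℝ) :
    (hermiteMonic a (k + 2)).eval x = x * (hermiteMonic a (k + 1)).eval x -
      (k + 1) / (2 * a) * (hermiteMonic a k).eval x := by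
  rw [hermiteMonic, derivative_hermiteMonic]
  simp
  ring

theorem hermiteInt_eq {a : ℝ} (ha : 0 < a) (x : ℝ) (k : ℕ) :
    hermiteInt a (1 - 2 * x) k =
      2 ^ k * (((hermiteMonic a k).eval x : ℝ) : ℂ) * hermiteInt a (1 - 2 * x) 0 := by
  have ha' : (a : ℂ) ≠ 0 := by exact_mod_cast ha.ne'
  have key : ∀ k, hermiteInt a (1 - 2 * x) k =
      2 ^ k * (((hermiteMonic a k).eval x : ℝ) : ℂ) * hermiteInt a (1 - 2 * x) 0 ∧
      hermiteInt a (1 - 2 * x) (k + 1) =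
      2 ^ (k + 1) * (((hermiteMonic a (k + 1)).eval x : ℝ) : ℂ) * hermiteInt a (1 - 2 * x) 0 := by
    intro k
    induction k with
    | zero =>
      simp only [zero_add, hermiteInt_one a ha]
      simp [hermiteMonic]
    | succ k ih =>
      refine ⟨ih.2, ?_⟩
      rw [hermiteInt_add_two ha, ih.1, ih.2, hermiteMonic_eval_add_two]
      push_cast
      field_simp
      ring
  exact (key k).1

/-- The ray integral of an entire Gaussian does not see the base point up to a term that does not
depend on the ray. -/
theorem hermiteInt_zero_eq {a : ℝ} (ha : 0 < a) (s : ℝ) :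
    hermiteInt a s 0 = hermiteInt a 0 0 := by
  obtain ⟨G, hG⟩ := Differentiable.isExactOn_univ (f := fun z : ℂ => Complex.exp (a / 4 * z ^ 2))
    (by fun_prop)
  have hG' (z : ℂ) : HasDerivAt G (Complex.exp (a / 4 * z ^ 2)) z := hG z (Set.mem_univ z)
  have hray (s : ℝ) (ω : ℂ) (hω : AiryDir ω) : Tendsto (fun R : ℝ => G (R * ω + s)) atTop
      (nhds (rayIntegral ω (fun v => Complex.exp (a / 4 * (v + s) ^ 2)) + G s)) := by
    have h1 (t : ℝ) : HasDerivAt (fun t : ℝ => G (t * ω + s))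
        (ω * Complex.exp (a / 4 * (t * ω + s) ^ 2)) t := by
      have h2 : HasDerivAt (fun t : ℝ => (t : ℂ) * ω + s) ω t := by
        simpa using ((Complex.ofRealCLM.hasDerivAt (x := t)).mul_const ω).add_const (s : ℂ)
      rw [mul_comm]
      exact (hG' _).comp t h2
    have h3 : IntegrableOn (fun t : ℝ => ω * Complex.exp (a / 4 * (t * ω + s) ^ 2))
        (Set.Ioi 0) := by
      have := (wedgeIntegrable_pow_mul_gaussian ha s 0 ω hω).const_mul ω
      simpa [IntegrableOn] using this
    have h4 := tendsto_limUnder_of_hasDerivAt_of_integrableOn_Ioi (fun t _ => h1 t) h3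
    have h5 := integral_Ioi_of_hasDerivAt_of_tendsto' (fun t _ => h1 t) h3 h4
    rw [rayIntegral, h5]
    simpa using h4
  -- Moving the far end of the ray horizontally by `s` changes the primitive by at most a constant
  -- times `exp(-R)`, by the mean value inequality on a segment where the Gaussian is that small.
  have hdiff (ω : ℂ) (hω : AiryDir ω) :
      Tendsto (fun R : ℝ => G (R * ω + s) - G (R * ω + (0 : ℝ))) atTop (nhds 0) := by
    set C := Real.exp (a / 4 * s ^ 2 + 2 / a * (a * |s| / 4 + 1) ^ 2) * |s| with hC
    refine squeeze_zero_norm' (a := fun R => C * Real.exp (-R)) ?_ ?_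
    · filter_upwards [eventually_ge_atTop 0] with R hR
      have := (convex_uIcc (0 : ℝ) s).norm_image_sub_le_of_norm_hasDerivWithin_le
        (f := fun σ : ℝ => G (R * ω + σ))
        (f' := fun σ : ℝ => Complex.exp (a / 4 * (R * ω + σ) ^ 2))
        (C := Real.exp (a / 4 * s ^ 2 + 2 / a * (a * |s| / 4 + 1) ^ 2) * Real.exp (-R))
        (x := 0) (y := s) (fun σ _ => ?_) (fun σ hσ => ?_) Set.left_mem_uIcc Set.right_mem_uIcc
      · refine this.trans (le_of_eq ?_)
        rw [sub_zero, Real.norm_eq_abs, hC]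
        ring
      · have h2 : HasDerivAt (fun σ : ℝ => (R : ℂ) * ω + σ) 1 σ := by
          simpa using (Complex.ofRealCLM.hasDerivAt (x := σ)).const_add ((R : ℂ) * ω)
        have := (hG' (R * ω + σ)).comp σ h2
        rw [mul_one] at this
        exact this.hasDerivWithinAt
      · have hσ' : |σ| ≤ |s| := by
          have := Set.abs_sub_left_of_mem_uIcc hσ
          simpa using this
        refine (hω.norm_gaussian_le ha σ R).trans ?_
        rw [neg_one_mul]
        have h3 : σ ^ 2 ≤ s ^ 2 := sq_le_sq.mpr hσ'
        have h4 : (a * σ / 4 + 1) ^ 2 ≤ (a * |s| / 4 + 1) ^ 2 := by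
          have e1 := neg_abs_le σ
          have e2 := le_abs_self σ
          have e3 : a * σ ≤ a * |s| := by gcongr; linarith
          have e4 : -(a * |s|) ≤ a * σ := by
            rw [← mul_neg]; gcongr; linarith
          refine sq_le_sq' (by linarith) (by linarith)
        gcongr
    · have := (Real.tendsto_exp_neg_atTop_nhds_zero).const_mul C
      simpa using this
  -- The discrepancy `G s - G 0` is the same for both rays and so drops out of their difference.
  have hlim (ω : ℂ) (hω : AiryDir ω) :
      rayIntegral ω (fun v => Complex.exp (a / 4 * (v + s) ^ 2)) + G s -
        (rayIntegral ω (fun v => Complex.exp (a / 4 * (v + (0 : ℝ)) ^ 2)) + G (0 : ℝ)) = 0 :=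
    tendsto_nhds_unique ((hray s ω hω).sub (hray 0 ω hω)) (hdiff ω hω)
  have h1 := hlim _ airyDir_up
  have h2 := hlim _ airyDir_down
  simp only [hermiteInt, wedgeInt, pow_zero, one_mul]
  linear_combination h1 - h2

/-- The sign `σ` treats both rays at once. On a ray the integrand is `exp(-b t²)` with `Re b > 0`,
and the direction `exp(iσπ/3)` times the phase `exp(iσπ/6)` of the principal root of `π/b` is `σ i`.
-/
theorem rayIntegral_gaussian {a : ℝ} (ha : 0 < a) (σ : ℝ) (hσ : σ = 1 ∨ σ = -1) :
    rayIntegral (Complex.exp (σ * (Complex.I * Real.pi / 3)))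
      (fun v => Complex.exp (a / 4 * v ^ 2)) = σ * Complex.I * √(Real.pi / a) := by
  have hpi := Real.pi_pos
  have hσ2 : σ ^ 2 = 1 := by rcases hσ with h | h <;> simp [h]
  set b : ℂ := (a / 4 : ℝ) * Complex.exp ((-σ * (Real.pi / 3) : ℝ) * Complex.I) with hb
  have hbre : 0 < b.re := by
    rw [hb, Complex.re_ofReal_mul, Complex.exp_ofReal_mul_I_re]
    have : Real.cos (-σ * (Real.pi / 3)) = 1 / 2 := by
      rcases hσ with h | h <;> simp [h]
    rw [this]; positivity
  have he (t : ℝ) : Complex.exp (a / 4 *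
      ((t : ℂ) * Complex.exp (σ * (Complex.I * Real.pi / 3))) ^ 2) =
      Complex.exp (-b * (t : ℂ) ^ 2) := by
    congr 1
    have h1 : Complex.exp (σ * (Complex.I * Real.pi / 3)) ^ 2 =
        -Complex.exp ((-σ * (Real.pi / 3) : ℝ) * Complex.I) := by
      rw [← Complex.exp_nat_mul, ← neg_one_mul]
      have h2 : (-1 : ℂ) = Complex.exp (σ * (Real.pi * Complex.I)) := by
        rcases hσ with h | h <;> simp [h, Complex.exp_neg, Complex.exp_pi_mul_I]
      rw [h2, ← Complex.exp_add]
      congr 1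
      push_cast
      ring
    rw [mul_pow, h1, hb]
    push_cast
    ring
  have hsqrt : (Real.pi / b : ℂ) ^ (1 / 2 : ℂ) =
      (2 * √(Real.pi / a) : ℝ) * Complex.exp ((σ * (Real.pi / 6) : ℝ) * Complex.I) := by
    have h1 : (Real.pi / b : ℂ) =
        ((4 * Real.pi / a : ℝ) : ℂ) * Complex.exp ((σ * (Real.pi / 3) : ℝ) * Complex.I) := by
      have ha' : (a : ℂ) ≠ 0 := by exact_mod_cast ha.ne'
      rw [hb, neg_mul, Complex.ofReal_neg, neg_mul, Complex.exp_neg]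
      push_cast
      field_simp
    have hr : 0 < 4 * Real.pi / a := by positivity
    have h2 : 2 * √(Real.pi / a) = Real.exp (Real.log (4 * Real.pi / a) * (1 / 2)) := by
      rw [← Real.rpow_def_of_pos hr, ← Real.sqrt_eq_rpow,
        show 4 * Real.pi / a = 2 ^ 2 * (Real.pi / a) by ring, Real.sqrt_mul (by positivity),
        Real.sqrt_sq (by positivity)]
    rw [h1, Complex.cpow_def_of_ne_zero (mul_ne_zero (Complex.ofReal_ne_zero.mpr hr.ne')
      (Complex.exp_ne_zero _)), Complex.log_ofReal_mul hr (Complex.exp_ne_zero _),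
      Complex.log_exp, h2, Complex.ofReal_exp, ← Complex.exp_add]
    · congr 1
      push_cast
      ring
    -- The two remaining goals say that the argument `σπ/3` lies in the principal range of the
    -- logarithm.
    · simp; rcases hσ with h | h <;> simp [h] <;> linarith
    · simp; rcases hσ with h | h <;> simp [h] <;> linarith
  simp only [rayIntegral, he]
  rw [integral_const_mul, integral_gaussian_complex_Ioi hbre, hsqrt]
  have h3 : Complex.exp (σ * (Complex.I * Real.pi / 3)) *
      Complex.exp ((σ * (Real.pi / 6) : ℝ) * Complex.I) = σ * Complex.I := by
    rw [← Complex.exp_add, show (σ * (Complex.I * Real.pi / 3) +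
      (σ * (Real.pi / 6) : ℝ) * Complex.I : ℂ) = σ * (Real.pi / 2 * Complex.I) by push_cast; ring]
    rcases hσ with h | h <;> simp [h, Complex.exp_neg, Complex.exp_pi_div_two_mul_I]
  push_cast at h3 ⊢
  linear_combination (√(Real.pi / a) : ℂ) * h3

theorem hermiteInt_zero {a : ℝ} (ha : 0 < a) (s : ℝ) :
    hermiteInt a s 0 = 2 * Complex.I * √(Real.pi / a) := by
  rw [hermiteInt_zero_eq ha]
  have h1 := rayIntegral_gaussian ha 1 (Or.inl rfl)
  have h2 := rayIntegral_gaussian ha (-1) (Or.inr rfl)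
  simp only [Complex.ofReal_one, Complex.ofReal_neg, one_mul, neg_mul] at h1 h2
  simp only [hermiteInt, wedgeInt, pow_zero, one_mul, Complex.ofReal_zero, add_zero]
  rw [h1, h2]
  ring

/-- A Hermite polynomial as an integral along the Airy contour. -/
theorem hermiteMonic_eval_eq_hermiteInt {a : ℝ} (ha : 0 < a) (x : ℝ) (k : ℕ) :
    2 ^ (k + 1) * Complex.I * √(Real.pi / a) * (((hermiteMonic a k).eval x : ℝ) : ℂ) =
      hermiteInt a (1 - 2 * x) k := by
  rw [hermiteInt_eq ha, hermiteInt_zero ha]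
  ring

/-- The derivative of a Hermite polynomial as an integral along the Airy contour. -/
theorem hermiteMonic_derivative_eval_eq_hermiteInt {a : ℝ} (ha : 0 < a) (x : ℝ) (k : ℕ) :
    2 ^ (k + 1) * Complex.I * √(Real.pi / a) * (((hermiteMonic a k).derivative.eval x : ℝ) : ℂ) =
      a * (2 * x * hermiteInt a (1 - 2 * x) k - hermiteInt a (1 - 2 * x) (k + 1)) := by
  have h1 := hermiteMonic_eval_eq_hermiteInt ha x k
  have h2 := hermiteMonic_eval_eq_hermiteInt ha x (k + 1)
  have h3 : (hermiteMonic a (k + 1)).eval x = x * (hermiteMonic a k).eval x -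
      1 / (2 * a) * (hermiteMonic a k).derivative.eval x := by
    simp [hermiteMonic]
  have ha' : (a : ℂ) ≠ 0 := by exact_mod_cast ha.ne'
  rw [← h1, ← h2, h3]
  push_cast
  field_simp
  ring

/-! ### Cauchy's theorem and a residue computation for the Airy contour. -/

theorem isOpen_neg_half_lt_re : IsOpen {z : ℂ | -1 / 2 < z.re} :=
  isOpen_lt continuous_const Complex.continuous_re

/-- Cauchy's theorem for the Airy contour. -/
theorem wedgeInt_eq_zero_of_differentiableOn {f : ℂ → ℂ} {C : ℝ}
    (hf : DifferentiableOn ℂ f {z | -1 / 2 < z.re}) (hi : WedgeIntegrable f)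
    (hb : ∀ z : ℂ, 2 ≤ z.re → |z.im| ≤ 2 * z.re → ‖f z‖ * z.re ^ 2 ≤ C) : wedgeInt f = 0 := by
  set ω₁ := Complex.exp (Complex.I * Real.pi / 3) with hω₁
  set ω₂ := Complex.exp (-(Complex.I * Real.pi / 3)) with hω₂
  have hlim (ω : ℂ) (hω : AiryDir ω) : Tendsto (fun R : ℝ => ∫ t in (0 : ℝ)..R, ω * f (t * ω))
      atTop (nhds (rayIntegral ω f)) :=
    intervalIntegral_tendsto_integral_Ioi 0 ((hi ω hω).const_mul ω) tendsto_id
  have hlim' := (hlim ω₁ airyDir_up).sub (hlim ω₂ airyDir_down)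
  refine tendsto_nhds_unique hlim' ?_
  have hbound : ∀ᶠ R : ℝ in atTop, ‖(∫ t in (0 : ℝ)..R, ω₁ * f (t * ω₁)) -
      ∫ t in (0 : ℝ)..R, ω₂ * f (t * ω₂)‖ ≤ 8 * C / R := by
    filter_upwards [eventually_ge_atTop 4] with R hR
    -- This disc lies in the half plane of holomorphy and contains both ray segments of length `R`,
    -- because `|tω - R|² = t² - tR + R² ≤ R²`. A primitive on the disc then closes the contour by
    -- the vertical chord.
    have hsub : Metric.ball (R : ℂ) (R + 1 / 2) ⊆ {z : ℂ | -1 / 2 < z.re} := by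
      intro z hz
      rw [Metric.mem_ball, dist_eq_norm] at hz
      have h1 := (abs_le.mp (Complex.abs_re_le_norm (z - R))).1
      simp only [Complex.sub_re, Complex.ofReal_re, Set.mem_ofPred_eq] at h1 ⊢
      linarith
    obtain ⟨G, hG⟩ := (hf.mono hsub).isExactOn_ball
    have hmem (ω : ℂ) (hω : AiryDir ω) (t : ℝ) (ht0 : 0 ≤ t) (htR : t ≤ R) :
        (t : ℂ) * ω ∈ Metric.ball (R : ℂ) (R + 1 / 2) := by
      rw [Metric.mem_ball, dist_eq_norm]
      refine lt_of_pow_lt_pow_left₀ 2 (by linarith) ?_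
      have h1 := hω.ofReal_mul_im_sq t
      rw [Complex.sq_norm, Complex.normSq_apply, ← sq, ← sq, Complex.sub_re, Complex.sub_im,
        Complex.ofReal_re, Complex.ofReal_im, sub_zero, h1, hω.ofReal_mul_re]
      nlinarith
    have hray (ω : ℂ) (hω : AiryDir ω) : ∫ t in (0 : ℝ)..R, ω * f (t * ω) = G (R * ω) - G 0 := by
      have h1 (t : ℝ) (ht : t ∈ Set.uIcc 0 R) :
          HasDerivAt (fun t : ℝ => G (t * ω)) (ω * f (t * ω)) t := by
        rw [Set.uIcc_of_le (by linarith)] at ht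
        have h2 : HasDerivAt (fun t : ℝ => (t : ℂ) * ω) ω t := by
          simpa using (Complex.ofRealCLM.hasDerivAt (x := t)).mul_const ω
        rw [mul_comm]
        exact (hG _ (hmem ω hω t ht.1 ht.2)).comp t h2
      have h3 : IntervalIntegrable (fun t : ℝ => ω * f (t * ω)) volume 0 R := by
        rw [intervalIntegrable_iff, Set.uIoc_of_le (by linarith)]
        exact IntegrableOn.mono_set (t := Set.Ioi 0) ((hi ω hω).const_mul ω)
          Set.Ioc_subset_Ioi_self
      rw [intervalIntegral.integral_eq_sub_of_hasDerivAt h1 h3]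
      simp
    rw [hray ω₁ airyDir_up, hray ω₂ airyDir_down, sub_sub_sub_cancel_right]
    -- On the chord `Re z = R/2 ≥ 2` and `|Im z| ≤ 2 Re z`, so the integrand is at most `4C/R²`. The
    -- chord has length at most `2R`, which gives `8C/R`.
    have hseg : ∀ z ∈ segment ℝ ((R : ℂ) * ω₂) (R * ω₁), z.re = R / 2 ∧ |z.im| ≤ R := by
      have him (ω : ℂ) (hω : AiryDir ω) : |((R : ℂ) * ω).im| ≤ R :=
        (Complex.abs_im_le_norm _).trans (hω.norm_ofReal_mul (by linarith)).le
      have hconv : Convex ℝ {z : ℂ | z.re = R / 2 ∧ |z.im| ≤ R} := by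
        have : {z : ℂ | z.re = R / 2 ∧ |z.im| ≤ R} =
            (Complex.reCLM ⁻¹' {R / 2}) ∩ (Complex.imCLM ⁻¹' Set.Icc (-R) R) := by
          ext z; simp [abs_le]
        rw [this]
        exact ((convex_singleton _).linear_preimage Complex.reCLM.toLinearMap).inter
          ((convex_Icc _ _).linear_preimage Complex.imCLM.toLinearMap)
      intro z hz
      exact hconv.segment_subset ⟨airyDir_down.ofReal_mul_re R, him _ airyDir_down⟩
        ⟨airyDir_up.ofReal_mul_re R, him _ airyDir_up⟩ hz
    have hball : segment ℝ ((R : ℂ) * ω₂) (R * ω₁) ⊆ Metric.ball (R : ℂ) (R + 1 / 2) :=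
      (convex_ball _ _).segment_subset (hmem _ airyDir_down R (by linarith) le_rfl)
        (hmem _ airyDir_up R (by linarith) le_rfl)
    have := (convex_segment ((R : ℂ) * ω₂) (R * ω₁)).norm_image_sub_le_of_norm_hasDerivWithin_le
      (f := G) (f' := f) (C := 4 * C / R ^ 2)
      (fun z hz => (hG z (hball hz)).hasDerivWithinAt) (fun z hz => by
        obtain ⟨h1, h2⟩ := hseg z hz
        have := hb z (by linarith) (by linarith)
        rw [h1] at this
        rw [le_div_iff₀ (by positivity)]
        linarith) (left_mem_segment _ _ _) (right_mem_segment _ _ _)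
    refine this.trans ?_
    have h4 : ‖(R : ℂ) * ω₁ - R * ω₂‖ ≤ 2 * R := by
      refine (norm_sub_le _ _).trans ?_
      rw [airyDir_up.norm_ofReal_mul (by linarith), airyDir_down.norm_ofReal_mul (by linarith)]
      linarith
    have h5 : 0 ≤ C := le_trans (by positivity) (hb 2 (by simp) (by simp))
    calc 4 * C / R ^ 2 * ‖(R : ℂ) * ω₁ - R * ω₂‖ ≤ 4 * C / R ^ 2 * (2 * R) := by gcongr
      _ = 8 * C / R := by field_simp; ring
  refine squeeze_zero_norm' hbound ?_
  exact tendsto_const_nhds.div_atTop tendsto_id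

theorem AiryDir.norm_one_sub_sq (t : ℝ) {ω : ℂ} (h : AiryDir ω) :
    (1 + t ^ 2) / 2 ≤ ‖(1 + (t : ℂ) * ω) * (1 - t * ω)‖ := by
  rw [norm_mul]
  refine (pow_le_pow_iff_left₀ (by positivity) (by positivity) two_ne_zero).mp ?_
  rw [mul_pow, h.normSq_one_add, h.normSq_one_sub]
  nlinarith [sq_nonneg (t ^ 2 - 1), sq_nonneg t]

theorem wedgeIntegrable_two_div : WedgeIntegrable fun v => 2 / ((1 + v) * (1 - v)) := by
  intro ω hω
  refine Integrable.mono' ((integrable_inv_one_add_sq.integrableOn).const_mul 4) ?_ ?_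
  · refine ContinuousOn.aestronglyMeasurable (fun t ht => ?_) measurableSet_Ioi
    refine ContinuousAt.continuousWithinAt (ContinuousAt.div₀ (by fun_prop) (by fun_prop) ?_)
    rw [← norm_pos_iff]
    have := hω.norm_one_sub_sq t
    nlinarith [sq_nonneg t]
  · refine ae_of_all _ fun t => ?_
    have := hω.norm_one_sub_sq t
    have h2 : 0 < 1 + t ^ 2 := by positivity
    rw [norm_div, Complex.norm_ofNat, div_le_iff₀ (by linarith)]
    calc (2 : ℝ) = 4 * (1 + t ^ 2)⁻¹ * ((1 + t ^ 2) / 2) := by field_simp; norm_num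
      _ ≤ _ := by gcongr

/-- A primitive is `log((1+v)/(1-v))`. Along a ray the quotient runs from `1` to `-1`; the set `s`
records on which side of the branch cut it arrives, hence which boundary value of the logarithm is
the limit. -/
theorem rayIntegral_two_div {ω : ℂ} (hω : AiryDir ω) {l : ℂ} {s : Set ℂ}
    (hl : Tendsto Complex.log (nhdsWithin (-1) s) (nhds l))
    (hs : ∀ t : ℝ, 0 < t → (1 + t * ω) / (1 - t * ω) ∈ s)
    (hs2 : ∀ t : ℝ, 0 < t → (1 + t * ω) / (1 - t * ω) ∈ Complex.slitPlane) :
    rayIntegral ω (fun v => 2 / ((1 + v) * (1 - v))) = l := by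
  have h2 (t : ℝ) : HasDerivAt (fun t : ℝ => (t : ℂ) * ω) ω t := by
    simpa using (Complex.ofRealCLM.hasDerivAt (x := t)).mul_const ω
  have h1 (t : ℝ) (ht : t ∈ Set.Ici (0 : ℝ)) :
      HasDerivAt (fun t : ℝ => Complex.log ((1 + t * ω) / (1 - t * ω)))
        (ω * (2 / ((1 + t * ω) * (1 - t * ω)))) t := by
    have h3 : (1 + t * ω) / (1 - t * ω) ∈ Complex.slitPlane := by
      rcases eq_or_lt_of_le (Set.mem_Ici.mp ht) with h | h
      · simp [← h]
      · exact hs2 t h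
    have h4 := hω.one_sub_ne_zero t
    have h5 := Complex.slitPlane_ne_zero (hω.one_add_mem_slitPlane ht)
    refine ((((h2 t).const_add 1).div ((h2 t).const_sub 1) h4).clog_real h3).congr_deriv ?_
    simp only [Pi.div_apply]
    field_simp
    ring
  have h6 : Tendsto (fun t : ℝ => (1 + t * ω) / (1 - t * ω)) atTop (nhdsWithin (-1) s) := by
    refine tendsto_nhdsWithin_iff.mpr ⟨?_, (eventually_gt_atTop 0).mono hs⟩
    have h7 : Tendsto (fun t : ℝ => (t : ℂ)⁻¹) atTop (nhds 0) := by
      have := (Complex.continuous_ofReal.tendsto 0).comp tendsto_inv_atTop_zero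
      simpa [Function.comp_def] using this
    have hω0 : ω ≠ 0 := by rw [← norm_pos_iff, hω.norm]; norm_num
    have h8 : Tendsto (fun t : ℝ => ((t : ℂ)⁻¹ + ω) / ((t : ℂ)⁻¹ - ω)) atTop (nhds (-1)) := by
      have := (h7.add_const ω).div (h7.sub_const ω) (by simpa using hω0)
      rw [zero_add, zero_sub, div_neg, div_self hω0] at this
      exact this
    refine h8.congr' ((eventually_gt_atTop 0).mono fun t ht => ?_)
    have ht' : (t : ℂ) ≠ 0 := by exact_mod_cast ht.ne'
    rw [← mul_div_mul_left _ _ ht']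
    congr 1 <;> field_simp
  have := integral_Ioi_of_hasDerivAt_of_tendsto' h1 ((wedgeIntegrable_two_div ω hω).const_mul ω)
    (hl.comp h6)
  simpa [rayIntegral] using this

theorem AiryDir.im_div (t : ℝ) {ω : ℂ} (h : AiryDir ω) :
    ((1 + (t : ℂ) * ω) / (1 - t * ω)).im = 2 * t * ω.im / (1 - t + t ^ 2) := by
  rw [Complex.div_im, ← Complex.sq_norm, h.normSq_one_sub]
  simp only [Complex.add_im, Complex.one_im, Complex.sub_re, Complex.one_re, Complex.add_re,
    Complex.sub_im, h.ofReal_mul_re, Complex.im_ofReal_mul]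
  ring

theorem wedgeInt_two_div : wedgeInt (fun v => 2 / ((1 + v) * (1 - v))) = 2 * Real.pi * Complex.I := by
  have hpos (t : ℝ) : 0 < 1 - t + t ^ 2 := by nlinarith [sq_nonneg (t - 1 / 2)]
  have hu : (Complex.exp (Complex.I * Real.pi / 3)).im = √3 / 2 := by
    have : Complex.I * Real.pi / 3 = ((Real.pi / 3 : ℝ) : ℂ) * Complex.I := by push_cast; ring
    rw [this, Complex.exp_ofReal_mul_I_im, Real.sin_pi_div_three]
  have hd : (Complex.exp (-(Complex.I * Real.pi / 3))).im = -(√3 / 2) := by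
    have : -(Complex.I * Real.pi / 3) = ((-(Real.pi / 3) : ℝ) : ℂ) * Complex.I := by
      push_cast; ring
    rw [this, Complex.exp_ofReal_mul_I_im, Real.sin_neg, Real.sin_pi_div_three]
  have hup (t : ℝ) (ht : 0 < t) : 0 < ((1 + (t : ℂ) * Complex.exp (Complex.I * Real.pi / 3)) /
      (1 - t * Complex.exp (Complex.I * Real.pi / 3))).im := by
    rw [airyDir_up.im_div, hu]
    have := hpos t
    positivity
  have hdn (t : ℝ) (ht : 0 < t) : ((1 + (t : ℂ) * Complex.exp (-(Complex.I * Real.pi / 3))) /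
      (1 - t * Complex.exp (-(Complex.I * Real.pi / 3)))).im < 0 := by
    rw [airyDir_down.im_div, hd]
    have := hpos t
    rw [mul_neg, neg_div]
    have : 0 < 2 * t * (√3 / 2) / (1 - t + t ^ 2) := by positivity
    linarith
  have h1 := rayIntegral_two_div airyDir_up
    (Complex.tendsto_log_nhdsWithin_im_nonneg_of_re_neg_of_im_zero (z := -1) (by simp) (by simp))
    (fun t ht => (hup t ht).le) (fun t ht => Or.inr (hup t ht).ne')
  have h2 := rayIntegral_two_div airyDir_down
    (Complex.tendsto_log_nhdsWithin_im_neg_of_re_neg_of_im_zero (z := -1) (by simp) (by simp))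
    (fun t ht => hdn t ht) (fun t ht => Or.inr (hdn t ht).ne)
  rw [wedgeInt, h1, h2]
  simp
  ring

/-- The residue theorem for the Airy contour and a simple pole at `1`. -/
theorem wedgeInt_div_one_sub {f : ℂ → ℂ} {C : ℝ}
    (hf : DifferentiableOn ℂ f {z | -1 / 2 < z.re}) (hi : WedgeIntegrable fun v => f v / (1 - v))
    (hb : ∀ z : ℂ, 2 ≤ z.re → |z.im| ≤ 2 * z.re → ‖f z‖ * z.re ^ 2 ≤ C) :
    wedgeInt (fun v => f v / (1 - v)) = 2 * Real.pi * Complex.I * f 1 := by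
  -- The multiple of `2/(1+v)` is chosen to make `g 1 = 0`, so that dividing by `v - 1` leaves a
  -- holomorphic function. Its pole at `-1` lies outside the half plane, and the subtracted term has
  -- an explicitly known integral.
  set g : ℂ → ℂ := fun v => f 1 * (2 / (1 + v)) - f v with hg
  have hne (z : ℂ) (hz : -1 / 2 < z.re) : 1 + z ≠ 0 := fun h => by
    have := congrArg Complex.re h
    simp at this
    linarith
  have hgd : DifferentiableOn ℂ g {z | -1 / 2 < z.re} := by
    refine DifferentiableOn.sub (fun z hz => ?_) hf
    have := hne z hz
    exact (DifferentiableAt.const_mul (DifferentiableAt.div (by fun_prop) (by fun_prop) this)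
      _).differentiableWithinAt
  have h1 : DifferentiableOn ℂ (dslope g 1) {z | -1 / 2 < z.re} :=
    (Complex.differentiableOn_dslope (isOpen_neg_half_lt_re.mem_nhds
      (by simp; norm_num))).mpr hgd
  have hg1 : g 1 = 0 := by simp [hg]; ring
  have hds (z : ℂ) (hz : z ≠ 1) : dslope g 1 z =
      f z / (1 - z) + (-f 1) * (2 / ((1 + z) * (1 - z))) := by
    rw [dslope_of_ne _ hz, slope_def_field, hg1, hg]
    have h2 : z - 1 ≠ 0 := sub_ne_zero.mpr hz
    have h3 : 1 - z ≠ 0 := sub_ne_zero.mpr hz.symm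
    by_cases h4 : 1 + z = 0
    · simp only [h4, div_zero, mul_zero, zero_mul]
      field_simp
      ring
    · field_simp
      ring
  have hray (ω : ℂ) (hω : AiryDir ω) (t : ℝ) (_ : 0 < t) :
      f (t * ω) / (1 - t * ω) + (-f 1) * (2 / ((1 + t * ω) * (1 - t * ω))) =
        dslope g 1 (t * ω) :=
    (hds _ fun h => hω.one_sub_ne_zero t (by rw [h, sub_self])).symm
  have hI2 := wedgeIntegrable_two_div.const_mul (-f 1)
  have h0 : wedgeInt (dslope g 1) = 0 := by
    refine wedgeInt_eq_zero_of_differentiableOn (C := 2 * C + 8 * ‖f 1‖) h1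
      ((hi.add hI2).congr hray) fun z hz1 hz2 => ?_
    have hz : z ≠ 1 := fun h => by rw [h] at hz1; norm_num at hz1
    have e1 : z.re / 2 ≤ ‖1 - z‖ := by
      have := Complex.abs_re_le_norm (1 - z)
      rw [Complex.sub_re, Complex.one_re] at this
      have := neg_abs_le (1 - z.re)
      linarith
    have e2 : z.re / 2 ≤ ‖1 + z‖ := by
      have := Complex.abs_re_le_norm (1 + z)
      rw [Complex.add_re, Complex.one_re] at this
      have := le_abs_self (1 + z.re)
      linarith
    have e3 := hb z hz1 hz2
    rw [hds z hz]
    have e4 : ‖f z / (1 - z)‖ ≤ 2 * ‖f z‖ := by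
      rw [norm_div, div_le_iff₀ (by linarith)]
      nlinarith [norm_nonneg (f z)]
    have e5 : ‖-f 1 * (2 / ((1 + z) * (1 - z)))‖ ≤ 8 * ‖f 1‖ / z.re ^ 2 := by
      rw [norm_mul, norm_neg, norm_div, norm_mul, Complex.norm_ofNat, ← mul_div_assoc,
        div_le_div_iff₀ (by nlinarith) (by positivity)]
      have : z.re / 2 * (z.re / 2) ≤ ‖1 + z‖ * ‖1 - z‖ :=
        mul_le_mul e2 e1 (by linarith) (by positivity)
      nlinarith [norm_nonneg (f 1), mul_le_mul_of_nonneg_left this (norm_nonneg (f 1))]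
    calc ‖f z / (1 - z) + -f 1 * (2 / ((1 + z) * (1 - z)))‖ * z.re ^ 2
        ≤ (2 * ‖f z‖ + 8 * ‖f 1‖ / z.re ^ 2) * z.re ^ 2 := by
          gcongr
          exact (norm_add_le _ _).trans (add_le_add e4 e5)
      _ = 2 * (‖f z‖ * z.re ^ 2) + 8 * ‖f 1‖ := by
          have : z.re ≠ 0 := by linarith
          field_simp
      _ ≤ _ := by linarith
  rw [← wedgeInt_congr
    (f := fun v => f v / (1 - v) + (-f 1) * (2 / ((1 + v) * (1 - v)))) hray, wedgeInt_add hi hI2, wedgeInt_const_mul, wedgeInt_two_div] at h0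
  linear_combination h0

/-! ### Laguerre polynomials as integrals along the Airy contour. -/

theorem norm_exp_mul_log (A : ℝ) (z : ℂ) :
    ‖Complex.exp (A * Complex.log z)‖ = Real.exp (A * Real.log ‖z‖) := by
  rw [Complex.norm_exp, Complex.re_ofReal_mul, Complex.log_re]

theorem norm_exp_mul_log_le (A : ℝ) {z : ℂ} {y : ℝ} (hz : 1 ≤ ‖z‖) (hy : ‖z‖ ≤ y) :
    ‖Complex.exp (A * Complex.log z)‖ ≤ y ^ ⌈|A|⌉₊ := by
  rw [norm_exp_mul_log]
  have h1 : 0 ≤ Real.log ‖z‖ := Real.log_nonneg hz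
  have h2 : A ≤ ⌈|A|⌉₊ := (le_abs_self A).trans (Nat.le_ceil _)
  calc Real.exp (A * Real.log ‖z‖) ≤ Real.exp (⌈|A|⌉₊ * Real.log ‖z‖) := by gcongr
    _ = ‖z‖ ^ ⌈|A|⌉₊ := by
      rw [Real.exp_nat_mul, Real.exp_log (by linarith)]
    _ ≤ y ^ ⌈|A|⌉₊ := by gcongr

theorem wedgeIntegrable_laguerre {c : ℝ} (hc : 0 < c) (A : ℝ) (k : ℕ) :
    WedgeIntegrable fun v =>
      Complex.exp (-c * v) * Complex.exp (A * Complex.log (1 + v)) / (1 - v) ^ k := by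
  refine wedgeIntegrable_of_bound (C := 2 ^ k) ⌈|A|⌉₊ (half_pos hc) (fun ω hω t ht => ?_)
    fun ω hω t ht => ?_
  · have h1 := hω.one_add_mem_slitPlane ht
    have h2 := pow_ne_zero k (hω.one_sub_ne_zero t)
    refine ContinuousAt.div₀ (ContinuousAt.mul (by fun_prop) ?_) (by fun_prop) h2
    exact (continuousAt_const.mul
      (ContinuousAt.clog (f := fun v => 1 + v) (by fun_prop) h1)).cexp
  · rw [norm_div, norm_mul, norm_pow]
    have h1 : ‖Complex.exp (-c * ((t : ℂ) * ω))‖ = Real.exp (-(c / 2) * t) := by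
      rw [Complex.norm_exp, ← Complex.ofReal_neg, Complex.re_ofReal_mul, hω.ofReal_mul_re]
      ring_nf
    have h2 := norm_exp_mul_log_le A (hω.one_le_norm_one_add ht.le) (hω.norm_one_add_le ht.le)
    have h3 : (1 / 2) ^ k ≤ ‖1 - (t : ℂ) * ω‖ ^ k :=
      pow_le_pow_left₀ (by norm_num) (hω.half_le_norm_one_sub t) k
    rw [h1, div_le_iff₀ (lt_of_lt_of_le (by positivity) h3)]
    calc Real.exp (-(c / 2) * t) * ‖Complex.exp (A * Complex.log (1 + t * ω))‖
        ≤ Real.exp (-(c / 2) * t) * (1 + t) ^ ⌈|A|⌉₊ := by gcongr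
      _ = 2 ^ k * ((1 + t) ^ ⌈|A|⌉₊ * Real.exp (-(c / 2) * t)) * (1 / 2) ^ k := by
        rw [one_div, inv_pow]
        field_simp
      _ ≤ _ := by gcongr

/-- The contour integral `∫ exp (-c v) (1+v)^A (1-v)^(-k) dv`. -/
def laguerreInt (c A : ℝ) (k : ℕ) : ℂ :=
  wedgeInt fun v => Complex.exp (-c * v) * Complex.exp (A * Complex.log (1 + v)) / (1 - v) ^ k

/-- Integrate the derivative of the integrand with exponents `A` and `k`. With `A = n + 1 + α` and
pole order `n + 1`, the two integrals on the right belong to degree `n` at parameters `α + 1` and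
`α`, exactly as in the recursion defining `laguerreMonic`. -/
theorem laguerreInt_succ {c : ℝ} (hc : 0 < c) (A : ℝ) (k : ℕ) :
    k * laguerreInt c A (k + 1) = c * laguerreInt c A k - A * laguerreInt c (A - 1) k := by
  have hI (A : ℝ) (k : ℕ) := wedgeIntegrable_laguerre hc A k
  have hd : wedgeInt (fun v => (-c : ℂ) *
      (Complex.exp (-c * v) * Complex.exp (A * Complex.log (1 + v)) / (1 - v) ^ k) +
      ((A : ℂ) * (Complex.exp (-c * v) *
        Complex.exp ((A - 1 : ℝ) * Complex.log (1 + v)) / (1 - v) ^ k) +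
      (k : ℂ) * (Complex.exp (-c * v) * Complex.exp (A * Complex.log (1 + v)) /
        (1 - v) ^ (k + 1)))) = 0 := by
    refine wedgeInt_deriv_eq_zero (fun ω hω t ht => ?_) (hI A k)
      (((hI A k).const_mul _).add (((hI (A - 1) k).const_mul _).add ((hI A (k + 1)).const_mul _)))
    have h1 := hω.one_add_mem_slitPlane ht
    have h1' := Complex.slitPlane_ne_zero h1
    have h2 := hω.one_sub_ne_zero t
    have e1 := ((hasDerivAt_id ((t : ℂ) * ω)).const_mul (-c : ℂ)).cexp
    have e2 := ((((hasDerivAt_id ((t : ℂ) * ω)).const_add 1).clog h1).const_mul (A : ℂ)).cexp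
    have e3 := ((hasDerivAt_id ((t : ℂ) * ω)).const_sub 1).pow k
    refine ((e1.mul e2).div e3 (pow_ne_zero k h2)).congr_deriv ?_
    have e4 : Complex.exp ((A - 1 : ℝ) * Complex.log (1 + t * ω)) =
        Complex.exp (A * Complex.log (1 + t * ω)) / (1 + t * ω) := by
      rw [Complex.ofReal_sub, sub_mul, Complex.exp_sub, Complex.ofReal_one, one_mul,
        Complex.exp_log h1']
    rw [e4]
    simp only [id, Pi.mul_apply, Pi.pow_apply]
    cases k with
    | zero => simp; field_simp
    | succ k =>
      simp only [Nat.add_sub_cancel]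
      push_cast
      field_simp
      ring
  rw [wedgeInt_add ((hI A k).const_mul _)
    (((hI (A - 1) k).const_mul _).add ((hI A (k + 1)).const_mul _)),
    wedgeInt_add ((hI (A - 1) k).const_mul _) ((hI A (k + 1)).const_mul _), wedgeInt_const_mul,
    wedgeInt_const_mul, wedgeInt_const_mul] at hd
  simp only [laguerreInt]
  linear_combination hd

theorem laguerreInt_one {c : ℝ} (hc : 0 < c) (A : ℝ) :
    laguerreInt c A 1 = 2 * Real.pi * Complex.I * (Real.exp (-c) * (2 : ℝ) ^ A : ℝ) := by
  set n := ⌈|A|⌉₊ with hn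
  have h1 := wedgeInt_div_one_sub
    (f := fun v => Complex.exp (-c * v) * Complex.exp (A * Complex.log (1 + v)))
    -- In the sector, `|1+z| ≤ 4 Re z` bounds the power, and `(c x)^(n+2) ≤ (n+2)! exp(c x)` lets
    -- the exponential absorb it together with the factor `x²`.
    (C := 4 ^ n * ((n + 2).factorial / c ^ (n + 2))) ?_
    (by simpa using wedgeIntegrable_laguerre hc A 1) ?_
  · simp only [laguerreInt, pow_one]
    rw [h1]
    congr 1
    rw [Complex.ofReal_mul, Complex.ofReal_exp, Complex.ofReal_cpow zero_le_two,
      Complex.cpow_def_of_ne_zero (by simp)]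
    push_cast
    rw [mul_one, one_add_one_eq_two, mul_comm (A : ℂ)]
  · intro z hz
    have hz' : 1 + z ∈ Complex.slitPlane := by
      left
      simp only [Complex.add_re, Complex.one_re]
      have : -1 / 2 < z.re := hz
      linarith
    refine (DifferentiableAt.mul (by fun_prop) (DifferentiableAt.cexp ?_)).differentiableWithinAt
    exact (DifferentiableAt.clog (by fun_prop) hz').const_mul _
  · intro z hz1 hz2
    have e1 : 1 ≤ ‖1 + z‖ := by
      have := Complex.abs_re_le_norm (1 + z)
      rw [Complex.add_re, Complex.one_re] at this
      have := le_abs_self (1 + z.re)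
      linarith
    have e2 : ‖1 + z‖ ≤ 4 * z.re := by
      have := Complex.norm_le_abs_re_add_abs_im (1 + z)
      simp only [Complex.add_re, Complex.one_re, Complex.add_im, Complex.one_im, zero_add] at this
      rw [abs_of_nonneg (by linarith : 0 ≤ 1 + z.re)] at this
      linarith
    have e3 := norm_exp_mul_log_le A e1 e2
    have e4 : ‖Complex.exp (-c * z)‖ = (Real.exp (c * z.re))⁻¹ := by
      rw [Complex.norm_exp, ← Complex.ofReal_neg, Complex.re_ofReal_mul, neg_mul, Real.exp_neg]
    have e5 := Real.pow_div_factorial_le_exp (c * z.re) (by positivity) (n + 2)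
    rw [div_le_iff₀ (by positivity)] at e5
    rw [norm_mul, e4]
    calc (Real.exp (c * z.re))⁻¹ * ‖Complex.exp (A * Complex.log (1 + z))‖ * z.re ^ 2
        ≤ (Real.exp (c * z.re))⁻¹ * (4 * z.re) ^ n * z.re ^ 2 := by gcongr
      _ = 4 ^ n * ((c * z.re) ^ (n + 2) / c ^ (n + 2)) * (Real.exp (c * z.re))⁻¹ := by
        field_simp
        ring
      _ ≤ 4 ^ n * (Real.exp (c * z.re) * (n + 2).factorial / c ^ (n + 2)) *
          (Real.exp (c * z.re))⁻¹ := by gcongr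
      _ = _ := by field_simp

/-- A Laguerre polynomial as an integral along the Airy contour. -/
theorem laguerreMonic_eval_eq_laguerreInt {b x : ℝ} (hb : 0 < b) (hx : 0 < x) (n : ℕ) (α : ℝ) :
    laguerreInt (b * x / 2) (n + α) (n + 1) = 2 * Real.pi * Complex.I *
      (Real.exp (-(b * x / 2)) * (2 : ℝ) ^ α * (b ^ n / n.factorial) *
        (laguerreMonic b n α).eval x : ℝ) := by
  have hc : 0 < b * x / 2 := by positivity
  induction n generalizing α with
  | zero =>
    simp only [Nat.cast_zero, zero_add, laguerreMonic, laguerreInt_one hc]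
    simp
  | succ n ih =>
    have h1 := laguerreInt_succ hc ((n + 1 : ℕ) + α) (n + 1)
    rw [show ((n + 1 : ℕ) + α : ℝ) - 1 = n + α by push_cast; ring, ih α,
      show ((n + 1 : ℕ) + α : ℝ) = n + (α + 1) by push_cast; ring, ih (α + 1),
      ← show ((n + 1 : ℕ) + α : ℝ) = n + (α + 1) by push_cast; ring] at h1
    have hn : ((n + 1 : ℕ) : ℂ) ≠ 0 := by exact_mod_cast n.succ_ne_zero
    refine mul_left_cancel₀ hn (h1.trans ?_)
    rw [laguerreMonic_succ_eval, Nat.factorial_succ, Real.rpow_add two_pos, Real.rpow_one]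
    have hb' : (b : ℂ) ≠ 0 := by exact_mod_cast hb.ne'
    push_cast
    have h2 : ((n : ℂ) + 1) ≠ 0 := by exact_mod_cast hn
    have h3 : (n.factorial : ℂ) ≠ 0 := by exact_mod_cast n.factorial_ne_zero
    field_simp
    ring

/-- The derivative of a Laguerre polynomial as an integral along the Airy contour. -/
theorem laguerreMonic_derivative_eval_eq_laguerreInt {b x : ℝ} (hb : 0 < b) (hx : 0 < x) {n : ℕ}
    (hn : n ≠ 0) (α : ℝ) : b / 2 * laguerreInt (b * x / 2) (n + α) n = 2 * Real.pi * Complex.I *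
      (Real.exp (-(b * x / 2)) * (2 : ℝ) ^ α * (b ^ n / n.factorial) *
        (laguerreMonic b n α).derivative.eval x : ℝ) := by
  obtain ⟨m, rfl⟩ := Nat.exists_eq_succ_of_ne_zero hn
  -- Differentiation replaces `(n, α)` by `(n-1, α+1)`: the exponent `n + α` is unchanged and only
  -- the order of the pole drops.
  have h1 := laguerreMonic_eval_eq_laguerreInt hb hx m (α + 1)
  rw [show (m + (α + 1) : ℝ) = (m + 1 : ℕ) + α by push_cast; ring] at h1
  rw [Nat.succ_eq_add_one, h1, derivative_laguerreMonic, Nat.factorial_succ,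
    Real.rpow_add two_pos, Real.rpow_one, Polynomial.eval_mul, Polynomial.eval_C,
    Nat.add_sub_cancel]
  have h2 : ((m : ℂ) + 1) ≠ 0 := by exact_mod_cast m.succ_ne_zero
  have h3 : (m.factorial : ℂ) ≠ 0 := by exact_mod_cast m.factorial_ne_zero
  push_cast
  field_simp
  ring

/-! ### Moments of the Airy integrand. -/

/-- The moments `∫ v^k exp (v³/3 - ξ v) dv` along the Airy contour. -/
def airyMoment (ξ : ℝ) (k : ℕ) : ℂ := wedgeInt fun v => v ^ k * Complex.exp (v ^ 3 / 3 - ξ * v)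

theorem neg_cube_add_le {M t : ℝ} (hM : 0 ≤ M) (ht : 0 ≤ t) :
    -(t ^ 3 / 6) + M * t ≤ M * (6 * M + 1) := by
  by_cases h : 6 * M ≤ t ^ 2
  · nlinarith [mul_le_mul_of_nonneg_right h ht]
  · have : t ≤ 6 * M + 1 := by nlinarith
    nlinarith [pow_nonneg ht 3, mul_le_mul_of_nonneg_left this hM]

theorem AiryDir.norm_airy (ξ t : ℝ) {ω : ℂ} (h : AiryDir ω) :
    ‖Complex.exp (((t : ℂ) * ω) ^ 3 / 3 - ξ * (t * ω))‖ =
      Real.exp (-(t ^ 3 / 3) - ξ * (t / 2)) := by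
  rw [Complex.norm_exp, mul_pow, h.cube_eq, Complex.sub_re, Complex.re_ofReal_mul,
    h.ofReal_mul_re, ← Complex.ofReal_pow]
  congr 2
  have : ((t ^ 3 : ℝ) : ℂ) * -1 / 3 = ((-(t ^ 3 / 3) : ℝ) : ℂ) := by push_cast; ring
  rw [this, Complex.ofReal_re]

theorem neg_mul_half_le (ξ : ℝ) {t : ℝ} (ht : 0 ≤ t) : -(ξ * (t / 2)) ≤ |ξ| * t := by
  nlinarith [neg_abs_le ξ, abs_nonneg ξ, mul_le_mul_of_nonneg_right (neg_abs_le ξ) ht,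
    mul_nonneg (abs_nonneg ξ) ht]

/-- The decay of the Airy integrand, with some room to spare. -/
theorem exp_airy_le (ξ : ℝ) {t : ℝ} (ht : 0 ≤ t) :
    Real.exp (-(t ^ 3 / 6) + |ξ| * t) ≤
      Real.exp ((|ξ| + 1) * (6 * (|ξ| + 1) + 1)) * Real.exp (-1 * t) := by
  rw [← Real.exp_add, Real.exp_le_exp]
  have := neg_cube_add_le (M := |ξ| + 1) (by positivity) ht
  linarith

theorem AiryDir.norm_airy_le (ξ : ℝ) {t : ℝ} (ht : 0 ≤ t) {ω : ℂ} (h : AiryDir ω) :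
    ‖Complex.exp (((t : ℂ) * ω) ^ 3 / 3 - ξ * (t * ω))‖ ≤
      Real.exp ((|ξ| + 1) * (6 * (|ξ| + 1) + 1)) * Real.exp (-1 * t) := by
  rw [h.norm_airy]
  refine le_trans (Real.exp_le_exp.mpr ?_) (exp_airy_le ξ ht)
  have := neg_mul_half_le ξ ht
  have := pow_nonneg ht 3
  linarith

theorem wedgeIntegrable_airy (ξ : ℝ) (k : ℕ) :
    WedgeIntegrable fun v => v ^ k * Complex.exp (v ^ 3 / 3 - ξ * v) := by
  refine wedgeIntegrable_of_bound (C := Real.exp ((|ξ| + 1) * (6 * (|ξ| + 1) + 1)))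
    k one_pos (fun ω hω t ht => by fun_prop) fun ω hω t ht => ?_
  rw [norm_mul, norm_pow, hω.norm_ofReal_mul ht.le]
  exact (mul_le_mul (pow_le_pow_left₀ ht.le (by linarith : t ≤ 1 + t) k) (hω.norm_airy_le ξ ht.le)
    (norm_nonneg _) (by positivity)).trans_eq (by ring)

/-- This is the Airy equation `Ai'' = ξ Ai`, obtained by integrating the derivative of the
exponential. -/
theorem airyMoment_two (ξ : ℝ) : airyMoment ξ 2 = ξ * airyMoment ξ 0 := by
  have hI (k : ℕ) := wedgeIntegrable_airy ξ k
  have hd : wedgeInt (fun v => v ^ 2 * Complex.exp (v ^ 3 / 3 - ξ * v) +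
      (-ξ : ℂ) * (v ^ 0 * Complex.exp (v ^ 3 / 3 - ξ * v))) = 0 := by
    refine wedgeInt_deriv_eq_zero (g := fun v => Complex.exp (v ^ 3 / 3 - ξ * v))
      (fun ω _ t _ => ?_) (by simpa using hI 0) ((hI 2).add ((hI 0).const_mul _))
    have h1 := ((((hasDerivAt_id ((t : ℂ) * ω)).pow 3).div_const 3).sub
      ((hasDerivAt_id ((t : ℂ) * ω)).const_mul (ξ : ℂ))).cexp
    refine h1.congr_deriv ?_
    simp
    ring
  rw [wedgeInt_add (hI 2) ((hI 0).const_mul _), wedgeInt_const_mul] at hd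
  simp only [airyMoment]
  linear_combination hd

theorem airyMoment_add_three (ξ : ℝ) (k : ℕ) :
    airyMoment ξ (k + 3) = ξ * airyMoment ξ (k + 1) - (k + 1) * airyMoment ξ k := by
  have hI (k : ℕ) := wedgeIntegrable_airy ξ k
  have hd : wedgeInt (fun v => v ^ (k + 3) * Complex.exp (v ^ 3 / 3 - ξ * v) +
      ((-ξ : ℂ) * (v ^ (k + 1) * Complex.exp (v ^ 3 / 3 - ξ * v)) +
      (k + 1 : ℂ) * (v ^ k * Complex.exp (v ^ 3 / 3 - ξ * v)))) = 0 := by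
    refine wedgeInt_deriv_eq_zero (fun ω _ t _ => ?_) (hI (k + 1))
      ((hI _).add (((hI _).const_mul _).add ((hI _).const_mul _)))
    have h1 := ((((hasDerivAt_id ((t : ℂ) * ω)).pow 3).div_const 3).sub
      ((hasDerivAt_id ((t : ℂ) * ω)).const_mul (ξ : ℂ))).cexp
    refine (((hasDerivAt_id ((t : ℂ) * ω)).pow (k + 1)).mul h1).congr_deriv ?_
    simp
    ring
  rw [wedgeInt_add (hI _) (((hI _).const_mul _).add ((hI _).const_mul _)),
    wedgeInt_add ((hI _).const_mul _) ((hI _).const_mul _), wedgeInt_const_mul,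
    wedgeInt_const_mul] at hd
  simp only [airyMoment]
  linear_combination hd

/-- Differentiation under the integral sign; the dominating function is uniform for parameters
within distance `1` of `ξ`. -/
theorem hasDerivAt_rayIntegral_airy (ξ : ℝ) {ω : ℂ} (hω : AiryDir ω) :
    HasDerivAt (fun ξ : ℝ => rayIntegral ω fun v => Complex.exp (v ^ 3 / 3 - ξ * v))
      (-rayIntegral ω fun v => v ^ 1 * Complex.exp (v ^ 3 / 3 - ξ * v)) ξ := by
  have hI (ξ : ℝ) : Integrable (fun t : ℝ => ω * Complex.exp (((t : ℂ) * ω) ^ 3 / 3 - ξ * (t * ω)))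
      (volume.restrict (Set.Ioi 0)) := by
    simpa [IntegrableOn] using (wedgeIntegrable_airy ξ 0 ω hω).const_mul ω
  set M := |ξ| + 1 with hM
  set K := Real.exp ((M + 1) * (6 * (M + 1) + 1)) with hK
  have h := hasDerivAt_integral_of_dominated_loc_of_deriv_le
    (μ := volume.restrict (Set.Ioi (0 : ℝ))) (x₀ := ξ) (s := Metric.ball ξ 1)
    (F := fun (ξ t : ℝ) => ω * Complex.exp (((t : ℂ) * ω) ^ 3 / 3 - ξ * (t * ω)))
    (F' := fun (ξ t : ℝ) =>
      ω * (-(((t : ℂ) * ω) ^ 1 * Complex.exp (((t : ℂ) * ω) ^ 3 / 3 - ξ * (t * ω)))))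
    (bound := fun t => K * ((1 + t) ^ 1 * Real.exp (-1 * t)))
    (Metric.ball_mem_nhds ξ one_pos) (Eventually.of_forall fun ξ => (hI ξ).1) (hI ξ)
    (by fun_prop) ?_ ((integrableOn_one_add_pow_mul_exp_neg 1 one_pos).const_mul K) ?_
  · refine h.2.congr_deriv ?_
    rw [rayIntegral, ← integral_neg]
    simp only [mul_neg]
  · refine (ae_restrict_mem measurableSet_Ioi).mono fun t ht η hη => ?_
    have ht0 : 0 < t := ht
    have hη' : |η| ≤ M := by
      rw [Metric.mem_ball, Real.dist_eq] at hη
      have := abs_sub_abs_le_abs_sub η ξ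
      linarith
    rw [norm_mul, hω.norm, one_mul, norm_neg, norm_mul, norm_pow, hω.norm_ofReal_mul ht0.le]
    have h1 := hω.norm_airy_le η ht0.le
    have h2 : Real.exp ((|η| + 1) * (6 * (|η| + 1) + 1)) ≤ K := by
      rw [hK]
      gcongr
    exact (mul_le_mul (pow_le_pow_left₀ ht0.le (by linarith : t ≤ 1 + t) 1)
      (h1.trans (mul_le_mul_of_nonneg_right h2 (Real.exp_pos _).le))
      (norm_nonneg _) (by positivity)).trans_eq (by ring)
  · refine ae_of_all _ fun t η _ => ?_
    have h1 : HasDerivAt (fun η : ℝ => ((t : ℂ) * ω) ^ 3 / 3 - η * (t * ω)) (-(t * ω)) η := by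
      simpa using ((Complex.ofRealCLM.hasDerivAt (x := η)).mul_const ((t : ℂ) * ω)).const_sub
        (((t : ℂ) * ω) ^ 3 / 3)
    refine (h1.cexp.const_mul ω).congr_deriv ?_
    ring

theorem airyMoment_zero (ξ : ℝ) : airyMoment ξ 0 = 2 * Real.pi * Complex.I * airyAi ξ := by
  rw [← airyContour_eq_airyAi, airyContour, mul_inv_cancel_left₀ Complex.two_pi_I_ne_zero]
  simp [airyMoment, wedgeInt, rayIntegral, airyRay]

theorem airyMoment_one (ξ : ℝ) :
    airyMoment ξ 1 = -(2 * Real.pi * Complex.I * (deriv airyAi ξ : ℝ)) := by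
  have h1 : HasDerivAt airyContour ((2 * Real.pi * Complex.I)⁻¹ * -airyMoment ξ 1) ξ := by
    have := ((hasDerivAt_rayIntegral_airy ξ airyDir_up).sub
      (hasDerivAt_rayIntegral_airy ξ airyDir_down)).const_mul (2 * Real.pi * Complex.I)⁻¹
    refine this.congr_deriv ?_
    rw [airyMoment, wedgeInt]
    ring
  have h2 : HasDerivAt airyAi ((2 * Real.pi * Complex.I)⁻¹ * -airyMoment ξ 1).re ξ :=
    (Complex.reCLM.hasFDerivAt.comp_hasDerivAt ξ h1)
  -- Since `airyContour` takes real values, its derivative agrees with the real part of that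
  -- derivative, so nothing is lost in passing to `airyAi`.
  have h3 : HasDerivAt airyContour
      (((2 * Real.pi * Complex.I)⁻¹ * -airyMoment ξ 1).re : ℂ) ξ := by
    have : airyContour = fun ξ => (airyAi ξ : ℂ) := funext airyContour_eq_airyAi
    rw [this]
    exact h2.ofReal_comp
  have h4 := h1.unique h3
  rw [h2.deriv, ← h4, mul_inv_cancel_left₀ Complex.two_pi_I_ne_zero, neg_neg]

/-! ### Perturbed Airy integrals to second order. -/

/-- Here `p` is the first order and `s` the second order part of `w`. After the cubic Taylor
remainder, `w` is replaced by `p + s` in the linear term but only by `p` in the quadratic one, where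
`w² - p² = (w-p)(w+p)`. -/
theorem norm_exp_sub_quadratic_le (w p s : ℂ) :
    ‖Complex.exp w - (1 + p + (s + p ^ 2 / 2))‖ ≤ ‖w‖ ^ 3 * Real.exp ‖w‖ +
      ‖w - (p + s)‖ + ‖w - p‖ * (‖w‖ + ‖p‖) := by
  have h1 := Complex.norm_exp_sub_sum_le_norm_mul_exp w 3
  have h2 : ∑ m ∈ Finset.range 3, w ^ m / (m.factorial : ℂ) = 1 + w + w ^ 2 / 2 := by
    simp [Finset.sum_range_succ, Nat.factorial]
  rw [h2] at h1
  have h3 : Complex.exp w - (1 + p + (s + p ^ 2 / 2)) =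
      (Complex.exp w - (1 + w + w ^ 2 / 2)) + (w - (p + s)) + (w - p) * ((w + p) / 2) := by ring
  rw [h3]
  refine (norm_add₃_le).trans ?_
  rw [norm_mul]
  gcongr
  rw [norm_div, Complex.norm_ofNat]
  have := norm_add_le w p
  have := norm_nonneg (w + p)
  linarith

/-- A phase `h` and an amplitude exponent `μ` whose integrals along the Airy contour, scaled at `0`,
are perturbations of the Airy integral. -/
structure AiryPhase (h μ : ℂ → ℂ) (a₄ a₅ m₁ m₂ : ℂ) (C c κ : ℝ) : Prop where
  C_nonneg : 0 ≤ C
  c_pos : 0 < c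
  κ_pos : 0 < κ
  phase : ∀ v, ‖v‖ ≤ c → ‖h v - (v ^ 3 / 3 + a₄ * v ^ 4 + a₅ * v ^ 5)‖ ≤ C * ‖v‖ ^ 6
  amplitude : ∀ v, ‖v‖ ≤ c → ‖μ v - (m₁ * v + m₂ * v ^ 2)‖ ≤ C * ‖v‖ ^ 3
  -- The comparison function is cubic near `0`, matching the double saddle, and only linear at
  -- infinity, which is all that the Laguerre phase provides.
  phase_re : ∀ ω, AiryDir ω → ∀ t : ℝ, 0 ≤ t → (h (t * ω)).re ≤ -(κ * (t ^ 3 / (1 + t ^ 2)))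
  amplitude_re : ∀ ω, AiryDir ω → ∀ t : ℝ, 0 ≤ t → (μ (t * ω)).re ≤ C * t
  phase_continuousAt : ∀ ω, AiryDir ω → ∀ t : ℝ, 0 ≤ t → ContinuousAt h (t * ω)
  amplitude_continuousAt : ∀ ω, AiryDir ω → ∀ t : ℝ, 0 ≤ t → ContinuousAt μ (t * ω)

/-- The perturbed Airy integrand at scale `ε`. -/
def perturbedAiry (h μ : ℂ → ℂ) (ξ ε : ℝ) (k : ℕ) (u : ℂ) : ℂ :=
  u ^ k * Complex.exp (h (ε * u) / ε ^ 3 + μ (ε * u) - ξ * u)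

/-- The second order expansion of `perturbedAiry` in `ε`. -/
def airyExpansion (a₄ a₅ m₁ m₂ : ℂ) (ξ ε : ℝ) (k : ℕ) (u : ℂ) : ℂ :=
  u ^ k * Complex.exp (u ^ 3 / 3 - ξ * u) * (1 + ε * (a₄ * u ^ 4 + m₁ * u) +
    (ε ^ 2 * (a₅ * u ^ 5 + m₂ * u ^ 2) + (ε * (a₄ * u ^ 4 + m₁ * u)) ^ 2 / 2))

namespace AiryPhase

variable {h μ : ℂ → ℂ} {a₄ a₅ m₁ m₂ : ℂ} {C c κ : ℝ}

/-- Dividing the phase by `ε³` turns a term in `(ε u)^j` into one in `ε^(j-3) u^j`. The hypothesis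
`ε t ≤ 1` trades surplus powers of `ε` for powers of `t`, so each coarser bound absorbs the finer
ones. -/
theorem norm_exponent_bounds (H : AiryPhase h μ a₄ a₅ m₁ m₂ C c κ) {ε t : ℝ} (hε : 0 < ε)
    (ht : 0 ≤ t) (hc : ε * t ≤ c) (h1 : ε * t ≤ 1) {u : ℂ} (hu : ‖u‖ = t) {S : ℝ}
    (hS : ‖a₄‖ + ‖a₅‖ + ‖m₁‖ + ‖m₂‖ + C = S) :
    ‖(h (ε * u) / ε ^ 3 + μ (ε * u) - u ^ 3 / 3) -
      (ε * (a₄ * u ^ 4 + m₁ * u) + ε ^ 2 * (a₅ * u ^ 5 + m₂ * u ^ 2))‖ ≤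
        ε ^ 3 * (C * (t ^ 6 + t ^ 3)) ∧
    ‖(h (ε * u) / ε ^ 3 + μ (ε * u) - u ^ 3 / 3) - ε * (a₄ * u ^ 4 + m₁ * u)‖ ≤
        ε ^ 2 * (S * (t ^ 5 + t ^ 2)) ∧
    ‖h (ε * u) / ε ^ 3 + μ (ε * u) - u ^ 3 / 3‖ ≤ ε * (S * (t ^ 4 + t)) ∧
    ‖(ε : ℂ) * (a₄ * u ^ 4 + m₁ * u)‖ ≤ ε * (S * (t ^ 4 + t)) := by
  have hC := H.C_nonneg
  have hεc : (ε : ℂ) ≠ 0 := by exact_mod_cast hε.ne'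
  have hn : ‖(ε : ℂ) * u‖ = ε * t := by
    rw [norm_mul, hu, Complex.norm_real, Real.norm_of_nonneg hε.le]
  have n4 := norm_nonneg a₄
  have n5 := norm_nonneg a₅
  have k1 := norm_nonneg m₁
  have k2 := norm_nonneg m₂
  set w := h (ε * u) / ε ^ 3 + μ (ε * u) - u ^ 3 / 3 with hw
  set p := (ε : ℂ) * (a₄ * u ^ 4 + m₁ * u) with hp
  set s := (ε : ℂ) ^ 2 * (a₅ * u ^ 5 + m₂ * u ^ 2) with hs
  have e1 : ‖w - (p + s)‖ ≤ ε ^ 3 * (C * (t ^ 6 + t ^ 3)) := by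
    have e2 := H.phase (ε * u) (by rw [hn]; exact hc)
    have e3 := H.amplitude (ε * u) (by rw [hn]; exact hc)
    rw [hn] at e2 e3
    have e4 : w - (p + s) = (h (ε * u) - ((ε * u) ^ 3 / 3 + a₄ * (ε * u) ^ 4 +
        a₅ * (ε * u) ^ 5)) / ε ^ 3 + (μ (ε * u) - (m₁ * (ε * u) + m₂ * (ε * u) ^ 2)) := by
      rw [hw, hp, hs]
      field_simp
      ring
    rw [e4]
    refine (norm_add_le _ _).trans ?_
    rw [norm_div, norm_pow, Complex.norm_real, Real.norm_of_nonneg hε.le]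
    have e5 : ‖h (ε * u) - ((ε * u) ^ 3 / 3 + a₄ * (ε * u) ^ 4 + a₅ * (ε * u) ^ 5)‖ / ε ^ 3 ≤
        ε ^ 3 * C * t ^ 6 := by
      rw [div_le_iff₀ (by positivity)]
      exact e2.trans_eq (by ring)
    linarith [e3.trans_eq (by ring : C * (ε * t) ^ 3 = ε ^ 3 * C * t ^ 3)]
  have e2 : ‖s‖ ≤ ε ^ 2 * (‖a₅‖ * t ^ 5 + ‖m₂‖ * t ^ 2) := by
    rw [hs, norm_mul, norm_pow, Complex.norm_real, Real.norm_of_nonneg hε.le]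
    gcongr
    refine (norm_add_le _ _).trans_eq ?_
    rw [norm_mul, norm_mul, norm_pow, norm_pow, hu]
  have e3 : ‖p‖ ≤ ε * (‖a₄‖ * t ^ 4 + ‖m₁‖ * t) := by
    rw [hp, norm_mul, Complex.norm_real, Real.norm_of_nonneg hε.le]
    gcongr
    refine (norm_add_le _ _).trans_eq ?_
    rw [norm_mul, norm_mul, norm_pow, hu]
  have e4 : ‖p‖ ≤ ε * (S * (t ^ 4 + t)) := by
    refine e3.trans ?_
    have f1 : ‖a₄‖ * t ^ 4 ≤ S * t ^ 4 := by gcongr; linarith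
    have f2 : ‖m₁‖ * t ≤ S * t := by gcongr; linarith
    have f3 : ‖a₄‖ * t ^ 4 + ‖m₁‖ * t ≤ S * (t ^ 4 + t) := by linarith
    gcongr
  have e5 : ‖w - p‖ ≤ ε ^ 2 * (‖a₅‖ * t ^ 5 + ‖m₂‖ * t ^ 2 + C * (t ^ 5 + t ^ 2)) := by
    have f1 : w - p = (w - (p + s)) + s := by ring
    have f2 : ε ^ 3 * (C * (t ^ 6 + t ^ 3)) ≤ ε ^ 2 * (C * (t ^ 5 + t ^ 2)) := by
      have : ε ^ 3 * (C * (t ^ 6 + t ^ 3)) = ε * t * (ε ^ 2 * (C * (t ^ 5 + t ^ 2))) := by ring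
      rw [this]
      exact mul_le_of_le_one_left (by positivity) h1
    rw [f1]
    refine (norm_add_le _ _).trans ?_
    linarith
  refine ⟨e1, e5.trans ?_, ?_, e4⟩
  · have : ‖a₅‖ * t ^ 5 + ‖m₂‖ * t ^ 2 + C * (t ^ 5 + t ^ 2) ≤ S * (t ^ 5 + t ^ 2) := by
      have f1 : (‖a₅‖ + C) * t ^ 5 ≤ S * t ^ 5 := by gcongr; linarith
      have f2 : (‖m₂‖ + C) * t ^ 2 ≤ S * t ^ 2 := by gcongr; linarith
      linarith
    gcongr
  · have f1 : w = (w - p) + p := by ring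
    have f2 : ε ^ 2 * (‖a₅‖ * t ^ 5 + ‖m₂‖ * t ^ 2 + C * (t ^ 5 + t ^ 2)) ≤
        ε * (‖a₅‖ * t ^ 4 + ‖m₂‖ * t + C * (t ^ 4 + t)) := by
      have : ε ^ 2 * (‖a₅‖ * t ^ 5 + ‖m₂‖ * t ^ 2 + C * (t ^ 5 + t ^ 2)) =
        ε * t * (ε * (‖a₅‖ * t ^ 4 + ‖m₂‖ * t + C * (t ^ 4 + t))) := by ring
      rw [this]
      exact mul_le_of_le_one_left (by positivity) h1
    have f3 : ‖a₄‖ * t ^ 4 + ‖m₁‖ * t + (‖a₅‖ * t ^ 4 + ‖m₂‖ * t + C * (t ^ 4 + t)) ≤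
        S * (t ^ 4 + t) := by
      have g1 : (‖a₄‖ + ‖a₅‖ + C) * t ^ 4 ≤ S * t ^ 4 := by gcongr; linarith
      have g2 : (‖m₁‖ + ‖m₂‖ + C) * t ≤ S * t := by gcongr; linarith
      linarith
    rw [f1]
    refine (norm_add_le _ _).trans ((add_le_add (e5.trans f2) e3).trans ?_)
    rw [← mul_add]
    gcongr
    linarith

/-- The expansion near the saddle point. -/
theorem norm_sub_le_near (H : AiryPhase h μ a₄ a₅ m₁ m₂ C c κ) {S : ℝ}
    (hS : ‖a₄‖ + ‖a₅‖ + ‖m₁‖ + ‖m₂‖ + C = S) (ξ : ℝ) (k : ℕ) {ε t : ℝ} (hε : 0 < ε)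
    (ht : 0 ≤ t) (hc : ε * t ≤ c) (h1 : ε * t ≤ 1) (hS' : ε * t * S ≤ 1 / 6) {ω : ℂ}
    (hω : AiryDir ω) :
    ‖perturbedAiry h μ ξ ε k (t * ω) - airyExpansion a₄ a₅ m₁ m₂ ξ ε k (t * ω)‖ ≤
      ε ^ 3 * ((8 * S ^ 3 + 2 * S + 8 * S ^ 2) * Real.exp (1 / 6) *
        Real.exp ((|ξ| + 1) * (6 * (|ξ| + 1) + 1))) *
        ((1 + t) ^ (k + 12) * Real.exp (-1 * t)) := by
  have hC := H.C_nonneg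
  have hS0 : 0 ≤ S := by rw [← hS]; positivity
  have hCS : C ≤ S := by
    rw [← hS]
    have : 0 ≤ ‖a₄‖ + ‖a₅‖ + ‖m₁‖ + ‖m₂‖ := by positivity
    linarith
  obtain ⟨b1, b2, b3, b4⟩ := H.norm_exponent_bounds hε ht hc h1 (hω.norm_ofReal_mul ht) hS
  set u := (t : ℂ) * ω with hu
  set w := h (ε * u) / ε ^ 3 + μ (ε * u) - u ^ 3 / 3 with hw
  set p := (ε : ℂ) * (a₄ * u ^ 4 + m₁ * u) with hp
  set s := (ε : ℂ) ^ 2 * (a₅ * u ^ 5 + m₂ * u ^ 2) with hs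
  have hq (i j : ℕ) (hij : i ≤ j) : t ^ i ≤ (1 + t) ^ j :=
    (pow_le_pow_left₀ ht (by linarith) i).trans (pow_le_pow_right₀ (by linarith) hij)
  have hq1 : t ≤ (1 + t) ^ 4 := by simpa using hq 1 4 (by norm_num)
  have hT : 1 ≤ 1 + t := by linarith
  have c1 : ‖w - (p + s)‖ ≤ ε ^ 3 * (2 * S) * (1 + t) ^ 12 := by
    have : C * (t ^ 6 + t ^ 3) ≤ S * (2 * (1 + t) ^ 12) := by
      gcongr
      linarith [hq 6 12 (by norm_num), hq 3 12 (by norm_num)]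
    calc _ ≤ _ := b1
      _ ≤ ε ^ 3 * (S * (2 * (1 + t) ^ 12)) := by gcongr
      _ = _ := by ring
  have c2 : ‖w - p‖ ≤ ε ^ 2 * (2 * S) * (1 + t) ^ 8 := by
    have : S * (t ^ 5 + t ^ 2) ≤ S * (2 * (1 + t) ^ 8) := by
      gcongr
      linarith [hq 5 8 (by norm_num), hq 2 8 (by norm_num)]
    calc _ ≤ _ := b2
      _ ≤ ε ^ 2 * (S * (2 * (1 + t) ^ 8)) := by gcongr
      _ = _ := by ring
  have c0 : ε * (S * (t ^ 4 + t)) ≤ ε * (2 * S) * (1 + t) ^ 4 := by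
    have : S * (t ^ 4 + t) ≤ S * (2 * (1 + t) ^ 4) := by
      gcongr
      linarith [hq 4 4 (by norm_num)]
    calc _ ≤ ε * (S * (2 * (1 + t) ^ 4)) := by gcongr
      _ = _ := by ring
  have c3 := b3.trans c0
  have c4 := b4.trans c0
  -- The perturbation uses up at most half of the decay `exp(-t³/3)`, apart from a constant factor.
  have c5 : ‖w‖ ≤ 1 / 6 + t ^ 3 / 6 := by
    calc ‖w‖ ≤ _ := b3
      _ = ε * t * S * (t ^ 3 + 1) := by ring
      _ ≤ 1 / 6 * (t ^ 3 + 1) := by gcongr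
      _ = _ := by ring
  have hfac : perturbedAiry h μ ξ ε k u - airyExpansion a₄ a₅ m₁ m₂ ξ ε k u =
      u ^ k * Complex.exp (u ^ 3 / 3 - ξ * u) *
        (Complex.exp w - (1 + p + (s + p ^ 2 / 2))) := by
    rw [perturbedAiry, airyExpansion, ← hp, ← hs, mul_sub, mul_assoc _ _ (Complex.exp w),
      ← Complex.exp_add, hw]
    congr 3
    ring
  have hE : 1 ≤ Real.exp (1 / 6 + t ^ 3 / 6) := Real.one_le_exp (by positivity)
  have hmain : ‖Complex.exp w - (1 + p + (s + p ^ 2 / 2))‖ ≤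
      ε ^ 3 * (8 * S ^ 3 + 2 * S + 8 * S ^ 2) * (1 + t) ^ 12 * Real.exp (1 / 6 + t ^ 3 / 6) := by
    refine (norm_exp_sub_quadratic_le w p s).trans ?_
    have d1 : ‖w‖ ^ 3 * Real.exp ‖w‖ ≤
        (ε * (2 * S) * (1 + t) ^ 4) ^ 3 * Real.exp (1 / 6 + t ^ 3 / 6) := by gcongr
    have d2 : ‖w - (p + s)‖ ≤
        ε ^ 3 * (2 * S) * (1 + t) ^ 12 * Real.exp (1 / 6 + t ^ 3 / 6) :=
      c1.trans (le_mul_of_one_le_right (by positivity) hE)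
    have d3 : ‖w - p‖ * (‖w‖ + ‖p‖) ≤ ε ^ 2 * (2 * S) * (1 + t) ^ 8 *
        (ε * (2 * S) * (1 + t) ^ 4 + ε * (2 * S) * (1 + t) ^ 4) := by gcongr
    have d4 := d3.trans (le_mul_of_one_le_right (by positivity) hE)
    refine (add_le_add (add_le_add d1 d2) d4).trans_eq ?_
    ring
  rw [hfac, norm_mul, norm_mul, norm_pow, hω.norm_airy, hω.norm_ofReal_mul ht]
  have hexp : Real.exp (-(t ^ 3 / 3) - ξ * (t / 2)) * Real.exp (1 / 6 + t ^ 3 / 6) ≤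
      Real.exp (1 / 6) * (Real.exp ((|ξ| + 1) * (6 * (|ξ| + 1) + 1)) * Real.exp (-1 * t)) := by
    calc _ = Real.exp (1 / 6) * Real.exp (-(t ^ 3 / 6) - ξ * (t / 2)) := by
          rw [← Real.exp_add, ← Real.exp_add]; ring_nf
      _ ≤ Real.exp (1 / 6) * Real.exp (-(t ^ 3 / 6) + |ξ| * t) := by
          gcongr
          linarith [neg_mul_half_le ξ ht]
      _ ≤ _ := by
          gcongr
          exact exp_airy_le ξ ht
  calc t ^ k * Real.exp (-(t ^ 3 / 3) - ξ * (t / 2)) *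
        ‖Complex.exp w - (1 + p + (s + p ^ 2 / 2))‖
      ≤ (1 + t) ^ k * Real.exp (-(t ^ 3 / 3) - ξ * (t / 2)) *
        (ε ^ 3 * (8 * S ^ 3 + 2 * S + 8 * S ^ 2) * (1 + t) ^ 12 *
          Real.exp (1 / 6 + t ^ 3 / 6)) := by
        gcongr
        linarith
    _ = ε ^ 3 * (8 * S ^ 3 + 2 * S + 8 * S ^ 2) * (1 + t) ^ (k + 12) *
        (Real.exp (-(t ^ 3 / 3) - ξ * (t / 2)) * Real.exp (1 / 6 + t ^ 3 / 6)) := by ring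
    _ ≤ ε ^ 3 * (8 * S ^ 3 + 2 * S + 8 * S ^ 2) * (1 + t) ^ (k + 12) *
        (Real.exp (1 / 6) *
          (Real.exp ((|ξ| + 1) * (6 * (|ξ| + 1) + 1)) * Real.exp (-1 * t))) := by gcongr
    _ = _ := by ring

/-- Away from the saddle the phase is at most `-(C + |ξ| + 1) t`, which beats the amplitude and the
linear term and still leaves `exp(-t)`. The factor `ε³` is free because `ε t / δ ≥ 1`, at the price
of `t³`. -/
theorem norm_perturbedAiry_le_far (H : AiryPhase h μ a₄ a₅ m₁ m₂ C c κ) (ξ : ℝ) (k : ℕ)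
    {δ ε t : ℝ} (hδ : 0 < δ) (hε : 0 < ε) (hε1 : ε ≤ 1) (ht : 0 ≤ t) (hc : δ ≤ ε * t)
    (hε2 : ε ^ 2 * (C + |ξ| + 1) ≤ κ * (δ ^ 2 / (1 + δ ^ 2))) {ω : ℂ} (hω : AiryDir ω) :
    ‖perturbedAiry h μ ξ ε k (t * ω)‖ ≤ ε ^ 3 * (1 / δ ^ 3) *
      ((1 + t) ^ (k + 3) * Real.exp (-1 * t)) := by
  have hC := H.C_nonneg
  have hκ := H.κ_pos
  have hre1 := H.phase_re ω hω (ε * t) (by positivity)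
  have hre2 := H.amplitude_re ω hω (ε * t) (by positivity)
  rw [perturbedAiry, norm_mul, norm_pow, hω.norm_ofReal_mul ht, Complex.norm_exp]
  have e1 : (ε : ℂ) * (t * ω) = ((ε * t : ℝ) : ℂ) * ω := by push_cast; ring
  have e2 : (h ((ε * t : ℝ) * ω) / ε ^ 3 + μ ((ε * t : ℝ) * ω) - ξ * (t * ω)).re =
      (h ((ε * t : ℝ) * ω)).re / ε ^ 3 + (μ ((ε * t : ℝ) * ω)).re - ξ * (t / 2) := by
    rw [Complex.sub_re, Complex.add_re, Complex.re_ofReal_mul, hω.ofReal_mul_re,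
      ← Complex.ofReal_pow, Complex.div_ofReal_re]
  have e3 : (h ((ε * t : ℝ) * ω)).re / ε ^ 3 ≤ -((C + |ξ| + 1) * t) := by
    rw [div_le_iff₀ (by positivity)]
    refine hre1.trans ?_
    have f1 : δ ^ 2 / (1 + δ ^ 2) ≤ (ε * t) ^ 2 / (1 + (ε * t) ^ 2) := by
      rw [div_le_div_iff₀ (by positivity) (by positivity)]
      have : δ ^ 2 ≤ (ε * t) ^ 2 := by gcongr
      linarith
    have f2 : ε ^ 2 * (C + |ξ| + 1) ≤ κ * ((ε * t) ^ 2 / (1 + (ε * t) ^ 2)) :=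
      hε2.trans (by gcongr)
    have f3 : ε * t * (ε ^ 2 * (C + |ξ| + 1)) ≤
        ε * t * (κ * ((ε * t) ^ 2 / (1 + (ε * t) ^ 2))) := by gcongr
    have f4 : κ * ((ε * t) ^ 3 / (1 + (ε * t) ^ 2)) =
        ε * t * (κ * ((ε * t) ^ 2 / (1 + (ε * t) ^ 2))) := by ring
    rw [f4]
    linarith
  have e4 : (μ ((ε * t : ℝ) * ω)).re ≤ C * t := by
    refine hre2.trans ?_
    have : ε * t ≤ 1 * t := by gcongr
    rw [one_mul] at this
    gcongr
  have e5 := neg_mul_half_le ξ ht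
  have e6 : 1 ≤ (ε * t / δ) ^ 3 := one_le_pow₀ ((one_le_div hδ).mpr hc)
  rw [e1, e2]
  calc t ^ k * Real.exp ((h ((ε * t : ℝ) * ω)).re / ε ^ 3 + (μ ((ε * t : ℝ) * ω)).re -
        ξ * (t / 2))
      ≤ t ^ k * Real.exp (-1 * t) := by
        gcongr
        linarith
    _ ≤ t ^ k * Real.exp (-1 * t) * (ε * t / δ) ^ 3 := le_mul_of_one_le_right (by positivity) e6
    _ = ε ^ 3 * (1 / δ ^ 3) * (t ^ (k + 3) * Real.exp (-1 * t)) := by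
        field_simp
        ring
    _ ≤ _ := by
        gcongr
        linarith

theorem norm_airyExpansion_le_far (H : AiryPhase h μ a₄ a₅ m₁ m₂ C c κ) {S : ℝ}
    (hS : ‖a₄‖ + ‖a₅‖ + ‖m₁‖ + ‖m₂‖ + C = S) (ξ : ℝ) (k : ℕ)
    {δ ε t : ℝ} (hδ : 0 < δ) (hε : 0 < ε) (hε1 : ε ≤ 1) (ht : 0 ≤ t) (hc : δ ≤ ε * t)
    {ω : ℂ} (hω : AiryDir ω) :
    ‖airyExpansion a₄ a₅ m₁ m₂ ξ ε k (t * ω)‖ ≤ ε ^ 3 * ((1 + 4 * S + 4 * S ^ 2) / δ ^ 3 *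
      Real.exp ((|ξ| + 1) * (6 * (|ξ| + 1) + 1))) *
      ((1 + t) ^ (k + 11) * Real.exp (-1 * t)) := by
  have hC := H.C_nonneg
  have n4 := norm_nonneg a₄
  have n5 := norm_nonneg a₅
  have k1 := norm_nonneg m₁
  have k2 := norm_nonneg m₂
  have hS0 : 0 ≤ S := by rw [← hS]; positivity
  have hu := hω.norm_ofReal_mul ht
  have hT : 1 ≤ 1 + t := by linarith
  have hq (i : ℕ) (hij : i ≤ 8) : t ^ i ≤ (1 + t) ^ 8 :=
    (pow_le_pow_left₀ ht (by linarith) i).trans (pow_le_pow_right₀ (by linarith) hij)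
  have b1 : ‖a₄ * ((t : ℂ) * ω) ^ 4 + m₁ * (t * ω)‖ ≤ 2 * S * (1 + t) ^ 4 := by
    refine (norm_add_le _ _).trans ?_
    rw [norm_mul, norm_mul, norm_pow, hu]
    have f1 : ‖a₄‖ * t ^ 4 ≤ S * (1 + t) ^ 4 := by gcongr <;> linarith
    have f2 : ‖m₁‖ * t ≤ S * (1 + t) ^ 4 := by
      gcongr
      · linarith
      · calc t ≤ 1 + t := by linarith
          _ ≤ (1 + t) ^ 4 := le_self_pow₀ hT (by norm_num)
    linarith
  have b2 : ‖a₅ * ((t : ℂ) * ω) ^ 5 + m₂ * (t * ω) ^ 2‖ ≤ 2 * S * (1 + t) ^ 8 := by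
    refine (norm_add_le _ _).trans ?_
    rw [norm_mul, norm_mul, norm_pow, norm_pow, hu]
    have f1 : ‖a₅‖ * t ^ 5 ≤ S * (1 + t) ^ 8 := by
      gcongr
      · linarith
      · exact hq 5 (by norm_num)
    have f2 : ‖m₂‖ * t ^ 2 ≤ S * (1 + t) ^ 8 := by
      gcongr
      · linarith
      · exact hq 2 (by norm_num)
    linarith
  have b3 : ‖1 + (ε : ℂ) * (a₄ * (t * ω) ^ 4 + m₁ * (t * ω)) +
      (ε ^ 2 * (a₅ * (t * ω) ^ 5 + m₂ * (t * ω) ^ 2) +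
        (ε * (a₄ * (t * ω) ^ 4 + m₁ * (t * ω))) ^ 2 / 2)‖ ≤
      (1 + 4 * S + 4 * S ^ 2) * (1 + t) ^ 8 := by
    refine (norm_add_le _ _).trans ((add_le_add (norm_add_le _ _) (norm_add_le _ _)).trans ?_)
    rw [norm_one, norm_div, norm_pow, norm_mul, norm_mul, norm_pow, Complex.norm_real,
      Real.norm_of_nonneg hε.le, Complex.norm_ofNat]
    have f1 : ε * ‖a₄ * ((t : ℂ) * ω) ^ 4 + m₁ * (t * ω)‖ ≤ 1 * (2 * S * (1 + t) ^ 4) := by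
      gcongr
    have f2 : ε ^ 2 * ‖a₅ * ((t : ℂ) * ω) ^ 5 + m₂ * (t * ω) ^ 2‖ ≤
        1 * (2 * S * (1 + t) ^ 8) := by
      gcongr
      exact pow_le_one₀ hε.le hε1
    have f3 : (ε * ‖a₄ * ((t : ℂ) * ω) ^ 4 + m₁ * (t * ω)‖) ^ 2 ≤
        (1 * (2 * S * (1 + t) ^ 4)) ^ 2 := by gcongr
    have f4 : 2 * S * (1 + t) ^ 4 ≤ 2 * S * (1 + t) ^ 8 := by
      gcongr
      norm_num
    have f5 : 1 ≤ (1 + t) ^ 8 := one_le_pow₀ hT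
    have f6 : (1 * (2 * S * (1 + t) ^ 4)) ^ 2 = 4 * S ^ 2 * (1 + t) ^ 8 := by ring
    have f7 : 0 ≤ S ^ 2 * (1 + t) ^ 8 := by positivity
    linarith
  have e6 : 1 ≤ (ε * t / δ) ^ 3 := one_le_pow₀ ((one_le_div hδ).mpr hc)
  rw [airyExpansion, norm_mul, norm_mul, norm_pow, hu]
  calc t ^ k * ‖Complex.exp (((t : ℂ) * ω) ^ 3 / 3 - ξ * (t * ω))‖ * _
      ≤ t ^ k * (Real.exp ((|ξ| + 1) * (6 * (|ξ| + 1) + 1)) * Real.exp (-1 * t)) *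
        ((1 + 4 * S + 4 * S ^ 2) * (1 + t) ^ 8) := by
        gcongr
        exact hω.norm_airy_le ξ ht
    _ ≤ t ^ k * (Real.exp ((|ξ| + 1) * (6 * (|ξ| + 1) + 1)) * Real.exp (-1 * t)) *
        ((1 + 4 * S + 4 * S ^ 2) * (1 + t) ^ 8) * (ε * t / δ) ^ 3 :=
        le_mul_of_one_le_right (by positivity) e6
    _ = ε ^ 3 * ((1 + 4 * S + 4 * S ^ 2) / δ ^ 3 *
        Real.exp ((|ξ| + 1) * (6 * (|ξ| + 1) + 1))) *
        ((t ^ (k + 3) * (1 + t) ^ 8) * Real.exp (-1 * t)) := by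
        field_simp
        ring
    _ ≤ ε ^ 3 * ((1 + 4 * S + 4 * S ^ 2) / δ ^ 3 *
        Real.exp ((|ξ| + 1) * (6 * (|ξ| + 1) + 1))) *
        (((1 + t) ^ (k + 3) * (1 + t) ^ 8) * Real.exp (-1 * t)) := by
        gcongr
        linarith
    _ = _ := by ring

end AiryPhase

theorem wedgeInt_airyExpansion (a₄ a₅ m₁ m₂ : ℂ) (ξ ε : ℝ) (k : ℕ) :
    WedgeIntegrable (airyExpansion a₄ a₅ m₁ m₂ ξ ε k) ∧
    wedgeInt (airyExpansion a₄ a₅ m₁ m₂ ξ ε k) = airyMoment ξ k +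
      ε * (a₄ * airyMoment ξ (k + 4) + m₁ * airyMoment ξ (k + 1)) +
      ε ^ 2 * (a₅ * airyMoment ξ (k + 5) + m₂ * airyMoment ξ (k + 2) +
        (a₄ ^ 2 * airyMoment ξ (k + 8) + 2 * a₄ * m₁ * airyMoment ξ (k + 5) +
          m₁ ^ 2 * airyMoment ξ (k + 2)) / 2) := by
  set f : ℕ → ℂ → ℂ := fun j v => v ^ j * Complex.exp (v ^ 3 / 3 - ξ * v) with hf
  have hI (j : ℕ) : WedgeIntegrable (f j) := wedgeIntegrable_airy ξ j
  have hM (j : ℕ) : wedgeInt (f j) = airyMoment ξ j := rfl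
  have h1 : airyExpansion a₄ a₅ m₁ m₂ ξ ε k = fun v => f k v +
      ((ε * a₄ : ℂ) * f (k + 4) v + ((ε * m₁ : ℂ) * f (k + 1) v +
      ((ε ^ 2 * (a₅ + a₄ * m₁) : ℂ) * f (k + 5) v +
      ((ε ^ 2 * (m₂ + m₁ ^ 2 / 2) : ℂ) * f (k + 2) v +
      (ε ^ 2 * (a₄ ^ 2 / 2) : ℂ) * f (k + 8) v)))) := by
    ext v
    simp only [airyExpansion, hf]
    ring
  have i5 := (hI (k + 8)).const_mul (ε ^ 2 * (a₄ ^ 2 / 2) : ℂ)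
  have j4 := (hI (k + 2)).const_mul (ε ^ 2 * (m₂ + m₁ ^ 2 / 2) : ℂ)
  have i4 := j4.add i5
  have j3 := (hI (k + 5)).const_mul (ε ^ 2 * (a₅ + a₄ * m₁) : ℂ)
  have i3 := j3.add i4
  have j2 := (hI (k + 1)).const_mul (ε * m₁ : ℂ)
  have i2 := j2.add i3
  have j1 := (hI (k + 4)).const_mul (ε * a₄ : ℂ)
  have i1 := j1.add i2
  rw [h1]
  refine ⟨(hI k).add i1, ?_⟩
  rw [wedgeInt_add (hI k) i1, wedgeInt_add j1 i2, wedgeInt_add j2 i3, wedgeInt_add j3 i4,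
    wedgeInt_add j4 i5, wedgeInt_const_mul, wedgeInt_const_mul, wedgeInt_const_mul,
    wedgeInt_const_mul, wedgeInt_const_mul]
  simp only [hM]
  ring

theorem norm_wedgeInt_le {g : ℂ → ℂ} {K : ℝ} (n : ℕ)
    (hb : ∀ ω, AiryDir ω → ∀ t : ℝ, 0 < t →
      ‖g (t * ω)‖ ≤ K * ((1 + t) ^ n * Real.exp (-1 * t))) :
    ‖wedgeInt g‖ ≤ K * (2 * ∫ t in Set.Ioi (0 : ℝ), (1 + t) ^ n * Real.exp (-1 * t)) := by
  have hray (ω : ℂ) (hω : AiryDir ω) : ‖rayIntegral ω g‖ ≤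
      K * ∫ t in Set.Ioi (0 : ℝ), (1 + t) ^ n * Real.exp (-1 * t) := by
    rw [← integral_const_mul]
    refine norm_integral_le_of_norm_le
      ((integrableOn_one_add_pow_mul_exp_neg n one_pos).const_mul K) ?_
    refine (ae_restrict_mem measurableSet_Ioi).mono fun t ht => ?_
    rw [norm_mul, hω.norm, one_mul]
    exact hb ω hω t ht
  refine (norm_sub_le _ _).trans ((add_le_add (hray _ airyDir_up) (hray _ airyDir_down)).trans ?_)
  linarith

/-- Integrals of perturbed Airy integrands, to second order. -/
theorem AiryPhase.wedgeInt_perturbedAiry_isBigO {h μ : ℂ → ℂ} {a₄ a₅ m₁ m₂ : ℂ} {C c κ : ℝ}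
    (H : AiryPhase h μ a₄ a₅ m₁ m₂ C c κ) (ξ : ℝ) (k : ℕ) :
    (fun ε : ℝ => wedgeInt (perturbedAiry h μ ξ ε k) - (airyMoment ξ k +
      ε * (a₄ * airyMoment ξ (k + 4) + m₁ * airyMoment ξ (k + 1)) +
      ε ^ 2 * (a₅ * airyMoment ξ (k + 5) + m₂ * airyMoment ξ (k + 2) +
        (a₄ ^ 2 * airyMoment ξ (k + 8) + 2 * a₄ * m₁ * airyMoment ξ (k + 5) +
          m₁ ^ 2 * airyMoment ξ (k + 2)) / 2))) =O[nhdsWithin 0 (Set.Ioi 0)] fun ε => ε ^ 3 := by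
  have hC := H.C_nonneg
  have hc0 := H.c_pos
  have hκ := H.κ_pos
  obtain ⟨S, hS⟩ : ∃ S, ‖a₄‖ + ‖a₅‖ + ‖m₁‖ + ‖m₂‖ + C = S := ⟨_, rfl⟩
  have hS0 : 0 ≤ S := by rw [← hS]; positivity
  -- The splitting radius ensures both `ε t ≤ 1` and `ε t S ≤ 1/6` in the near region.
  set δ := min c (1 / (6 * (S + 1))) with hδ
  have hδ0 : 0 < δ := lt_min hc0 (by positivity)
  have hδ1 : δ * (6 * (S + 1)) ≤ 1 := by
    rw [← le_div_iff₀ (by positivity)]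
    exact min_le_right _ _
  set K₀ := Real.exp ((|ξ| + 1) * (6 * (|ξ| + 1) + 1)) with hK₀
  set K := (8 * S ^ 3 + 2 * S + 8 * S ^ 2) * Real.exp (1 / 6) * K₀ +
    (1 / δ ^ 3 + (1 + 4 * S + 4 * S ^ 2) / δ ^ 3 * K₀) with hK
  have hsmall : ∀ᶠ ε : ℝ in nhdsWithin 0 (Set.Ioi 0),
      0 < ε ∧ ε ≤ 1 ∧ ε ^ 2 * (C + |ξ| + 1) ≤ κ * (δ ^ 2 / (1 + δ ^ 2)) := by
    have h1 : ∀ᶠ ε : ℝ in nhds 0, ε < 1 := eventually_lt_nhds one_pos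
    have h2 : ∀ᶠ ε : ℝ in nhds 0, ε ^ 2 * (C + |ξ| + 1) < κ * (δ ^ 2 / (1 + δ ^ 2)) := by
      refine (Continuous.tendsto (by fun_prop : Continuous fun ε : ℝ => ε ^ 2 * (C + |ξ| + 1))
        0).eventually_lt_const ?_
      simp only [ne_eq, OfNat.ofNat_ne_zero, not_false_eq_true, zero_pow, zero_mul]
      positivity
    filter_upwards [self_mem_nhdsWithin, nhdsWithin_le_nhds h1, nhdsWithin_le_nhds h2]
      with ε h3 h4 h5 using ⟨h3, h4.le, h5.le⟩
  refine IsBigO.of_bound (K * (2 * ∫ t in Set.Ioi (0 : ℝ), (1 + t) ^ (k + 12) *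
    Real.exp (-1 * t))) (hsmall.mono fun ε ⟨hε, hε1, hε2⟩ => ?_)
  obtain ⟨hEi, hE⟩ := wedgeInt_airyExpansion a₄ a₅ m₁ m₂ ξ ε k
  have hb (ω : ℂ) (hω : AiryDir ω) (t : ℝ) (ht : 0 < t) :
      ‖perturbedAiry h μ ξ ε k (t * ω) - airyExpansion a₄ a₅ m₁ m₂ ξ ε k (t * ω)‖ ≤
        ε ^ 3 * K * ((1 + t) ^ (k + 12) * Real.exp (-1 * t)) := by
    rcases le_total (ε * t) δ with hd | hd
    · have hd1 : ε * t ≤ 1 := hd.trans (by nlinarith)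
      refine (H.norm_sub_le_near hS ξ k hε ht.le (hd.trans (min_le_left _ _)) hd1 ?_ hω).trans ?_
      · have : ε * t * S ≤ δ * S := by gcongr
        nlinarith
      · gcongr
        rw [hK]
        exact le_add_of_nonneg_right (by positivity)
    · have h1 := H.norm_perturbedAiry_le_far ξ k hδ0 hε hε1 ht.le hd hε2 hω
      have h2 := H.norm_airyExpansion_le_far hS ξ k hδ0 hε hε1 ht.le hd hω
      have hT : 1 ≤ 1 + t := by linarith
      have h3 : (1 + t) ^ (k + 3) ≤ (1 + t) ^ (k + 12) := pow_le_pow_right₀ hT (by omega)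
      have h4 : (1 + t) ^ (k + 11) ≤ (1 + t) ^ (k + 12) := pow_le_pow_right₀ hT (by omega)
      refine (norm_sub_le _ _).trans ((add_le_add h1 h2).trans ?_)
      calc _ ≤ ε ^ 3 * (1 / δ ^ 3) * ((1 + t) ^ (k + 12) * Real.exp (-1 * t)) +
            ε ^ 3 * ((1 + 4 * S + 4 * S ^ 2) / δ ^ 3 * K₀) *
              ((1 + t) ^ (k + 12) * Real.exp (-1 * t)) := by gcongr
        _ = ε ^ 3 * (1 / δ ^ 3 + (1 + 4 * S + 4 * S ^ 2) / δ ^ 3 * K₀) *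
              ((1 + t) ^ (k + 12) * Real.exp (-1 * t)) := by ring
        _ ≤ _ := by
          gcongr
          rw [hK]
          exact le_add_of_nonneg_left (by positivity)
  have hcont (ω : ℂ) (hω : AiryDir ω) (t : ℝ) (ht : 0 ≤ t) : ContinuousAt
      (fun v => perturbedAiry h μ ξ ε k v - airyExpansion a₄ a₅ m₁ m₂ ξ ε k v) (t * ω) := by
    have e1 : (ε : ℂ) * (t * ω) = ((ε * t : ℝ) : ℂ) * ω := by push_cast; ring
    have c1 : ContinuousAt (fun v => h (ε * v)) ((t : ℂ) * ω) :=
      ContinuousAt.comp (f := fun v : ℂ => (ε : ℂ) * v)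
        (by rw [e1]; exact H.phase_continuousAt ω hω _ (by positivity)) (by fun_prop)
    have c2 : ContinuousAt (fun v => μ (ε * v)) ((t : ℂ) * ω) :=
      ContinuousAt.comp (f := fun v : ℂ => (ε : ℂ) * v)
        (by rw [e1]; exact H.amplitude_continuousAt ω hω _ (by positivity)) (by fun_prop)
    refine ContinuousAt.sub (ContinuousAt.mul (by fun_prop) ?_) ?_
    · exact (((c1.div_const _).add c2).sub (by fun_prop)).cexp
    · unfold airyExpansion
      fun_prop
  -- The pointwise estimate also makes the difference integrable, which justifies splitting the
  -- integral of `perturbedAiry`.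
  have hDi := wedgeIntegrable_of_bound (k + 12) one_pos hcont hb
  have hsum : wedgeInt (perturbedAiry h μ ξ ε k) =
      wedgeInt (fun v => perturbedAiry h μ ξ ε k v - airyExpansion a₄ a₅ m₁ m₂ ξ ε k v) +
        wedgeInt (airyExpansion a₄ a₅ m₁ m₂ ξ ε k) := by
    rw [← wedgeInt_add hDi hEi]
    simp
  rw [hsum, hE, add_sub_cancel_right, norm_pow, Real.norm_of_nonneg hε.le]
  refine (norm_wedgeInt_le (k + 12) hb).trans_eq ?_
  ring

/-! ### Decay of the Hermite and Laguerre phases along the rays. -/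

theorem nonpos_of_hasDerivAt_nonpos {f f' : ℝ → ℝ} (h0 : f 0 = 0)
    (hd : ∀ t, 0 ≤ t → HasDerivAt f (f' t) t) (hf : ∀ t, 0 ≤ t → f' t ≤ 0) {t : ℝ} (ht : 0 ≤ t) :
    f t ≤ 0 := by
  rw [← h0]
  refine antitoneOn_of_deriv_nonpos (convex_Ici (0 : ℝ))
    (fun s hs => (hd s hs).continuousAt.continuousWithinAt)
    (fun s hs => ?_) (fun s hs => ?_) Set.self_mem_Ici ht ht
  · exact (hd s (interior_subset hs)).differentiableAt.differentiableWithinAt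
  · rw [(hd s (interior_subset hs)).deriv]
    exact hf s (interior_subset hs)

theorem hasDerivAt_cube_div (t : ℝ) :
    HasDerivAt (fun t : ℝ => 1 / 6 * (t ^ 3 / (1 + t ^ 2)))
      (1 / 6 * ((3 * t ^ 2 + t ^ 4) / (1 + t ^ 2) ^ 2)) t := by
  have h1 := ((hasDerivAt_pow 3 t).div ((hasDerivAt_pow 2 t).const_add 1)
    (by positivity)).const_mul (1 / 6 : ℝ)
  refine h1.congr_deriv ?_
  push_cast
  ring

/-- A simpler majorant for the derivative of the comparison function, easily compared with the
derivatives of both phases. -/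
theorem cube_div_deriv_le (t : ℝ) :
    1 / 6 * ((3 * t ^ 2 + t ^ 4) / (1 + t ^ 2) ^ 2) ≤ t ^ 2 / (2 * (1 + t ^ 2)) := by
  rw [← mul_div_assoc, div_le_div_iff₀ (by positivity) (by positivity)]
  have : 0 ≤ t ^ 4 * (1 + t ^ 2) := by positivity
  nlinarith

namespace AiryDir

variable {ω : ℂ}

theorem log_norm_one_add (h : AiryDir ω) (t : ℝ) :
    Real.log ‖1 + (t : ℂ) * ω‖ = Real.log (1 + t + t ^ 2) / 2 := by
  rw [← h.normSq_one_add, Real.log_pow]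
  push_cast
  ring

theorem log_norm_one_sub (h : AiryDir ω) (t : ℝ) :
    Real.log ‖1 - (t : ℂ) * ω‖ = Real.log (1 - t + t ^ 2) / 2 := by
  rw [← h.normSq_one_sub, Real.log_pow]
  push_cast
  ring

theorem one_sub_mem_slitPlane (h : AiryDir ω) (t : ℝ) : 1 - (t : ℂ) * ω ∈ Complex.slitPlane := by
  rcases eq_or_ne t 0 with rfl | ht
  · simp
  · right
    intro h0
    rw [Complex.sub_im, Complex.one_im, zero_sub, neg_eq_zero] at h0
    have := h.ofReal_mul_im_sq t
    rw [h0] at this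
    have : 0 < t ^ 2 := by positivity
    linarith

end AiryDir

theorem hasDerivAt_log_one_add_add_sq {t : ℝ} (ht : 0 < 1 + t + t ^ 2) :
    HasDerivAt (fun t : ℝ => Real.log (1 + t + t ^ 2)) ((1 + 2 * t) / (1 + t + t ^ 2)) t := by
  have := ((((hasDerivAt_id t).const_add 1).add (hasDerivAt_pow 2 t))).log ht.ne'
  refine this.congr_deriv ?_
  simp

theorem hasDerivAt_log_one_sub_add_sq {t : ℝ} (ht : 0 < 1 - t + t ^ 2) :
    HasDerivAt (fun t : ℝ => Real.log (1 - t + t ^ 2)) ((2 * t - 1) / (1 - t + t ^ 2)) t := by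
  have := ((((hasDerivAt_id t).const_sub 1).add (hasDerivAt_pow 2 t))).log ht.ne'
  refine this.congr_deriv ?_
  simp
  ring

/-- On a ray `|1+tω|² = 1+t+t²`. Both sides vanish at `0`, and the phase has derivative
`-t²(2+t)/(2(1+t+t²))`, so comparing derivatives suffices. -/
theorem hermite_phase_re_le {t : ℝ} (ht : 0 ≤ t) :
    Real.log (1 + t + t ^ 2) / 2 - t / 2 - t ^ 2 / 4 ≤ -(1 / 6 * (t ^ 3 / (1 + t ^ 2))) := by
  have key := nonpos_of_hasDerivAt_nonpos (t := t)
    (f := fun t => Real.log (1 + t + t ^ 2) / 2 - t / 2 - t ^ 2 / 4 +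
      1 / 6 * (t ^ 3 / (1 + t ^ 2)))
    (f' := fun t => (1 + 2 * t) / (1 + t + t ^ 2) / 2 - 1 / 2 - (2 * t) / 4 +
      1 / 6 * ((3 * t ^ 2 + t ^ 4) / (1 + t ^ 2) ^ 2)) (by simp) (fun t ht => ?_)
    (fun t ht => ?_) ht
  · linarith
  · refine (((((hasDerivAt_log_one_add_add_sq (by positivity)).div_const 2).sub
      ((hasDerivAt_id t).div_const 2)).sub ((hasDerivAt_pow 2 t).div_const 4)).add
      (hasDerivAt_cube_div t)).congr_deriv ?_
    simp
  · have h1 := cube_div_deriv_le t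
    have h2 : (1 + 2 * t) / (1 + t + t ^ 2) / 2 - 1 / 2 - (2 * t) / 4 =
        -((t ^ 2 * (2 + t)) / (2 * (1 + t + t ^ 2))) := by
      field_simp
      ring
    have h3 : t ^ 2 / (2 * (1 + t ^ 2)) ≤ (t ^ 2 * (2 + t)) / (2 * (1 + t + t ^ 2)) := by
      rw [div_le_div_iff₀ (by positivity) (by positivity)]
      have : 0 ≤ t ^ 2 * (1 + t ^ 2 + t ^ 3) := by positivity
      nlinarith
    linarith

/-- The same comparison; here `(1+t+t²)(1-t+t²) = 1+t²+t⁴` and the derivative is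
`-t²(2+t²)/(2(1+t²+t⁴))`. -/
theorem laguerre_phase_re_le {t : ℝ} (ht : 0 ≤ t) :
    (Real.log (1 + t + t ^ 2) / 2 - Real.log (1 - t + t ^ 2) / 2) / 2 - t / 2 ≤
      -(1 / 6 * (t ^ 3 / (1 + t ^ 2))) := by
  have hpos (t : ℝ) : 0 < 1 - t + t ^ 2 := by nlinarith [sq_nonneg (t - 1 / 2)]
  have key := nonpos_of_hasDerivAt_nonpos (t := t)
    (f := fun t => (Real.log (1 + t + t ^ 2) / 2 - Real.log (1 - t + t ^ 2) / 2) / 2 - t / 2 +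
      1 / 6 * (t ^ 3 / (1 + t ^ 2)))
    (f' := fun t => ((1 + 2 * t) / (1 + t + t ^ 2) / 2 - (2 * t - 1) / (1 - t + t ^ 2) / 2) / 2 -
      1 / 2 + 1 / 6 * ((3 * t ^ 2 + t ^ 4) / (1 + t ^ 2) ^ 2)) (by simp) (fun t ht => ?_)
    (fun t ht => ?_) ht
  · linarith
  · exact (((((hasDerivAt_log_one_add_add_sq (by positivity)).div_const 2).sub
      ((hasDerivAt_log_one_sub_add_sq (hpos t)).div_const 2)).div_const 2).sub
      ((hasDerivAt_id t).div_const 2)).add (hasDerivAt_cube_div t)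
  · have h1 := cube_div_deriv_le t
    have h0 := hpos t
    have h2 : ((1 + 2 * t) / (1 + t + t ^ 2) / 2 - (2 * t - 1) / (1 - t + t ^ 2) / 2) / 2 -
        1 / 2 = -((t ^ 2 * (2 + t ^ 2)) / (2 * (1 + t ^ 2 + t ^ 4))) := by
      have e : 1 + t ^ 2 + t ^ 4 = (1 + t + t ^ 2) * (1 - t + t ^ 2) := by ring
      rw [e]
      field_simp
      ring
    have h3 : t ^ 2 / (2 * (1 + t ^ 2)) ≤ (t ^ 2 * (2 + t ^ 2)) / (2 * (1 + t ^ 2 + t ^ 4)) := by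
      rw [div_le_div_iff₀ (by positivity) (by positivity)]
      have : 0 ≤ t ^ 2 * (1 + t ^ 2) := by positivity
      nlinarith
    linarith

theorem norm_log_sub_taylor_five_le {z : ℂ} (hz : ‖z‖ ≤ 1 / 2) :
    ‖Complex.log (1 + z) - (z - z ^ 2 / 2 + z ^ 3 / 3 - z ^ 4 / 4 + z ^ 5 / 5)‖ ≤
      ‖z‖ ^ 6 := by
  have h := Complex.norm_log_sub_logTaylor_le 5 (lt_of_le_of_lt hz (by norm_num))
  have h1 : Complex.logTaylor (5 + 1) z = z - z ^ 2 / 2 + z ^ 3 / 3 - z ^ 4 / 4 + z ^ 5 / 5 := by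
    simp [Complex.logTaylor, Finset.sum_range_succ]
    ring
  rw [h1] at h
  refine h.trans ?_
  have h2 : (1 - ‖z‖)⁻¹ ≤ 2 := by
    rw [inv_le_comm₀ (by linarith) (by norm_num)]
    linarith
  have h3 : ‖z‖ ^ 6 * (1 - ‖z‖)⁻¹ ≤ ‖z‖ ^ 6 * 2 := by gcongr
  have h4 : 0 ≤ ‖z‖ ^ 6 := by positivity
  norm_num
  linarith

theorem norm_log_sub_taylor_two_le {z : ℂ} (hz : ‖z‖ ≤ 1 / 2) :
    ‖Complex.log (1 + z) - (z - z ^ 2 / 2)‖ ≤ ‖z‖ ^ 3 := by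
  have h := Complex.norm_log_sub_logTaylor_le 2 (lt_of_le_of_lt hz (by norm_num))
  have h1 : Complex.logTaylor (2 + 1) z = z - z ^ 2 / 2 := by
    simp [Complex.logTaylor, Finset.sum_range_succ]
    ring
  rw [h1] at h
  refine h.trans ?_
  have h2 : (1 - ‖z‖)⁻¹ ≤ 2 := by
    rw [inv_le_comm₀ (by linarith) (by norm_num)]
    linarith
  have h3 : ‖z‖ ^ 3 * (1 - ‖z‖)⁻¹ ≤ ‖z‖ ^ 3 * 2 := by gcongr
  have h4 : 0 ≤ ‖z‖ ^ 3 := by positivity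
  norm_num
  linarith

/-- The phase of the Hermite polynomials at the edge. -/
theorem airyPhase_hermite : AiryPhase (fun v => Complex.log (1 + v) - v + v ^ 2 / 2)
    (fun _ => 0) (-(1 / 4)) (1 / 5) 0 0 1 (1 / 2) (1 / 6) where
  C_nonneg := by norm_num
  c_pos := by norm_num
  κ_pos := by norm_num
  phase v hv := by
    rw [one_mul]
    refine le_trans (le_of_eq ?_) (norm_log_sub_taylor_five_le hv)
    congr 1
    ring
  amplitude v hv := by simp
  phase_re ω hω t ht := by
    refine le_trans (le_of_eq ?_) (hermite_phase_re_le ht)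
    have h1 : (((t : ℂ) * ω) ^ 2 / 2).re = -(t ^ 2 / 4) := by
      have := hω.re_sq_add 0 t
      rw [Complex.ofReal_zero, add_zero] at this
      have e : ((t : ℂ) * ω) ^ 2 / 2 = ((t : ℂ) * ω) ^ 2 / ((2 : ℝ) : ℂ) := by norm_num
      rw [e, Complex.div_ofReal_re, this]
      ring
    rw [Complex.add_re, Complex.sub_re, h1, Complex.log_re, hω.log_norm_one_add,
      hω.ofReal_mul_re]
    ring
  amplitude_re ω hω t ht := by simpa using ht
  phase_continuousAt ω hω t ht := by
    have h1 := hω.one_add_mem_slitPlane ht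
    have : ContinuousAt (fun v : ℂ => Complex.log (1 + v)) (t * ω) :=
      ContinuousAt.clog (by fun_prop) h1
    fun_prop
  amplitude_continuousAt ω hω t ht := continuousAt_const

/-- The phase and amplitude of the Laguerre polynomials at the soft edge. -/
theorem airyPhase_laguerre (α : ℝ) :
    AiryPhase (fun v => (Complex.log (1 + v) - Complex.log (1 - v)) / 2 - v)
      (fun v => α * Complex.log (1 + v) - Complex.log (1 - v)) 0 (1 / 5) (α + 1) ((1 - α) / 2)
      (|α| + 1) (1 / 2) (1 / 6) where
  C_nonneg := by positivity
  c_pos := by norm_num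
  κ_pos := by norm_num
  phase v hv := by
    have h1 := norm_log_sub_taylor_five_le hv
    have h2 := norm_log_sub_taylor_five_le (z := -v) (by rwa [norm_neg])
    rw [norm_neg, ← sub_eq_add_neg] at h2
    have h3 : (Complex.log (1 + v) - Complex.log (1 - v)) / 2 - v -
        (v ^ 3 / 3 + 0 * v ^ 4 + 1 / 5 * v ^ 5) =
        ((Complex.log (1 + v) - (v - v ^ 2 / 2 + v ^ 3 / 3 - v ^ 4 / 4 + v ^ 5 / 5)) -
        (Complex.log (1 - v) - (-v - (-v) ^ 2 / 2 + (-v) ^ 3 / 3 - (-v) ^ 4 / 4 +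
          (-v) ^ 5 / 5))) / 2 := by ring
    rw [h3, norm_div, Complex.norm_ofNat]
    have h4 := (norm_sub_le _ _).trans (add_le_add h1 h2)
    have h5 : 0 ≤ |α| * ‖v‖ ^ 6 := by positivity
    linarith
  amplitude v hv := by
    have h1 := norm_log_sub_taylor_two_le hv
    have h2 := norm_log_sub_taylor_two_le (z := -v) (by rwa [norm_neg])
    rw [norm_neg, ← sub_eq_add_neg] at h2
    have h3 : α * Complex.log (1 + v) - Complex.log (1 - v) -
        ((α + 1) * v + (1 - α) / 2 * v ^ 2) =
        α * (Complex.log (1 + v) - (v - v ^ 2 / 2)) -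
        (Complex.log (1 - v) - (-v - (-v) ^ 2 / 2)) := by ring
    rw [h3]
    refine (norm_sub_le _ _).trans ?_
    rw [norm_mul, Complex.norm_real, Real.norm_eq_abs]
    have h4 : |α| * ‖Complex.log (1 + v) - (v - v ^ 2 / 2)‖ ≤ |α| * ‖v‖ ^ 3 := by gcongr
    linarith
  phase_re ω hω t ht := by
    refine le_trans (le_of_eq ?_) (laguerre_phase_re_le ht)
    have e : (Complex.log (1 + t * ω) - Complex.log (1 - t * ω)) / 2 =
        (Complex.log (1 + t * ω) - Complex.log (1 - t * ω)) / ((2 : ℝ) : ℂ) := by norm_num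
    rw [Complex.sub_re, e, Complex.div_ofReal_re, Complex.sub_re, Complex.log_re, Complex.log_re,
      hω.log_norm_one_add, hω.log_norm_one_sub, hω.ofReal_mul_re]
  amplitude_re ω hω t ht := by
    rw [Complex.sub_re, Complex.re_ofReal_mul, Complex.log_re, Complex.log_re,
      hω.log_norm_one_sub]
    have hpos : 3 / 4 ≤ 1 - t + t ^ 2 := by nlinarith [sq_nonneg (t - 1 / 2)]
    have h1 : α * Real.log ‖1 + (t : ℂ) * ω‖ ≤ |α| * t := by
      have h2 := Real.log_nonneg (hω.one_le_norm_one_add ht)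
      have h3 : Real.log ‖1 + (t : ℂ) * ω‖ ≤ t := by
        have := Real.log_le_sub_one_of_pos
          (lt_of_lt_of_le one_pos (hω.one_le_norm_one_add ht))
        linarith [hω.norm_one_add_le ht]
      calc _ ≤ |α| * Real.log ‖1 + (t : ℂ) * ω‖ := by gcongr; exact le_abs_self α
        _ ≤ _ := by gcongr
    have h4 : -Real.log (1 - t + t ^ 2) ≤ 2 * t := by
      rw [← Real.log_inv]
      refine (Real.log_le_sub_one_of_pos (by positivity)).trans ?_
      rw [sub_le_iff_le_add, inv_le_iff_one_le_mul₀ (by linarith)]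
      nlinarith [mul_nonneg ht (sub_nonneg.mpr hpos)]
    linarith
  phase_continuousAt ω hω t ht := by
    have h1 := hω.one_add_mem_slitPlane ht
    have h2 := hω.one_sub_mem_slitPlane t
    have c1 : ContinuousAt (fun v : ℂ => Complex.log (1 + v)) (t * ω) :=
      ContinuousAt.clog (by fun_prop) h1
    have c2 : ContinuousAt (fun v : ℂ => Complex.log (1 - v)) (t * ω) :=
      ContinuousAt.clog (by fun_prop) h2
    fun_prop
  amplitude_continuousAt ω hω t ht := by
    have h1 := hω.one_add_mem_slitPlane ht
    have h2 := hω.one_sub_mem_slitPlane t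
    have c1 : ContinuousAt (fun v : ℂ => Complex.log (1 + v)) (t * ω) :=
      ContinuousAt.clog (by fun_prop) h1
    have c2 : ContinuousAt (fun v : ℂ => Complex.log (1 - v)) (t * ω) :=
      ContinuousAt.clog (by fun_prop) h2
    fun_prop

/-! ### Stirling's formula for `Γ(n+α+1)` with a rate. -/

/-- The logarithm of the quotient of `Γ(n+α+1)` and its Stirling approximation. -/
def stirlingLog (α : ℝ) (n : ℕ) : ℝ :=
  Real.log (Real.Gamma (n + α + 1)) - (n + α + 1 / 2) * Real.log n + n -
    Real.log (2 * Real.pi) / 2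

theorem log_Gamma_add_nat {x : ℝ} (hx : 0 < x) (n : ℕ) :
    Real.log (Real.Gamma (x + n)) =
      Real.log (Real.Gamma x) + ∑ m ∈ Finset.range n, Real.log (x + m) := by
  induction n with
  | zero => simp
  | succ n ih =>
    have hn : 0 < x + n := by positivity
    rw [Nat.cast_succ, ← add_assoc, Real.Gamma_add_one hn.ne',
      Real.log_mul hn.ne' (Real.Gamma_pos_of_pos hn).ne', ih, Finset.sum_range_succ]
    ring

/-- Euler's limit formula compares `Γ(n+α+1)` with `n^α n!`, and Stirling's formula handles `n!`.
This gives the limit but no rate. -/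
theorem tendsto_stirlingLog {α : ℝ} (hα : -1 < α) :
    Tendsto (stirlingLog α) atTop (nhds 0) := by
  have hx : 0 < α + 1 := by linarith
  have h1 : Tendsto (fun n : ℕ => Real.log (Real.Gamma (α + 1)) -
      Real.BohrMollerup.logGammaSeq (α + 1) n) atTop (nhds 0) := by
    have := (Real.BohrMollerup.tendsto_log_gamma hx).const_sub (Real.log (Real.Gamma (α + 1)))
    rwa [sub_self] at this
  have h2 : Tendsto (fun n : ℕ => Real.log (Stirling.stirlingSeq n)) atTop
      (nhds (Real.log √Real.pi)) :=
    (Real.continuousAt_log (by positivity)).tendsto.comp Stirling.tendsto_stirlingSeq_sqrt_pi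
  have h3 : Tendsto (fun n : ℕ => Real.log (1 + (α + 1) / n)) atTop (nhds 0) := by
    have := tendsto_const_div_atTop_nhds_zero_nat (α + 1)
    have h4 := (Real.continuousAt_log (x := 1 + 0) (by norm_num)).tendsto.comp (this.const_add 1)
    simpa [Function.comp_def] using h4
  have h5 := ((h1.add h2).sub h3).sub_const (Real.log Real.pi / 2)
  rw [Real.log_sqrt Real.pi_pos.le, zero_add, sub_zero, sub_self] at h5
  refine h5.congr' ?_
  filter_upwards [eventually_ge_atTop 1] with n hn
  have hn0 : (0 : ℝ) < n := by exact_mod_cast hn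
  have hna : 0 < n + α + 1 := by linarith
  have e1 := log_Gamma_add_nat hx (n + 1)
  have e2 : Real.log (Real.Gamma (α + 1 + (n + 1 : ℕ))) =
      Real.log (n + α + 1) + Real.log (Real.Gamma (n + α + 1)) := by
    rw [← Real.log_mul hna.ne' (Real.Gamma_pos_of_pos hna).ne', ← Real.Gamma_add_one hna.ne']
    push_cast
    ring_nf
  have e3 : Real.log (1 + (α + 1) / n) = Real.log (n + α + 1) - Real.log n := by
    rw [← Real.log_div hna.ne' hn0.ne']
    congr 1
    field_simp
    ring
  have e4 := Stirling.log_stirlingSeq_formula n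
  rw [Real.log_mul two_ne_zero hn0.ne', Real.log_div hn0.ne' (Real.exp_pos 1).ne',
    Real.log_exp] at e4
  rw [e2] at e1
  rw [e3, e4, stirlingLog, Real.BohrMollerup.logGammaSeq,
    Real.log_mul two_ne_zero Real.pi_pos.ne']
  linarith

theorem abs_stirlingLog_succ_sub_le {α : ℝ} (hα : -1 < α) {n : ℕ} (hn : 2 * |α| + 2 ≤ n) :
    |stirlingLog α (n + 1) - stirlingLog α n| ≤ (2 * α ^ 2 + |α| + 5) / n ^ 2 := by
  have ha := abs_nonneg α
  have hn0 : (0 : ℝ) < n := by linarith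
  have hna : 0 < n + α + 1 := by linarith
  set m : ℝ := n + 1 with hm
  have hm0 : 0 < m := by linarith
  have hm1 : m ≠ 0 := hm0.ne'
  have b1 : |Real.log (1 + α / m) - α / m| ≤ 2 * α ^ 2 / m ^ 2 := by
    have hx : |-(α / m)| ≤ 1 / 2 := by
      rw [abs_neg, abs_div, abs_of_pos hm0, div_le_iff₀ hm0]
      linarith
    have := Real.abs_log_sub_add_sum_range_le (lt_of_le_of_lt hx (by norm_num)) 1
    simp only [Finset.range_one, Finset.sum_singleton, zero_add, pow_one, Nat.cast_zero, div_one,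
      sub_neg_eq_add] at this
    rw [neg_add_eq_sub] at this
    refine this.trans ?_
    rw [div_le_iff₀ (by linarith)]
    have e : |-(α / m)| ^ (1 + 1) = α ^ 2 / m ^ 2 := by
      rw [abs_neg, one_add_one_eq_two, sq_abs, div_pow]
    rw [e]
    have h0 : 0 ≤ α ^ 2 / m ^ 2 := by positivity
    calc α ^ 2 / m ^ 2 = 2 * (α ^ 2 / m ^ 2) * (1 / 2) := by ring
      _ ≤ 2 * (α ^ 2 / m ^ 2) * (1 - |-(α / m)|) := by gcongr; linarith
      _ = _ := by ring
  have b2 : |Real.log (1 - 1 / m) + 1 / m + 1 / (2 * m ^ 2)| ≤ 2 / m ^ 3 := by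
    have hx : |1 / m| ≤ 1 / 2 := by
      rw [abs_div, abs_one, abs_of_pos hm0, div_le_div_iff₀ hm0 two_pos]
      linarith
    have := Real.abs_log_sub_add_sum_range_le (lt_of_le_of_lt hx (by norm_num)) 2
    simp only [Finset.sum_range_succ, Finset.range_zero, Finset.sum_empty, zero_add, pow_one,
      Nat.cast_zero, div_one, Nat.cast_one] at this
    have e0 : 1 / m + (1 / m) ^ (1 + 1) / (1 + 1) + Real.log (1 - 1 / m) =
        Real.log (1 - 1 / m) + 1 / m + 1 / (2 * m ^ 2) := by
      generalize Real.log (1 - 1 / m) = L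
      simp only [Nat.reduceAdd]
      field_simp
      ring
    rw [e0] at this
    refine this.trans ?_
    rw [div_le_iff₀ (by linarith)]
    have e : |1 / m| ^ (2 + 1) = 1 / m ^ 3 := by
      rw [abs_of_pos (by positivity)]
      norm_num
    rw [e]
    calc 1 / m ^ 3 = 2 / m ^ 3 * (1 / 2) := by ring
      _ ≤ 2 / m ^ 3 * (1 - |1 / m|) := by gcongr; linarith
  -- In terms of `m = n + 1` the contributions of order `1` and `1/m` cancel, leaving two Taylor
  -- remainders and an explicit term of order `1/m²`.
  have e1 : stirlingLog α (n + 1) - stirlingLog α n =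
      (Real.log (1 + α / m) - α / m) +
      (m + α - 1 / 2) * (Real.log (1 - 1 / m) + 1 / m + 1 / (2 * m ^ 2)) -
      (α - 1 / 2) / (2 * m ^ 2) := by
    have f1 : Real.log (1 + α / m) = Real.log (n + α + 1) - Real.log m := by
      rw [← Real.log_div hna.ne' hm1]
      congr 1
      rw [hm]
      field_simp
      ring
    have f2 : Real.log (1 - 1 / m) = Real.log n - Real.log m := by
      rw [← Real.log_div hn0.ne' hm1]
      congr 1
      rw [hm]
      field_simp
      ring
    have f3 : Real.log (Real.Gamma ((n + 1 : ℕ) + α + 1)) =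
        Real.log (n + α + 1) + Real.log (Real.Gamma (n + α + 1)) := by
      rw [← Real.log_mul hna.ne' (Real.Gamma_pos_of_pos hna).ne', ← Real.Gamma_add_one hna.ne']
      push_cast
      ring_nf
    rw [f1, f2, stirlingLog, stirlingLog, f3]
    have f4 : ((n + 1 : ℕ) : ℝ) = m := by rw [hm]; push_cast; rfl
    have f5 : (n : ℝ) = m - 1 := by rw [hm]; ring
    rw [f4, f5]
    field_simp
    ring
  have b3 : |(m + α - 1 / 2) * (Real.log (1 - 1 / m) + 1 / m + 1 / (2 * m ^ 2))| ≤
      4 / m ^ 2 := by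
    rw [abs_mul]
    have : |m + α - 1 / 2| ≤ 2 * m := by
      rw [abs_le]
      constructor <;> linarith [neg_abs_le α, le_abs_self α]
    calc _ ≤ 2 * m * (2 / m ^ 3) := by gcongr
      _ = _ := by field_simp; norm_num
  have b4 : |(α - 1 / 2) / (2 * m ^ 2)| ≤ (|α| + 1) / m ^ 2 := by
    rw [abs_div, abs_of_pos (by positivity : 0 < 2 * m ^ 2),
      div_le_div_iff₀ (by positivity) (by positivity)]
    have : |α - 1 / 2| ≤ |α| + 1 := by
      rw [abs_le]
      constructor <;> linarith [neg_abs_le α, le_abs_self α]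
    have h2 := mul_le_mul_of_nonneg_right this (by positivity : 0 ≤ m ^ 2)
    have h3 : 0 ≤ (|α| + 1) * m ^ 2 := by positivity
    linarith
  rw [e1]
  refine (abs_sub _ _).trans ((add_le_add (abs_add_le _ _) le_rfl).trans
    ((add_le_add (add_le_add b1 b3) b4).trans ?_))
  have : 2 * α ^ 2 / m ^ 2 + 4 / m ^ 2 + (|α| + 1) / m ^ 2 =
      (2 * α ^ 2 + |α| + 5) / m ^ 2 := by ring
  rw [this]
  gcongr
  linarith

/-- The increments are `O(1/n²)` and are dominated by a telescoping multiple of `1/n - 1/(n+1)`.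
Summing to infinity, where the limit is known to be `0`, gives the rate. -/
theorem stirlingLog_isBigO {α : ℝ} (hα : -1 < α) :
    stirlingLog α =O[atTop] fun n : ℕ => 1 / (n : ℝ) := by
  set C := 2 * α ^ 2 + |α| + 5 with hC
  have hC0 : 0 ≤ C := by positivity
  refine IsBigO.of_bound (2 * C) ?_
  filter_upwards [eventually_ge_atTop ⌈2 * |α| + 2⌉₊] with n hn
  have hn' : 2 * |α| + 2 ≤ n := (Nat.le_ceil _).trans (by exact_mod_cast hn)
  have ha := abs_nonneg α
  have hn0 : (0 : ℝ) < n := by linarith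
  have key (k : ℕ) : |stirlingLog α (n + k) - stirlingLog α n| ≤
      2 * C * (1 / (n : ℝ) - 1 / (n + k)) := by
    induction k with
    | zero => simp
    | succ k ih =>
      have hk : (0 : ℝ) ≤ k := k.cast_nonneg
      have h1 := abs_stirlingLog_succ_sub_le hα (n := n + k) (by push_cast; linarith)
      push_cast at h1
      have h2 : C / ((n : ℝ) + k) ^ 2 ≤
          2 * C * (1 / ((n : ℝ) + k) - 1 / (n + (k + 1 : ℕ))) := by
        have e : 2 * C * (1 / ((n : ℝ) + k) - 1 / (n + (k + 1 : ℕ))) =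
            2 * C / ((n + k) * (n + k + 1)) := by
          push_cast
          field_simp
          ring
        rw [e, div_le_div_iff₀ (by positivity) (by positivity)]
        nlinarith [mul_nonneg hC0 (by nlinarith : 0 ≤ ((n : ℝ) + k) * (n + k - 1))]
      have h3 := abs_sub_le (stirlingLog α (n + (k + 1))) (stirlingLog α (n + k))
        (stirlingLog α n)
      rw [← add_assoc] at h3 ⊢
      linarith
  have hlim : Tendsto (fun k : ℕ => |stirlingLog α (n + k) - stirlingLog α n|) atTop
      (nhds |0 - stirlingLog α n|) := by
    refine ((Tendsto.sub_const ?_ _).abs)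
    have := (tendsto_add_atTop_iff_nat n).mpr (tendsto_stirlingLog hα)
    simpa [add_comm] using this
  rw [zero_sub, abs_neg] at hlim
  rw [Real.norm_eq_abs, Real.norm_of_nonneg (by positivity)]
  refine le_of_tendsto' hlim fun k => (key k).trans ?_
  gcongr
  have : (0 : ℝ) ≤ 1 / (n + k) := by positivity
  linarith

/-- The quotient of the Stirling approximation and `Γ(n+α+1)`. -/
def stirlingRatio (α : ℝ) (n : ℕ) : ℝ :=
  √(2 * Real.pi) * ((n : ℝ) ^ n * (n : ℝ) ^ (α + 1 / 2)) * Real.exp (-n) / Real.Gamma (n + α + 1)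

theorem stirlingRatio_eq_exp {α : ℝ} (hα : -1 < α) {n : ℕ} (hn : n ≠ 0) :
    stirlingRatio α n = Real.exp (-stirlingLog α n) := by
  have hn0 : (0 : ℝ) < n := by positivity
  have hG := Real.Gamma_pos_of_pos (by linarith : 0 < n + α + 1)
  have hpi := Real.pi_pos
  have h0 : 0 < stirlingRatio α n := by
    rw [stirlingRatio]
    positivity
  rw [← Real.exp_log h0]
  congr 1
  rw [stirlingRatio, Real.log_div (by positivity) hG.ne', Real.log_mul (by positivity)
    (by positivity), Real.log_mul (by positivity) (by positivity), Real.log_mul (by positivity)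
    (by positivity), Real.log_sqrt (by positivity), Real.log_pow, Real.log_rpow hn0, Real.log_exp,
    stirlingLog]
  ring

theorem stirlingRatio_sub_one_isBigO {α : ℝ} (hα : -1 < α) :
    (fun n : ℕ => stirlingRatio α n - 1) =O[atTop] fun n : ℕ => 1 / (n : ℝ) := by
  have h1 : (fun x : ℝ => Real.exp x - 1) =O[nhds 0] fun x => x := by
    have := (Real.hasDerivAt_exp 0).isBigO_sub
    simpa using this
  have h2 : Tendsto (fun n => -stirlingLog α n) atTop (nhds 0) := by
    simpa using (tendsto_stirlingLog hα).neg
  refine ((h1.comp_tendsto h2).trans ?_).congr' ?_ EventuallyEq.rfl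
  · exact (stirlingLog_isBigO hα).neg_left
  · filter_upwards [eventually_ne_atTop 0] with n hn
    simp [stirlingRatio_eq_exp hα hn]

/-! ### Exact formulas for the densities at the edge. -/

theorem wedgeInt_eq_mul_comp {ε : ℝ} (hε : 0 < ε) (g : ℂ → ℂ) :
    wedgeInt g = ε * wedgeInt (fun v => g (ε * v)) := by
  have hε' : (ε : ℂ) ≠ 0 := by exact_mod_cast hε.ne'
  rw [wedgeInt_comp_mul hε, mul_inv_cancel_left₀ hε']

/-- The integrals of `perturbedAiry` for the Hermite phase, divided by `2πi`. -/
def hermiteAiry (ξ ε : ℝ) (k : ℕ) : ℂ :=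
  (2 * Real.pi * Complex.I)⁻¹ *
    wedgeInt (perturbedAiry (fun v => Complex.log (1 + v) - v + v ^ 2 / 2) (fun _ => 0) ξ ε k)

/-- The integrals of `perturbedAiry` for the Laguerre phase, divided by `2πi`. -/
def laguerreAiry (α ξ ε : ℝ) (k : ℕ) : ℂ :=
  (2 * Real.pi * Complex.I)⁻¹ *
    wedgeInt (perturbedAiry (fun v => (Complex.log (1 + v) - Complex.log (1 - v)) / 2 - v)
      (fun v => α * Complex.log (1 + v) - Complex.log (1 - v)) ξ ε k)

/-- Expanding the square with `s = -1 - ξ ε²` gives the constant `N/2 (1 + ξ ε²)²`, the phase `N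
(log(1+v) - v + v²/2)` and the term `-N ξ ε² v`, which is `-ξ u` for `v = ε u`. -/
theorem wedgeInt_hermite_scaled {N : ℕ} {ε : ℝ} (hε : 0 < ε) (hN : N * ε ^ 3 = 1) (ξ : ℝ)
    (k : ℕ) :
    wedgeInt (fun v => v ^ k * ((1 + v) ^ N *
      Complex.exp ((2 * N : ℝ) / 4 * (v + (1 - 2 * (1 + ξ * ε ^ 2 / 2) : ℝ)) ^ 2))) =
      2 * Real.pi * Complex.I *
        (Complex.exp (N / 2 * (1 + ξ * ε ^ 2) ^ 2) * ε ^ (k + 1) * hermiteAiry ξ ε k) := by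
  have hε' : (ε : ℂ) ≠ 0 := by exact_mod_cast hε.ne'
  have hNc : (N : ℂ) * ε ^ 3 = 1 := by exact_mod_cast hN
  have hNε : (N : ℂ) = 1 / ε ^ 3 := by field_simp; exact hNc
  rw [hermiteAiry, mul_left_comm _ _ (wedgeInt _), mul_inv_cancel_left₀ Complex.two_pi_I_ne_zero,
    wedgeInt_eq_mul_comp hε, mul_right_comm, pow_succ' (ε : ℂ) k, mul_left_comm _ (ε : ℂ),
    mul_right_comm]
  congr 1
  rw [← wedgeInt_const_mul]
  refine wedgeInt_congr fun ω hω t ht => ?_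
  set u := (t : ℂ) * ω with hu
  have h1 : 1 + (ε : ℂ) * u ∈ Complex.slitPlane := by
    have : (ε : ℂ) * u = ((ε * t : ℝ) : ℂ) * ω := by rw [hu]; push_cast; ring
    rw [this]
    exact hω.one_add_mem_slitPlane (by positivity)
  have h2 : (1 + (ε : ℂ) * u) ^ N = Complex.exp (N * Complex.log (1 + ε * u)) := by
    rw [Complex.exp_nat_mul, Complex.exp_log (Complex.slitPlane_ne_zero h1)]
  rw [perturbedAiry, h2, mul_pow, ← Complex.exp_add, mul_assoc, mul_assoc,
    mul_left_comm (Complex.exp _), mul_left_comm (Complex.exp _), ← Complex.exp_add]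
  congr 3
  push_cast
  rw [hNε]
  field_simp
  ring

theorem hermiteInt_edge {N : ℕ} {ε : ℝ} (hε : 0 < ε) (hN : N * ε ^ 3 = 1) (ξ : ℝ) :
    hermiteInt (2 * N) (1 - 2 * (1 + ξ * ε ^ 2 / 2)) N =
      2 * Real.pi * Complex.I *
        (Complex.exp (N / 2 * (1 + ξ * ε ^ 2) ^ 2) * ε * hermiteAiry ξ ε 0) ∧
    hermiteInt (2 * N) (1 - 2 * (1 + ξ * ε ^ 2 / 2)) (N + 1) =
      2 * Real.pi * Complex.I * (Complex.exp (N / 2 * (1 + ξ * ε ^ 2) ^ 2) *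
        (ε * hermiteAiry ξ ε 0 + ε ^ 2 * hermiteAiry ξ ε 1)) := by
  have hN0 : (0 : ℝ) < 2 * N := by
    have : (N : ℝ) ≠ 0 := fun h => by rw [h] at hN; simp at hN
    positivity
  have h0 := wedgeInt_hermite_scaled hε hN ξ 0
  have h1 := wedgeInt_hermite_scaled hε hN ξ 1
  simp only [pow_zero, one_mul, zero_add, pow_one] at h0
  have hI (k : ℕ) := wedgeIntegrable_pow_mul_gaussian hN0 (1 - 2 * (1 + ξ * ε ^ 2 / 2)) k
  refine ⟨h0, ?_⟩
  -- The factor `v = (1+v) - 1` relates the first scaled moment to the integrals of orders `N + 1`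
  -- and `N`.
  have h2 : wedgeInt (fun v => v ^ 1 * ((1 + v) ^ N *
      Complex.exp ((2 * N : ℝ) / 4 * (v + (1 - 2 * (1 + ξ * ε ^ 2 / 2) : ℝ)) ^ 2))) =
      hermiteInt (2 * N) (1 - 2 * (1 + ξ * ε ^ 2 / 2)) (N + 1) -
      hermiteInt (2 * N) (1 - 2 * (1 + ξ * ε ^ 2 / 2)) N := by
    have := wedgeInt_add (hI (N + 1)) ((hI N).const_mul (-1))
    rw [wedgeInt_const_mul] at this
    refine Eq.trans (congrArg wedgeInt ?_) (this.trans ?_)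
    · ext v
      push_cast
      ring
    · simp only [hermiteInt]
      ring
  rw [h2] at h1
  have h3 : hermiteInt (2 * N) (1 - 2 * (1 + ξ * ε ^ 2 / 2)) N =
      2 * Real.pi * Complex.I *
        (Complex.exp (N / 2 * (1 + ξ * ε ^ 2) ^ 2) * ε * hermiteAiry ξ ε 0) := h0
  rw [h3] at h1
  linear_combination h1

theorem gueDensity_eq {N : ℕ} (hN : N ≠ 0) (x : ℝ) :
    gueDensity N x = Real.exp (-(2 * N) * x ^ 2) *
      (∑ k ∈ Finset.range N, (hermiteMonic (2 * N) k).eval x ^ 2 / hermiteNorm (2 * N) k) / N := by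
  have hN0 : (0 : ℝ) < 2 * N := by positivity
  have hw : gueWeight N = fun x => Real.exp (-(2 * N) * x ^ 2) := by
    ext x
    rw [gueWeight, neg_mul]
  obtain ⟨n, rfl⟩ := Nat.exists_eq_succ_of_ne_zero hN
  rw [gueDensity, hw, marginalDensity_succ_eq _ _ (hermiteMonic (2 * (n + 1 : ℕ)))
    (fun k => (hermiteMonic_monic_natDegree _ k).1)
    (fun k => (hermiteMonic_monic_natDegree _ k).2) (hermiteNorm (2 * (n + 1 : ℕ)))
    (fun k => (hermiteNorm_pos hN0 k).ne')]
  · push_cast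
    rfl
  · intro i j
    have := integrable_eval_mul_gaussian hN0
      (hermiteMonic (2 * (n + 1 : ℕ)) i * hermiteMonic (2 * (n + 1 : ℕ)) j)
    simpa only [Polynomial.eval_mul, ← mul_assoc] using this.integrableOn
  · intro i j
    rw [setIntegral_univ]
    exact hermiteMonic_orthogonal hN0 i j

/-- The GUE density at the edge in terms of perturbed Airy integrals. -/
theorem gueDensity_edge {N : ℕ} {ε : ℝ} (hε : 0 < ε) (hN : N * ε ^ 3 = 1) (ξ : ℝ) :
    ((ε⁻¹ / 2 * gueDensity N (1 + ξ * ε ^ 2 / 2) : ℝ) : ℂ) =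
      stirlingRatio 0 N * (Complex.exp (ξ ^ 2 / 2 * ε) *
        (hermiteAiry ξ ε 1 ^ 2 - ξ * ε * hermiteAiry ξ ε 0 * hermiteAiry ξ ε 1 -
          ξ * hermiteAiry ξ ε 0 ^ 2)) := by
  have hN1 : N ≠ 0 := fun h => by rw [h] at hN; simp at hN
  have hN0 : (0 : ℝ) < N := by positivity
  have ha : (0 : ℝ) < 2 * N := by positivity
  set x := 1 + ξ * ε ^ 2 / 2 with hx
  obtain ⟨j0, j1⟩ := hermiteInt_edge hε hN ξ
  rw [← hx] at j0 j1
  have q1 := hermiteMonic_eval_eq_hermiteInt ha x N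
  have d1 := hermiteMonic_derivative_eval_eq_hermiteInt ha x N
  have hC := hermite_christoffel ha N x
  have hn := hermiteNorm_pos ha N
  rw [← eq_div_iff hn.ne'] at hC
  rw [j0] at q1 d1
  rw [j1] at d1
  set q := (hermiteMonic (2 * N) N).eval x with hq
  set d := (hermiteMonic (2 * N) N).derivative.eval x with hd
  set A0 := hermiteAiry ξ ε 0
  set A1 := hermiteAiry ξ ε 1
  set E := Complex.exp (N / 2 * (1 + ξ * ε ^ 2) ^ 2) with hE
  set r := √(Real.pi / (2 * N)) with hr
  have hr2 : r ^ 2 = Real.pi / (2 * N) := Real.sq_sqrt (by positivity)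
  have hr0 : 0 < r := by positivity
  have hrc : (r : ℂ) ≠ 0 := by exact_mod_cast hr0.ne'
  have hpi : (Real.pi : ℂ) ≠ 0 := by exact_mod_cast Real.pi_ne_zero
  have hεc : (ε : ℂ) ≠ 0 := by exact_mod_cast hε.ne'
  have hNc : (N : ℂ) * ε ^ 3 = 1 := by exact_mod_cast hN
  have hNc0 : (N : ℂ) ≠ 0 := by exact_mod_cast hN1
  have hq' : (q : ℂ) = Real.pi * E * ε * A0 / (2 ^ N * r) := by
    rw [eq_div_iff (mul_ne_zero (pow_ne_zero _ two_ne_zero) hrc)]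
    refine mul_left_cancel₀ (mul_ne_zero two_ne_zero Complex.I_ne_zero) ?_
    linear_combination q1
  have hd' : (d : ℂ) = 2 * N * Real.pi * E * ((1 + ξ * ε ^ 2) * ε * A0 - ε ^ 2 * A1) /
      (2 ^ N * r) := by
    rw [eq_div_iff (mul_ne_zero (pow_ne_zero _ two_ne_zero) hrc)]
    refine mul_left_cancel₀ (mul_ne_zero two_ne_zero Complex.I_ne_zero) ?_
    rw [hx] at d1
    push_cast at d1
    linear_combination d1
  -- The weight cancels all of `E²` but `exp(-N + N ξ² ε⁴/2)`, and `N ε⁴ = ε`.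
  have hEE : E ^ 2 * Real.exp (-(2 * N) * x ^ 2) =
      Complex.exp (ξ ^ 2 / 2 * ε) * Real.exp (-N) := by
    rw [hE, Complex.ofReal_exp, Complex.ofReal_exp, ← Complex.exp_nat_mul, ← Complex.exp_add,
      ← Complex.exp_add, hx]
    congr 1
    push_cast
    linear_combination (ξ ^ 2 * ε / 2 : ℂ) * hNc
  have hS : (stirlingRatio 0 N : ℂ) = Real.pi * N ^ N * Real.exp (-N) / (N.factorial * r) := by
    rw [stirlingRatio, add_zero, Real.Gamma_nat_eq_factorial, zero_add, ← Real.sqrt_eq_rpow]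
    have : √(2 * Real.pi) * √(N : ℝ) = Real.pi / r := by
      rw [eq_div_iff hr0.ne', hr, ← Real.sqrt_mul (by positivity), ← Real.sqrt_mul (by positivity)]
      rw [show 2 * Real.pi * N * (Real.pi / (2 * N)) = Real.pi ^ 2 by field_simp]
      exact Real.sqrt_sq Real.pi_pos.le
    have h2 : √(2 * Real.pi) * ((N : ℝ) ^ N * √(N : ℝ)) = Real.pi / r * (N : ℝ) ^ N := by
      rw [← this]; ring
    rw [h2]
    push_cast
    field_simp
  have hfac : (N.factorial : ℂ) ≠ 0 := by exact_mod_cast N.factorial_ne_zero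
  have hr2c : (r : ℂ) ^ 2 = Real.pi / (2 * N) := by exact_mod_cast hr2
  have hxc : (x : ℂ) = 1 + ξ * ε ^ 2 / 2 := by rw [hx]; push_cast; rfl
  -- The terms in `ε² A0²` and `ε³ A0 A1` cancel identically, leaving an overall factor `ε⁴`; no
  -- accuracy is lost when `A0` and `A1` are expanded later.
  have hbr : ((d ^ 2 / (2 * (2 * N)) - x * q * d + N * q ^ 2 : ℝ) : ℂ) =
      N * ε ^ 4 * Real.pi ^ 2 * E ^ 2 / (4 ^ N * r ^ 2) *
        (A1 ^ 2 - ξ * ε * A0 * A1 - ξ * A0 ^ 2) := by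
    push_cast
    rw [hq', hd', hxc]
    have h4 : (4 : ℂ) ^ N = (2 ^ N) ^ 2 := by rw [← pow_mul, mul_comm, pow_mul]; norm_num
    rw [h4]
    field_simp
    ring
  have hnorm : (hermiteNorm (2 * N) N : ℂ) = N.factorial / (4 ^ N * N ^ N) * r := by
    rw [hermiteNorm, ← hr, ← mul_pow]
    push_cast
    ring_nf
  rw [hS, ← mul_assoc]
  generalize d ^ 2 / (2 * (2 * N)) - x * q * d + N * q ^ 2 = T at hbr hC
  rw [gueDensity_eq hN1, hC]
  push_cast
  push_cast at hEE
  rw [hbr, hnorm]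
  have e1 : (ε : ℂ)⁻¹ / 2 * (Complex.exp (-(2 * N) * x ^ 2) *
      (N * ε ^ 4 * Real.pi ^ 2 * E ^ 2 / (4 ^ N * r ^ 2) *
        (A1 ^ 2 - ξ * ε * A0 * A1 - ξ * A0 ^ 2) / (N.factorial / (4 ^ N * N ^ N) * r)) / N) =
      (E ^ 2 * Complex.exp (-(2 * N) * x ^ 2)) * (ε ^ 3 * Real.pi ^ 2 * N ^ N /
        (2 * r ^ 2 * (N.factorial * r))) * (A1 ^ 2 - ξ * ε * A0 * A1 - ξ * A0 ^ 2) := by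
    have h4 : (4 : ℂ) ^ N ≠ 0 := pow_ne_zero _ (by norm_num)
    field_simp
  rw [e1, hEE, hr2c]
  have e2 : (ε : ℂ) ^ 3 * Real.pi ^ 2 * N ^ N / (2 * (Real.pi / (2 * N)) * (N.factorial * r)) =
      Real.pi * N ^ N / (N.factorial * r) := by
    have : (ε : ℂ) ^ 3 * Real.pi ^ 2 * N ^ N / (2 * (Real.pi / (2 * N)) * (N.factorial * r)) =
      (N * ε ^ 3) * (Real.pi * N ^ N / (N.factorial * r)) := by field_simp
    rw [this, hNc, one_mul]
  rw [e2]
  ring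

/-- The powers of order `N` together with `-2N v` form the phase, since `2N = 1/ε³`. The leftover
exponents, `α` on `1 + v` and one extra power of `1 - v`, form the amplitude. -/
theorem wedgeInt_laguerre_scaled {N : ℕ} {ε : ℝ} (hε : 0 < ε) (hN : 2 * N * ε ^ 3 = 1)
    (α ξ : ℝ) (k : ℕ) :
    wedgeInt (fun v => v ^ k * (Complex.exp (-(4 * N * (1 + ξ * ε ^ 2) / 2 : ℝ) * v) *
      Complex.exp ((N + α : ℝ) * Complex.log (1 + v)) / (1 - v) ^ (N + 1))) =
      2 * Real.pi * Complex.I * (ε ^ (k + 1) * laguerreAiry α ξ ε k) := by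
  have hε' : (ε : ℂ) ≠ 0 := by exact_mod_cast hε.ne'
  have hNc : 2 * (N : ℂ) * ε ^ 3 = 1 := by exact_mod_cast hN
  have hNε : (N : ℂ) = 1 / (2 * ε ^ 3) := by field_simp; linear_combination hNc
  rw [laguerreAiry, mul_left_comm _ _ (wedgeInt _), mul_inv_cancel_left₀ Complex.two_pi_I_ne_zero,
    wedgeInt_eq_mul_comp hε, pow_succ' (ε : ℂ) k, mul_assoc (ε : ℂ)]
  congr 1
  rw [← wedgeInt_const_mul]
  refine wedgeInt_congr fun ω hω t ht => ?_
  set u := (t : ℂ) * ω with hu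
  have hεu : (ε : ℂ) * u = ((ε * t : ℝ) : ℂ) * ω := by rw [hu]; push_cast; ring
  have h1 : 1 - (ε : ℂ) * u ≠ 0 := by
    rw [hεu]
    exact hω.one_sub_ne_zero _
  have h2 : (1 - (ε : ℂ) * u) ^ (N + 1) =
      Complex.exp ((N + 1 : ℕ) * Complex.log (1 - ε * u)) := by
    rw [Complex.exp_nat_mul, Complex.exp_log h1]
  rw [perturbedAiry, h2, mul_pow, ← Complex.exp_add, ← Complex.exp_sub, mul_assoc]
  congr 3
  push_cast
  rw [hNε]
  field_simp
  ring

theorem laguerreInt_edge {N : ℕ} {ε : ℝ} (hε : 0 < ε) (hN : 2 * N * ε ^ 3 = 1) (α ξ : ℝ)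
    (hx : 0 < 1 + ξ * ε ^ 2) :
    laguerreInt (4 * N * (1 + ξ * ε ^ 2) / 2) (N + α) (N + 1) =
      2 * Real.pi * Complex.I * (ε * laguerreAiry α ξ ε 0) ∧
    laguerreInt (4 * N * (1 + ξ * ε ^ 2) / 2) (N + α) N =
      2 * Real.pi * Complex.I *
        (ε * laguerreAiry α ξ ε 0 - ε ^ 2 * laguerreAiry α ξ ε 1) := by
  have hN0 : (0 : ℝ) < 4 * N * (1 + ξ * ε ^ 2) / 2 := by
    have : (N : ℝ) ≠ 0 := fun h => by rw [h] at hN; simp at hN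
    positivity
  have h0 := wedgeInt_laguerre_scaled hε hN α ξ 0
  have h1 := wedgeInt_laguerre_scaled hε hN α ξ 1
  simp only [pow_zero, one_mul, zero_add, pow_one] at h0 h1
  have hI (k : ℕ) := wedgeIntegrable_laguerre hN0 (N + α) k
  refine ⟨h0, ?_⟩
  have h2 := wedgeInt_add (hI N) ((hI (N + 1)).const_mul (-1))
  rw [wedgeInt_const_mul] at h2
  have h3 : wedgeInt (fun v => (-1 : ℂ) * (v *
      (Complex.exp (-(4 * N * (1 + ξ * ε ^ 2) / 2 : ℝ) * v) *
        Complex.exp ((N + α : ℝ) * Complex.log (1 + v)) / (1 - v) ^ (N + 1)))) =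
      laguerreInt (4 * N * (1 + ξ * ε ^ 2) / 2) (N + α) N +
        (-1) * laguerreInt (4 * N * (1 + ξ * ε ^ 2) / 2) (N + α) (N + 1) := by
    -- Here `-v = (1-v) - 1` lowers the order of the pole by one.
    refine Eq.trans (wedgeInt_congr fun ω hω t ht => ?_) h2
    have := hω.one_sub_ne_zero t
    field_simp
    ring
  rw [wedgeInt_const_mul, h1] at h3
  have h4 : laguerreInt (4 * N * (1 + ξ * ε ^ 2) / 2) (N + α) (N + 1) =
      2 * Real.pi * Complex.I * (ε * laguerreAiry α ξ ε 0) := h0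
  rw [h4] at h3
  linear_combination -h3

theorem lueDensity_eq {α : ℝ} (hα : -1 < α) {N : ℕ} (hN : N ≠ 0) (x : ℝ) :
    lueDensity α N x = laguerreWeight (4 * N) α x *
      (∑ k ∈ Finset.range N, (laguerreMonic (4 * N) k α).eval x ^ 2 / laguerreNorm (4 * N) α k) /
        N := by
  have hN0 : (0 : ℝ) < 4 * N := by positivity
  have hw : lueWeight α N = laguerreWeight (4 * N) α := by
    ext x
    rw [lueWeight, laguerreWeight, neg_mul]
  obtain ⟨n, rfl⟩ := Nat.exists_eq_succ_of_ne_zero hN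
  rw [lueDensity, hw, marginalDensity_succ_eq _ _ (fun k => laguerreMonic (4 * (n + 1 : ℕ)) k α)
    (fun k => (laguerreMonic_monic_natDegree _ k α).1)
    (fun k => (laguerreMonic_monic_natDegree _ k α).2) (laguerreNorm (4 * (n + 1 : ℕ)) α)
    (fun k => (laguerreNorm_pos hN0 hα k).ne')]
  · push_cast
    rfl
  · intro i j
    have := integrableOn_laguerreWeight_mul_eval hN0 hα
      (laguerreMonic (4 * (n + 1 : ℕ)) i α * laguerreMonic (4 * (n + 1 : ℕ)) j α)
    simpa only [Polynomial.eval_mul, ← mul_assoc] using this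
  · intro i j
    exact laguerreMonic_orthogonal hN0 hα i j

/-- The LUE density at the edge in terms of perturbed Airy integrals. -/
theorem lueDensity_edge {α : ℝ} (hα : -1 < α) {N : ℕ} {ε : ℝ} (hε : 0 < ε)
    (hN : 2 * N * ε ^ 3 = 1) {ξ : ℝ} (hx0 : 0 < 1 + ξ * ε ^ 2) :
    ((ε⁻¹ / 2 * lueDensity α N (1 + ξ * ε ^ 2) : ℝ) : ℂ) =
      (stirlingRatio α N / stirlingRatio 0 N : ℝ) * ((1 + ξ * ε ^ 2 : ℝ) ^ α : ℝ) *
        ((1 + ξ * ε ^ 2) * laguerreAiry α ξ ε 1 ^ 2 + (α * ε - ξ) * laguerreAiry α ξ ε 0 ^ 2 -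
          α * ε ^ 2 * laguerreAiry α ξ ε 0 * laguerreAiry α ξ ε 1) := by
  have hN1 : N ≠ 0 := fun h => by rw [h] at hN; simp at hN
  have hN0 : (0 : ℝ) < N := by positivity
  have hb : (0 : ℝ) < 4 * N := by positivity
  set x := 1 + ξ * ε ^ 2 with hx
  obtain ⟨j0, j1⟩ := laguerreInt_edge hε hN α ξ hx0
  rw [← hx] at j0 j1
  have q1 := laguerreMonic_eval_eq_laguerreInt hb hx0 N α
  have d1 := laguerreMonic_derivative_eval_eq_laguerreInt hb hx0 hN1 α
  have hC := laguerre_christoffel hb hα N x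
  have hn := laguerreNorm_pos hb hα N
  rw [← eq_div_iff hn.ne'] at hC
  rw [j0] at q1
  rw [j1] at d1
  set q := (laguerreMonic (4 * N) N α).eval x with hq
  set d := (laguerreMonic (4 * N) N α).derivative.eval x with hd
  set A0 := laguerreAiry α ξ ε 0
  set A1 := laguerreAiry α ξ ε 1
  set κ := Real.exp (-(4 * N * x / 2)) * (2 : ℝ) ^ α * ((4 * N) ^ N / N.factorial) with hκ
  have hfac : (0 : ℝ) < N.factorial := by exact_mod_cast N.factorial_pos
  have hκ0 : 0 < κ := by positivity
  have hκc : (κ : ℂ) ≠ 0 := by exact_mod_cast hκ0.ne'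
  have hεc : (ε : ℂ) ≠ 0 := by exact_mod_cast hε.ne'
  have hNc : 2 * (N : ℂ) * ε ^ 3 = 1 := by exact_mod_cast hN
  have hNε : (N : ℂ) = 1 / (2 * ε ^ 3) := by field_simp; linear_combination hNc
  have hxc : (x : ℂ) = 1 + ξ * ε ^ 2 := by rw [hx]; push_cast; rfl
  have hq' : (q : ℂ) = ε * A0 / κ := by
    rw [eq_div_iff hκc]
    refine mul_left_cancel₀ Complex.two_pi_I_ne_zero ?_
    push_cast at q1
    linear_combination -q1
  have hd' : (d : ℂ) = 2 * N * (ε * A0 - ε ^ 2 * A1) / κ := by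
    rw [eq_div_iff hκc]
    refine mul_left_cancel₀ Complex.two_pi_I_ne_zero ?_
    push_cast at d1
    linear_combination -d1
  -- As for the GUE, the two lowest orders in `ε` coming from the terms without `α` cancel exactly.
  have hbr : (((x * d ^ 2 + (α - 4 * N * x) * q * d + 4 * N * N * q ^ 2) / (4 * N) : ℝ) : ℂ) =
      ((ε ^ 4 * N / κ ^ 2 : ℝ) : ℂ) *
        ((1 + ξ * ε ^ 2) * A1 ^ 2 + (α * ε - ξ) * A0 ^ 2 - α * ε ^ 2 * A0 * A1) := by
    push_cast
    rw [hq', hd', hxc, hNε]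
    field_simp
    ring
  have hG : 0 < Real.Gamma (N + α + 1) := Real.Gamma_pos_of_pos (by linarith)
  -- The exponential factors cancel in this quotient, which makes it the exact prefactor of the LUE
  -- density.
  have hR : stirlingRatio α N / stirlingRatio 0 N =
      N ^ α * N.factorial / Real.Gamma (N + α + 1) := by
    have hs : √(2 * Real.pi) ≠ 0 := (Real.sqrt_pos.2 (by positivity)).ne'
    have hp : (N : ℝ) ^ (1 / 2 : ℝ) ≠ 0 := (Real.rpow_pos_of_pos hN0 _).ne'
    have hg := hG.ne'
    rw [stirlingRatio, stirlingRatio, add_zero, Real.Gamma_nat_eq_factorial, zero_add,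
      Real.rpow_add hN0]
    field_simp
  have hmain : ε⁻¹ / 2 * (laguerreWeight (4 * N) α x *
      ((ε ^ 4 * N / κ ^ 2) / laguerreNorm (4 * N) α N) / N) =
      stirlingRatio α N / stirlingRatio 0 N * x ^ α := by
    have hE : Real.exp (-(4 * N * x / 2)) ^ 2 = Real.exp (-(4 * N * x)) := by
      rw [← Real.exp_nat_mul]
      congr 1
      push_cast
      ring
    have h2 : ((2 : ℝ) ^ α) ^ 2 = 4 ^ α := by
      rw [sq, ← Real.mul_rpow two_pos.le two_pos.le]
      norm_num
    have h4 : (4 : ℝ) ^ α ≠ 0 := (Real.rpow_pos_of_pos (by norm_num) _).ne'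
    have hE0 := (Real.exp_pos (-(4 * N * x))).ne'
    have hg := hG.ne'
    rw [hR, laguerreWeight, laguerreNorm, hκ, mul_pow, mul_pow, hE, h2, div_pow, ← pow_mul,
      mul_comm N 2, Real.rpow_add hb, Real.rpow_one, Real.mul_rpow (by norm_num) hN0.le, neg_mul]
    have hP : (0 : ℝ) < (4 * N) ^ (2 * N) := by positivity
    generalize ((4 : ℝ) * N) ^ (2 * N) = P at hP ⊢
    field_simp
    linear_combination 2 * hN
  generalize (x * d ^ 2 + (α - 4 * N * x) * q * d + 4 * N * N * q ^ 2) / (4 * N) = T at hbr hC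
  rw [lueDensity_eq hα hN1, hC, ← Complex.ofReal_mul, ← hmain]
  push_cast
  push_cast at hbr
  rw [hbr]
  ring

/-! ### Calculus of second order expansions and the resulting coefficients. -/

/-- `f ε = a + b ε + c ε² + O(ε³)` as `ε → 0⁺`. -/
def HasExpansion (f : ℝ → ℂ) (a b c : ℂ) : Prop :=
  (fun ε : ℝ => f ε - (a + b * ε + c * ε ^ 2)) =O[nhdsWithin 0 (Set.Ioi 0)] fun ε : ℝ => ε ^ 3

theorem pow_isBigO_pow_nhdsGT {m n : ℕ} (h : m ≤ n) :
    (fun ε : ℝ => ε ^ n) =O[nhdsWithin 0 (Set.Ioi 0)] fun ε : ℝ => ε ^ m := by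
  refine IsBigO.of_bound 1 ?_
  filter_upwards [Ioo_mem_nhdsGT (zero_lt_one' ℝ)] with ε hε
  rw [one_mul, norm_pow, norm_pow]
  exact pow_le_pow_of_le_one (norm_nonneg _) (by rw [Real.norm_of_nonneg hε.1.le]; exact hε.2.le) h

theorem ofReal_pow_isBigO (n : ℕ) (l : Filter ℝ) :
    (fun ε : ℝ => (ε : ℂ) ^ n) =O[l] fun ε : ℝ => ε ^ n :=
  IsBigO.of_bound 1 (Eventually.of_forall fun ε => by
    rw [one_mul, norm_pow, norm_pow, Complex.norm_real])

theorem ofReal_pow_isBigO_pow {m n : ℕ} (h : m ≤ n) :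
    (fun ε : ℝ => (ε : ℂ) ^ n) =O[nhdsWithin 0 (Set.Ioi 0)] fun ε : ℝ => ε ^ m :=
  (ofReal_pow_isBigO n _).trans (pow_isBigO_pow_nhdsGT h)

namespace HasExpansion

variable {f g : ℝ → ℂ} {a b c a' b' c' : ℂ}

theorem quadratic (a b c : ℂ) : HasExpansion (fun ε => a + b * ε + c * ε ^ 2) a b c := by
  simp only [HasExpansion, sub_self]
  exact isBigO_zero _ _

theorem add (hf : HasExpansion f a b c) (hg : HasExpansion g a' b' c') :
    HasExpansion (fun ε => f ε + g ε) (a + a') (b + b') (c + c') := by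
  refine (IsBigO.add hf hg).congr_left fun ε => ?_
  ring

theorem isBigO_linear (hf : HasExpansion f a b c) :
    (fun ε => f ε - (a + b * ε)) =O[nhdsWithin 0 (Set.Ioi 0)] fun ε : ℝ => ε ^ 2 := by
  have h1 : (fun ε : ℝ => c * (ε : ℂ) ^ 2) =O[nhdsWithin 0 (Set.Ioi 0)] fun ε : ℝ => ε ^ 2 :=
    (ofReal_pow_isBigO 2 _).const_mul_left c
  refine ((hf.trans (pow_isBigO_pow_nhdsGT (by norm_num))).add h1).congr_left fun ε => ?_
  ring

theorem isBigO_const (hf : HasExpansion f a b c) :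
    (fun ε => f ε - a) =O[nhdsWithin 0 (Set.Ioi 0)] fun ε : ℝ => ε ^ 1 := by
  have h1 : (fun ε : ℝ => b * (ε : ℂ) ^ 1) =O[nhdsWithin 0 (Set.Ioi 0)] fun ε : ℝ => ε ^ 1 :=
    (ofReal_pow_isBigO 1 _).const_mul_left b
  refine ((hf.isBigO_linear.trans (pow_isBigO_pow_nhdsGT (by norm_num))).add h1).congr_left
    fun ε => ?_
  ring

theorem isBigO_one (hf : HasExpansion f a b c) :
    f =O[nhdsWithin 0 (Set.Ioi 0)] fun _ : ℝ => (1 : ℝ) := by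
  have h1 := hf.isBigO_const.trans (pow_isBigO_pow_nhdsGT (Nat.zero_le 1))
  simp only [pow_zero] at h1
  refine (h1.add (isBigO_const_const a one_ne_zero _)).congr_left fun ε => ?_
  ring

theorem mul (hf : HasExpansion f a b c) (hg : HasExpansion g a' b' c') :
    HasExpansion (fun ε => f ε * g ε) (a * a') (a * b' + b * a') (a * c' + b * b' + c * a') := by
  have h1 := IsBigO.mul hf hg.isBigO_one
  simp only [mul_one] at h1
  have h2 := IsBigO.mul (quadratic a b c).isBigO_one hg
  simp only [one_mul] at h2
  have h3 := (ofReal_pow_isBigO_pow (le_refl 3)).const_mul_left (b * c' + c * b')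
  have h4 := (ofReal_pow_isBigO_pow (show 3 ≤ 4 by norm_num)).const_mul_left (c * c')
  refine (((h1.add h2).add h3).add h4).congr_left fun ε => ?_
  ring

theorem cexp (hf : HasExpansion f 0 b c) :
    HasExpansion (fun ε => Complex.exp (f ε)) 1 b (c + b ^ 2 / 2) := by
  have h0 := hf.isBigO_const
  simp only [sub_zero] at h0
  have h1 := hf.isBigO_linear
  simp only [zero_add] at h1
  have h2 : (fun ε : ℝ => b * (ε : ℂ)) =O[nhdsWithin 0 (Set.Ioi 0)] fun ε : ℝ => ε ^ 1 := by
    simpa only [pow_one] using (ofReal_pow_isBigO 1 (nhdsWithin 0 (Set.Ioi 0))).const_mul_left b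
  have h3 : Tendsto (fun ε => Real.exp ‖f ε‖) (nhdsWithin 0 (Set.Ioi 0)) (nhds (Real.exp 0)) := by
    have h4 : Tendsto f (nhdsWithin 0 (Set.Ioi 0)) (nhds 0) := by
      refine h0.trans_tendsto ?_
      simp only [pow_one]
      exact tendsto_nhdsWithin_of_tendsto_nhds tendsto_id
    have := (Real.continuous_exp.tendsto ‖(0 : ℂ)‖).comp h4.norm
    rwa [norm_zero] at this
  have h5 : (fun ε => ‖f ε‖ ^ 3 * Real.exp ‖f ε‖) =O[nhdsWithin 0 (Set.Ioi 0)]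
      fun ε : ℝ => ε ^ 3 :=
    ((h0.norm_left.pow 3).mul (h3.isBigO_one ℝ)).congr_right fun ε => by ring
  have h6 : (fun ε => ‖f ε - b * ε‖ * (‖f ε‖ + ‖b * ε‖)) =O[nhdsWithin 0 (Set.Ioi 0)]
      fun ε : ℝ => ε ^ 3 :=
    (h1.norm_left.mul (h0.norm_left.add h2.norm_left)).congr_right fun ε => by ring
  have h7 : (fun ε => ‖f ε - (b * ε + c * ε ^ 2)‖) =O[nhdsWithin 0 (Set.Ioi 0)]
      fun ε : ℝ => ε ^ 3 := by
    simpa only [HasExpansion, zero_add] using IsBigO.norm_left hf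
  refine IsBigO.trans (IsBigO.of_bound 1 (Eventually.of_forall fun ε => ?_)) ((h5.add h7).add h6)
  rw [one_mul, show (1 : ℂ) + b * ε + (c + b ^ 2 / 2) * ε ^ 2 =
    1 + b * ε + (c * ε ^ 2 + (b * ε) ^ 2 / 2) by ring]
  exact (norm_exp_sub_quadratic_le _ _ _).trans (le_abs_self _)

end HasExpansion

/-- The moments `airyMoment ξ k / (2πi)` in terms of `A = Ai ξ` and `B = Ai' ξ`. -/
def airyPoly (ξ A B : ℂ) : ℕ → ℂ
  | 0 => A
  | 1 => -B
  | 2 => ξ * A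
  | k + 3 => ξ * airyPoly ξ A B (k + 1) - (k + 1) * airyPoly ξ A B k

theorem inv_mul_airyMoment (ξ : ℝ) (k : ℕ) :
    (2 * Real.pi * Complex.I)⁻¹ * airyMoment ξ k = airyPoly ξ (airyAi ξ) (deriv airyAi ξ : ℝ) k := by
  rw [inv_mul_eq_iff_eq_mul₀ Complex.two_pi_I_ne_zero]
  induction k using airyPoly.induct with
  | case1 => rw [airyMoment_zero, airyPoly]
  | case2 => rw [airyMoment_one, airyPoly]; ring
  | case3 => rw [airyMoment_two, airyMoment_zero, airyPoly]; ring
  | case4 k h1 h2 =>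
    rw [airyMoment_add_three, h1, h2, airyPoly]
    ring

theorem AiryPhase.hasExpansion {h μ : ℂ → ℂ} {a₄ a₅ m₁ m₂ : ℂ} {C c κ : ℝ}
    (H : AiryPhase h μ a₄ a₅ m₁ m₂ C c κ) (ξ : ℝ) (k : ℕ) {M : ℕ → ℂ}
    (hM : airyPoly ξ (airyAi ξ) (deriv airyAi ξ : ℝ) = M) :
    HasExpansion (fun ε => (2 * Real.pi * Complex.I)⁻¹ * wedgeInt (perturbedAiry h μ ξ ε k))
      (M k) (a₄ * M (k + 4) + m₁ * M (k + 1)) (a₅ * M (k + 5) + m₂ * M (k + 2) +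
        (a₄ ^ 2 * M (k + 8) + 2 * a₄ * m₁ * M (k + 5) + m₁ ^ 2 * M (k + 2)) / 2) := by
  refine ((H.wedgeInt_perturbedAiry_isBigO ξ k).const_mul_left
    (2 * Real.pi * Complex.I)⁻¹).congr_left fun ε => ?_
  simp only [← hM, ← inv_mul_airyMoment]
  ring

theorem hasExpansion_one_add_rpow (α ξ : ℝ) :
    HasExpansion (fun ε => ((1 + ξ * ε ^ 2 : ℝ) ^ α : ℝ)) 1 0 (α * ξ) := by
  have ht : Tendsto (fun ε : ℝ => ξ * ε ^ 2) (nhdsWithin 0 (Set.Ioi 0)) (nhds 0) := by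
    have : Continuous fun ε : ℝ => ξ * ε ^ 2 := by fun_prop
    simpa using tendsto_nhdsWithin_of_tendsto_nhds (this.tendsto 0)
  have hs := ht.eventually (Metric.ball_mem_nhds 0 (by norm_num : (0 : ℝ) < 1 / 2))
  simp only [dist_zero_right] at hs
  have h1 : HasExpansion (fun ε => α * Complex.log (1 + ((ξ * ε ^ 2 : ℝ) : ℂ))) 0 0 (α * ξ) := by
    have h2 : (fun ε : ℝ => Complex.log (1 + ((ξ * ε ^ 2 : ℝ) : ℂ)) - (((ξ * ε ^ 2 : ℝ) : ℂ) -
        ((ξ * ε ^ 2 : ℝ) : ℂ) ^ 2 / 2)) =O[nhdsWithin 0 (Set.Ioi 0)] fun ε : ℝ => ε ^ 3 := by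
      refine IsBigO.trans (g := fun ε : ℝ => |ξ| ^ 3 * ε ^ 6) (IsBigO.of_bound 1 ?_)
        ((pow_isBigO_pow_nhdsGT (by norm_num)).const_mul_left _)
      filter_upwards [hs] with ε hε
      refine (norm_log_sub_taylor_two_le (by rw [Complex.norm_real]; exact hε.le)).trans ?_
      rw [one_mul, Complex.norm_real, norm_mul, norm_mul, norm_pow, norm_pow, norm_pow,
        Real.norm_eq_abs, Real.norm_eq_abs, Real.norm_eq_abs, abs_abs]
      exact le_of_eq (by ring)
    have h3 := (ofReal_pow_isBigO_pow (show 3 ≤ 4 by norm_num)).const_mul_left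
      (-((α : ℂ) * ξ ^ 2 / 2))
    refine ((h2.const_mul_left (α : ℂ)).add h3).congr_left fun ε => ?_
    push_cast
    ring
  have h4 := h1.cexp
  rw [zero_pow two_ne_zero, zero_div, add_zero] at h4
  refine IsBigO.congr' h4 ?_ EventuallyEq.rfl
  filter_upwards [hs] with ε hε
  have hx : 0 < 1 + ξ * ε ^ 2 := by
    have := (abs_lt.1 hε).1
    linarith
  congr 1
  have h5 : 1 + ((ξ * ε ^ 2 : ℝ) : ℂ) = ((1 + ξ * ε ^ 2 : ℝ) : ℂ) := by push_cast; rfl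
  rw [Real.rpow_def_of_pos hx, h5, ← Complex.ofReal_log hx.le, Complex.ofReal_exp,
    Complex.ofReal_mul, mul_comm]

/-- The coefficient of `ε` vanishes because the quartic term of the phase and the cross term
together contribute `-ξ²/2` times the leading term, which the factor `exp(ξ² ε/2)` compensates. -/
theorem hasExpansion_gue (ξ : ℝ) :
    HasExpansion (fun ε => Complex.exp (ξ ^ 2 / 2 * ε) *
      (hermiteAiry ξ ε 1 ^ 2 - ξ * ε * hermiteAiry ξ ε 0 * hermiteAiry ξ ε 1 -
        ξ * hermiteAiry ξ ε 0 ^ 2))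
      ((deriv airyAi ξ ^ 2 - ξ * airyAi ξ ^ 2 : ℝ) : ℂ) 0
      ((-(1 / 20 * (3 * ξ ^ 2 * airyAi ξ ^ 2 - 2 * ξ * deriv airyAi ξ ^ 2 -
        3 * airyAi ξ * deriv airyAi ξ)) : ℝ) : ℂ) := by
  obtain ⟨M, hM⟩ : ∃ M, airyPoly ξ (airyAi ξ) (deriv airyAi ξ : ℝ) = M := ⟨_, rfl⟩
  have h0 := airyPhase_hermite.hasExpansion ξ 0 hM
  have h1 := airyPhase_hermite.hasExpansion ξ 1 hM
  have he : HasExpansion (fun ε : ℝ => Complex.exp (ξ ^ 2 / 2 * ε)) 1 (ξ ^ 2 / 2)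
      (0 + (ξ ^ 2 / 2) ^ 2 / 2) :=
    HasExpansion.cexp (by simpa using HasExpansion.quadratic 0 (ξ ^ 2 / 2 : ℂ) 0)
  have hl : HasExpansion (fun ε : ℝ => -ξ * (ε : ℂ)) 0 (-ξ) 0 := by
    simpa using HasExpansion.quadratic 0 (-ξ : ℂ) 0
  have hc : HasExpansion (fun ε : ℝ => -(ξ : ℂ)) (-ξ) 0 0 := by
    simpa using HasExpansion.quadratic (-ξ : ℂ) 0 0
  have key := he.mul (((h1.mul h1).add (hl.mul (h0.mul h1))).add (hc.mul (h0.mul h0)))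
  convert key using 1
  · ext ε
    simp only [hermiteAiry]
    ring
  all_goals
    simp only [← hM, airyPoly]
    push_cast
    ring

theorem hasExpansion_lue (α ξ : ℝ) :
    HasExpansion (fun ε => ((1 + ξ * ε ^ 2 : ℝ) ^ α : ℝ) *
      ((1 + ξ * ε ^ 2) * laguerreAiry α ξ ε 1 ^ 2 + (α * ε - ξ) * laguerreAiry α ξ ε 0 ^ 2 -
          α * ε ^ 2 * laguerreAiry α ξ ε 0 * laguerreAiry α ξ ε 1))
      ((deriv airyAi ξ ^ 2 - ξ * airyAi ξ ^ 2 : ℝ) : ℂ) ((α * airyAi ξ ^ 2 : ℝ) : ℂ)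
      ((1 / 5 * (3 * ξ ^ 2 * airyAi ξ ^ 2 - 2 * ξ * deriv airyAi ξ ^ 2 +
        (2 - 5 * α ^ 2) * airyAi ξ * deriv airyAi ξ) : ℝ) : ℂ) := by
  obtain ⟨M, hM⟩ : ∃ M, airyPoly ξ (airyAi ξ) (deriv airyAi ξ : ℝ) = M := ⟨_, rfl⟩
  have h0 := (airyPhase_laguerre α).hasExpansion ξ 0 hM
  have h1 := (airyPhase_laguerre α).hasExpansion ξ 1 hM
  have key := (hasExpansion_one_add_rpow α ξ).mul
    ((((HasExpansion.quadratic 1 0 ξ).mul (h1.mul h1)).add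
      ((HasExpansion.quadratic (-ξ) α 0).mul (h0.mul h0))).add
      ((HasExpansion.quadratic 0 0 (-α)).mul (h0.mul h1)))
  convert key using 1
  · ext ε
    simp only [laguerreAiry]
    ring
  all_goals
    simp only [← hM, airyPoly]
    push_cast
    ring

/-- The Stirling factor differs from `1` by `O(1/n)`, no more than the error already allowed, so it
does not affect the coefficients. -/
theorem HasExpansion.isBigO_seq {G : ℝ → ℂ} {a b c : ℂ} (H : HasExpansion G a b c) {s : ℕ → ℝ}
    (hs : (fun n => s n - 1) =O[atTop] fun n : ℕ => 1 / (n : ℝ)) {ε : ℕ → ℝ}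
    (hε : Tendsto ε atTop (nhdsWithin 0 (Set.Ioi 0)))
    (hε3 : (fun n => ε n ^ 3) =O[atTop] fun n : ℕ => 1 / (n : ℝ)) :
    (fun n => (s n : ℂ) * G (ε n) - (a + b * ε n + c * ε n ^ 2)) =O[atTop]
      fun n : ℕ => 1 / (n : ℝ) := by
  have h1 := (IsBigO.comp_tendsto H hε).trans hε3
  have hs' : (fun n => ((s n - 1 : ℝ) : ℂ)) =O[atTop] fun n : ℕ => 1 / (n : ℝ) :=
    Complex.isBigO_ofReal_left.2 hs
  have h2 := hs'.mul (H.isBigO_one.comp_tendsto hε)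
  simp only [Function.comp_apply, mul_one] at h2
  refine (h2.add h1).congr_left fun n => ?_
  simp only [Function.comp_apply]
  push_cast
  ring

/-! ### Return from `ε` to powers of `N`. -/

theorem rpow_neg_third {y : ℝ} (hy : 0 < y) :
    0 < y ^ (-(1 / 3) : ℝ) ∧ y * (y ^ (-(1 / 3) : ℝ)) ^ 3 = 1 ∧
    y ^ (1 / 3 : ℝ) = (y ^ (-(1 / 3) : ℝ))⁻¹ ∧ y ^ (2 / 3 : ℝ) = ((y ^ (-(1 / 3) : ℝ)) ^ 2)⁻¹ := by
  refine ⟨Real.rpow_pos_of_pos hy _, ?_, ?_, ?_⟩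
  · rw [← Real.rpow_mul_natCast hy.le]
    norm_num [Real.rpow_neg_one, hy.ne']
  · rw [← Real.rpow_neg hy.le, neg_neg]
  · rw [← Real.rpow_mul_natCast hy.le, ← Real.rpow_neg hy.le]
    norm_num

theorem tendsto_rpow_neg_third {y : ℕ → ℝ} (hy : Tendsto y atTop atTop) :
    Tendsto (fun n => y n ^ (-(1 / 3) : ℝ)) atTop (nhdsWithin 0 (Set.Ioi 0)) := by
  refine tendsto_nhdsWithin_iff.2 ⟨(tendsto_rpow_neg_atTop (by norm_num)).comp hy, ?_⟩
  filter_upwards [hy.eventually_gt_atTop 0] with n hn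
  exact Real.rpow_pos_of_pos hn _

theorem stirlingRatio_div_sub_one_isBigO {α : ℝ} (hα : -1 < α) :
    (fun n : ℕ => stirlingRatio α n / stirlingRatio 0 n - 1) =O[atTop]
      fun n : ℕ => 1 / (n : ℝ) := by
  have h0 := stirlingRatio_sub_one_isBigO neg_one_lt_zero
  have h1 := stirlingRatio_sub_one_isBigO hα
  have ht : Tendsto (stirlingRatio 0) atTop (nhds 1) := by
    have := (h0.trans_tendsto tendsto_one_div_atTop_nhds_zero_nat).add_const 1
    simpa using this
  have h2 := (h1.sub h0).mul ((ht.inv₀ one_ne_zero).isBigO_one ℝ)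
  refine IsBigO.congr' h2 ?_ (Eventually.of_forall fun n => mul_one _)
  filter_upwards [ht.eventually_ne one_ne_zero] with n hn
  field_simp
  ring

theorem gueDensity_edge_expansion (ξ : ℝ) :
    (fun N : ℕ =>
        (N : ℝ) ^ (1 / 3 : ℝ) / 2 * gueDensity N (1 + ξ / (2 * (N : ℝ) ^ (2 / 3 : ℝ))) -
          ((deriv airyAi ξ) ^ 2 - ξ * (airyAi ξ) ^ 2 -
            1 / 20 * (3 * ξ ^ 2 * (airyAi ξ) ^ 2 - 2 * ξ * (deriv airyAi ξ) ^ 2 -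
              3 * airyAi ξ * deriv airyAi ξ) * (1 / (N : ℝ) ^ (2 / 3 : ℝ))))
      =O[atTop] fun N : ℕ => 1 / (N : ℝ) := by
  rw [← Complex.isBigO_ofReal_left]
  have hε3 : (fun N : ℕ => ((N : ℝ) ^ (-(1 / 3) : ℝ)) ^ 3) =O[atTop] fun N : ℕ => 1 / (N : ℝ) := by
    refine EventuallyEq.isBigO ?_
    filter_upwards [eventually_gt_atTop 0] with N hN
    have hN' : (0 : ℝ) < N := by exact_mod_cast hN
    rw [eq_div_iff hN'.ne', mul_comm]
    exact (rpow_neg_third hN').2.1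
  refine IsBigO.congr' ((hasExpansion_gue ξ).isBigO_seq
    (stirlingRatio_sub_one_isBigO neg_one_lt_zero)
    (tendsto_rpow_neg_third tendsto_natCast_atTop_atTop) hε3) ?_ EventuallyEq.rfl
  filter_upwards [eventually_gt_atTop 0] with N hN
  have hN' : (0 : ℝ) < N := by exact_mod_cast hN
  obtain ⟨h0, h1, h2, h3⟩ := rpow_neg_third hN'
  rw [h2, h3, Complex.ofReal_sub (_ * gueDensity _ _)]
  set ε := (N : ℝ) ^ (-(1 / 3) : ℝ)
  rw [show ξ / (2 * (ε ^ 2)⁻¹) = ξ * ε ^ 2 / 2 by field_simp, gueDensity_edge h0 h1]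
  congr 1
  push_cast
  field_simp
  ring

theorem lueDensity_edge_expansion {α : ℝ} (hα : -1 < α) (ξ : ℝ) :
    (fun N : ℕ =>
          (2 * (N : ℝ)) ^ (1 / 3 : ℝ) / 2 *
              lueDensity α N (1 + ξ / (2 * (N : ℝ)) ^ (2 / 3 : ℝ)) -
            ((deriv airyAi ξ) ^ 2 - ξ * (airyAi ξ) ^ 2 +
              α / (2 : ℝ) ^ (1 / 3 : ℝ) * (airyAi ξ) ^ 2 * (1 / (N : ℝ) ^ (1 / 3 : ℝ)) +
              (2 : ℝ) ^ (1 / 3 : ℝ) / 10 *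
                (3 * ξ ^ 2 * (airyAi ξ) ^ 2 - 2 * ξ * (deriv airyAi ξ) ^ 2 +
                  (2 - 5 * α ^ 2) * airyAi ξ * deriv airyAi ξ) * (1 / (N : ℝ) ^ (2 / 3 : ℝ))))
        =O[atTop] fun N : ℕ => 1 / (N : ℝ) := by
  rw [← Complex.isBigO_ofReal_left]
  have hε3 : (fun N : ℕ => ((2 * N : ℝ) ^ (-(1 / 3) : ℝ)) ^ 3) =O[atTop]
      fun N : ℕ => 1 / (N : ℝ) := by
    refine ((isBigO_refl _ _).const_mul_left (1 / 2 : ℝ)).congr' ?_ EventuallyEq.rfl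
    filter_upwards [eventually_gt_atTop 0] with N hN
    have hN' : (0 : ℝ) < N := by exact_mod_cast hN
    have := (rpow_neg_third (show (0 : ℝ) < 2 * N by positivity)).2.1
    field_simp
    linear_combination -this
  have hy : Tendsto (fun N : ℕ => (2 * N : ℝ)) atTop atTop :=
    tendsto_natCast_atTop_atTop.const_mul_atTop two_pos
  have ht := tendsto_rpow_neg_third hy
  -- For negative `ξ` the evaluation point enters `(0, ∞)` only once `N` is large.
  have hpos : ∀ᶠ N : ℕ in atTop, 0 < 1 + ξ * ((2 * N : ℝ) ^ (-(1 / 3) : ℝ)) ^ 2 := by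
    have hc : Continuous fun ε : ℝ => 1 + ξ * ε ^ 2 := by fun_prop
    refine ((hc.tendsto 0).comp (ht.mono_right nhdsWithin_le_nhds)).eventually_const_lt ?_
    norm_num
  refine IsBigO.congr' ((hasExpansion_lue α ξ).isBigO_seq
    (stirlingRatio_div_sub_one_isBigO hα) ht hε3) ?_ EventuallyEq.rfl
  filter_upwards [eventually_gt_atTop 0, hpos] with N hN hx
  have hN' : (0 : ℝ) < N := by exact_mod_cast hN
  obtain ⟨h0, h1, h2, h3⟩ := rpow_neg_third (show (0 : ℝ) < 2 * N by positivity)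
  have h4 : 1 / (N : ℝ) ^ (1 / 3 : ℝ) = (2 : ℝ) ^ (1 / 3 : ℝ) * (2 * N : ℝ) ^ (-(1 / 3) : ℝ) := by
    have h5 := Real.rpow_pos_of_pos hN' (1 / 3)
    have h6 : (0 : ℝ) < 2 ^ (1 / 3 : ℝ) := by positivity
    rw [Real.rpow_neg (by positivity), Real.mul_rpow two_pos.le hN'.le]
    field_simp
  -- Since `2^(1/3) · 2^(2/3) = 2`, the constant `2^(1/3)/10` equals `2^(-2/3)/5`.
  have h5 : (2 : ℝ) ^ (1 / 3 : ℝ) / 10 * (1 / (N : ℝ) ^ (2 / 3 : ℝ)) =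
      1 / 5 * ((2 * N : ℝ) ^ (-(1 / 3) : ℝ)) ^ 2 := by
    have h6 := Real.rpow_pos_of_pos hN' (2 / 3)
    have h7 : (2 : ℝ) ^ (1 / 3 : ℝ) * 2 ^ (2 / 3 : ℝ) = 2 := by
      rw [← Real.rpow_add two_pos]
      norm_num
    have h8 : (0 : ℝ) < 2 ^ (2 / 3 : ℝ) := by positivity
    rw [← inv_inv (((2 * N : ℝ) ^ (-(1 / 3) : ℝ)) ^ 2), ← h3, Real.mul_rpow two_pos.le hN'.le]
    field_simp
    linear_combination 5 * h7
  have h6 : (2 : ℝ) ^ (1 / 3 : ℝ) ≠ 0 := by positivity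
  rw [mul_right_comm ((2 : ℝ) ^ (1 / 3 : ℝ) / 10), h5, h4, h2, h3, Complex.ofReal_sub (_ * lueDensity _ _ _)]
  set ε := (2 * N : ℝ) ^ (-(1 / 3) : ℝ)
  rw [div_inv_eq_mul, lueDensity_edge hα h0 h1 hx]
  congr 1
  · ring
  · have : α / (2 : ℝ) ^ (1 / 3 : ℝ) * airyAi ξ ^ 2 * ((2 : ℝ) ^ (1 / 3 : ℝ) * ε) =
        α * airyAi ξ ^ 2 * ε := by field_simp
    rw [this]
    push_cast
    ring

end

theorem mainTheorem2 (ξ : ℝ) :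
    ((fun N : ℕ =>
        (N : ℝ) ^ (1 / 3 : ℝ) / 2 * gueDensity N (1 + ξ / (2 * (N : ℝ) ^ (2 / 3 : ℝ))) -
          ((deriv airyAi ξ) ^ 2 - ξ * (airyAi ξ) ^ 2 -
            1 / 20 * (3 * ξ ^ 2 * (airyAi ξ) ^ 2 - 2 * ξ * (deriv airyAi ξ) ^ 2 -
              3 * airyAi ξ * deriv airyAi ξ) * (1 / (N : ℝ) ^ (2 / 3 : ℝ))))
      =O[atTop] fun N : ℕ => 1 / (N : ℝ)) ∧
    ∀ α : ℝ, -1 < α →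
      ((fun N : ℕ =>
          (2 * (N : ℝ)) ^ (1 / 3 : ℝ) / 2 *
              lueDensity α N (1 + ξ / (2 * (N : ℝ)) ^ (2 / 3 : ℝ)) -
            ((deriv airyAi ξ) ^ 2 - ξ * (airyAi ξ) ^ 2 +
              α / (2 : ℝ) ^ (1 / 3 : ℝ) * (airyAi ξ) ^ 2 * (1 / (N : ℝ) ^ (1 / 3 : ℝ)) +
              (2 : ℝ) ^ (1 / 3 : ℝ) / 10 *
                (3 * ξ ^ 2 * (airyAi ξ) ^ 2 - 2 * ξ * (deriv airyAi ξ) ^ 2 +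
                  (2 - 5 * α ^ 2) * airyAi ξ * deriv airyAi ξ) * (1 / (N : ℝ) ^ (2 / 3 : ℝ))))
        =O[atTop] fun N : ℕ => 1 / (N : ℝ)) := by
  exact ⟨gueDensity_edge_expansion ξ, fun α hα => lueDensity_edge_expansion hα ξ⟩
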